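/- Let $G=(V,E)$ be an infinite connected simple graph with bounded degrees, and let $(S_n,P^x)$ be the simple random walk on $G$ (each step is to a uniformly chosen neighbour). Put $p_n(x,y)=P^x(S_n=y)$ and $T_x=\inf\{k\ge 1: S_k=x\}$. Assume that $G$ is uniformly weakly recurrent: there are constants $c,C>0$ with $c\le n\,(p_n(x,x)+p_{n+1}(x,x))\le C$ for all $n\ge 1$ and all $x\in V$. Let $$r_{\inf}=\liminf_{n\to\infty}(\log n)\inf_{x\in V}P^x(T_x>n),\qquad r_{\sup}=\limsup_{n\to\infty}(\log n)\sup_{x\in V}P^x(T_x>n).$$ The lamplighter graph $\{0,1\}\wr G$ has as vertices the pairs $(f,v)$ with $f:V\to\{0,1\}$ finitely supported and $v\in V$; $(f,u)$ and $(g,v)$ are adjacent if either $f=g$ and $u,v$ are adjacent in $G$, or $u=v$ and $f,g$ differ exactly at $u$. Let $d$ be its graph distance. Let $(Y_n)$ be either the simple random walk on the graph $\{0,1\}\wr G$, or the switch-walk-switch walk on $\{0,1\}\wr G$ (in one step from $(f,u)$: the lamp at $u$ is set to a uniform state in $\{0,1\}$, the lamplighter moves from $u$ to a uniformly chosen neighbour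 $v$ in $G$, and the lamp at $v$ is set to a uniform state, all choices being independent), and let $P^x_{\{0,1\}\wr G}$ be its law when started at $x$. Then, in both cases, for every vertex $x$ of $\{0,1\}\wr G$: (i) $$\limsup_{n\to\infty}\frac{d(Y_0,Y_n)}{n/\log n}\le\Bigl(2\max_{v\in V}\deg(v)+1\Bigr)r_{\sup}\quad P^x_{\{0,1\}\wr G}\text{-a.s.},$$ and for every $\epsilon>0$, $$\lim_{n\to\infty}P^x_{\{0,1\}\wr G}\Bigl(\frac{d(Y_0,Y_n)}{n/\log n}\le\frac{r_{\inf}}{4}-\epsilon\Bigr)=0.$$ (ii) If furthermore $G$ is Ahlfors $\alpha$-regular for some $\alpha>0$, that is, there are $c_1,c_2>0$ with $c_1n^\alpha\le|\{y\in V: d_G(x,y)\le n\}|\le c_2n^\alpha$ for all $n\ge 1$ and all $x\in V$, where $d_G$ is the graph distance of $G$, then $$\liminf_{n\to\infty}\frac{d(Y_0,Y_n)}{n/\log n}\ge\frac{r_{\inf}}{4}\quad P^x_{\{0,1\}\wr G}\text{-a.s.}$$ -/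

import Mathlib

open Filter Topology MeasureTheory ProbabilityTheory

noncomputable section

namespace Lamplighter

/-! ### Markov chains on a discrete state space -/

section Chain

variable {V : Type*} [MeasurableSpace V] [DiscreteMeasurableSpace V]

/-- The one-step transition probabilities `Q` as a kernel from histories up to time `n` to the
state at time `n + 1`; it depends on the history only through its last state. -/
def stepKernel (Q : V → PMF V) (n : ℕ) : Kernel (Π _ : Finset.Iic n, V) V where
  toFun h := (Q (h ⟨n, Finset.mem_Iic.2 le_rfl⟩)).toMeasure
  measurable' :=
    (Measurable.of_discrete (f := fun v : V => (Q v).toMeasure)).comp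
      (measurable_pi_apply (⟨n, Finset.mem_Iic.2 le_rfl⟩ : Finset.Iic n))

instance (Q : V → PMF V) (n : ℕ) : IsMarkovKernel (stepKernel Q n) :=
  ⟨fun h => PMF.toMeasure.isProbabilityMeasure (Q (h ⟨n, Finset.mem_Iic.2 le_rfl⟩))⟩

/-- The law `P^x`, on the path space `ℕ → V`, of the time-homogeneous Markov chain with one-step
transition probabilities `Q` started at `x`. The chain itself is the coordinate process. -/
def chainLaw (Q : V → PMF V) (x : V) : Measure (ℕ → V) :=
  Kernel.trajMeasure (X := fun _ => V) (Measure.dirac x) (stepKernel Q)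

end Chain

/-! ### Simple random walk on a graph -/

/-- One step of the simple random walk on a locally finite graph: the next state is uniform among
the neighbours of the present one. (An isolated vertex is absorbing.) -/
def srwStep {V : Type*} (G : SimpleGraph V) [G.LocallyFinite] (v : V) : PMF V :=
  open Classical in
  if h : (G.neighborFinset v).Nonempty then PMF.uniformOfFinset (G.neighborFinset v) h
  else PMF.pure v

section Walk

variable {V : Type*} [MeasurableSpace V] [DiscreteMeasurableSpace V]

/-- The heat kernel `p_n(x, y) = P^x(S_n = y)` of the simple random walk. -/
def heatKernel (G : SimpleGraph V) [G.LocallyFinite] (n : ℕ) (x y : V) : ℝ :=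
  (chainLaw (srwStep G) x).real {ω | ω n = y}

/-- There are `c, C > 0` with `c ≤ n (p_n(x, x) + p_{n+1}(x, x)) ≤ C` for all `n ≥ 1` and all `x`. -/
def UniformlyWeaklyRecurrent (G : SimpleGraph V) [G.LocallyFinite] : Prop :=
  ∃ c C : ℝ, 0 < c ∧ 0 < C ∧ ∀ n : ℕ, 1 ≤ n → ∀ x : V,
    c ≤ n * (heatKernel G n x x + heatKernel G (n + 1) x x) ∧
      n * (heatKernel G n x x + heatKernel G (n + 1) x x) ≤ C

/-- `T_x = inf {k ≥ 1 : S_k = x}`, equal to `⊤` if the path does not visit `x` after time `0`. -/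
def returnTime (x : V) (ω : ℕ → V) : ℕ∞ :=
  sInf ((fun k : ℕ => (k : ℕ∞)) '' {k | 1 ≤ k ∧ ω k = x})

/-- `P^x(T_x > n)` for the simple random walk. -/
def noReturnProb (G : SimpleGraph V) [G.LocallyFinite] (n : ℕ) (x : V) : ℝ :=
  (chainLaw (srwStep G) x).real {ω | (n : ℕ∞) < returnTime x ω}

/-- `r_inf = liminf_n (log n) inf_x P^x(T_x > n)`, as an extended real number. -/
def rInf (G : SimpleGraph V) [G.LocallyFinite] : EReal :=
  liminf (fun n : ℕ => ((Real.log n * ⨅ x : V, noReturnProb G n x : ℝ) : EReal)) atTop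

/-- `r_sup = limsup_n (log n) sup_x P^x(T_x > n)`, as an extended real number. -/
def rSup (G : SimpleGraph V) [G.LocallyFinite] : EReal :=
  limsup (fun n : ℕ => ((Real.log n * ⨆ x : V, noReturnProb G n x : ℝ) : EReal)) atTop

end Walk

/-- Ahlfors `d`-regularity: `c₁ n^d ≤ |B(x, n)| ≤ c₂ n^d` for all `n ≥ 1` and all `x`, where
`B(x, n)` is the closed ball for the graph distance. -/
def AhlforsRegular {V : Type*} (G : SimpleGraph V) (d : ℝ) : Prop :=
  ∃ c₁ c₂ : ℝ, 0 < c₁ ∧ 0 < c₂ ∧ ∀ n : ℕ, 1 ≤ n → ∀ x : V,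
    c₁ * (n : ℝ) ^ d ≤ ({y | G.dist x y ≤ n}.ncard : ℝ) ∧
      ({y | G.dist x y ≤ n}.ncard : ℝ) ≤ c₂ * (n : ℝ) ^ d

/-! ### The lamplighter graph -/

/-- A vertex of the wreath product `{0,1} ≀ G`: a finitely supported configuration of lamps
together with the position of the lamplighter. -/
@[ext]
structure LampState (V : Type*) where
  lamps : V →₀ ZMod 2
  pos : V

instance (V : Type*) : MeasurableSpace (LampState V) := ⊤

instance (V : Type*) : DiscreteMeasurableSpace (LampState V) := ⟨fun _ => trivial⟩

/-- The wreath product graph `{0,1} ≀ G`: `(f, u)` and `(g, v)` are adjacent if either `f = g` and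
`u`, `v` are adjacent in `G`, or `u = v` and `f`, `g` differ exactly at `u`. -/
def wreath {V : Type*} (G : SimpleGraph V) : SimpleGraph (LampState V) where
  Adj s t := (s.lamps = t.lamps ∧ G.Adj s.pos t.pos) ∨
    (s.pos = t.pos ∧ s.lamps s.pos ≠ t.lamps s.pos ∧ ∀ x, x ≠ s.pos → s.lamps x = t.lamps x)
  symm := ⟨by
    rintro s t (⟨h, h'⟩ | ⟨h, h', h''⟩)
    · exact Or.inl ⟨h.symm, h'.symm⟩
    · exact Or.inr ⟨h.symm, h ▸ h'.symm, fun x hx => (h'' x (h ▸ hx)).symm⟩⟩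
  loopless := ⟨by
    rintro s (⟨-, h⟩ | ⟨-, h, -⟩)
    · exact G.loopless.irrefl _ h
    · exact h rfl⟩

theorem wreath_neighborSet_finite {V : Type*} (G : SimpleGraph V) [G.LocallyFinite]
    (s : LampState V) : ((wreath G).neighborSet s).Finite := by
  classical
  refine ((((G.neighborSet s.pos).toFinite).image (fun v => (⟨s.lamps, v⟩ : LampState V))).union
    (Set.finite_range
      (fun a : ZMod 2 => (⟨s.lamps.update s.pos a, s.pos⟩ : LampState V)))).subset ?_
  rintro t (⟨h, h'⟩ | ⟨h, -, h'⟩)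
  · exact Or.inl ⟨t.pos, h', LampState.ext h rfl⟩
  · refine Or.inr ⟨t.lamps s.pos, LampState.ext (Finsupp.ext fun x => ?_) h⟩
    by_cases hx : x = s.pos
    · subst hx; simp
    · simp [Finsupp.update_apply, hx, h' x hx]

instance {V : Type*} (G : SimpleGraph V) [G.LocallyFinite] : (wreath G).LocallyFinite :=
  fun s => (wreath_neighborSet_finite G s).fintype

/-- One step of the switch-walk-switch walk on `{0,1} ≀ G`: the lamp at the present position `u` is
set to a uniform state, the lamplighter makes a step of the simple random walk on `G` from `u` to
some `v`, and the lamp at `v` is set to a uniform state, all these choices being independent. -/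
def swsStep {V : Type*} (G : SimpleGraph V) [G.LocallyFinite] (s : LampState V) :
    PMF (LampState V) :=
  (PMF.uniformOfFintype (ZMod 2)).bind fun a =>
    (srwStep G s.pos).bind fun v =>
      (PMF.uniformOfFintype (ZMod 2)).bind fun b =>
        PMF.pure ⟨(s.lamps.update s.pos a).update v b, v⟩

/-- `d(Y_0, Y_n) / (n / log n)` along a path `Y`, with `d` the graph distance of `{0,1} ≀ G`. -/
def scaledDist {V : Type*} (G : SimpleGraph V) (Y : ℕ → LampState V) (n : ℕ) : ℝ :=
  ((wreath G).dist (Y 0) (Y n) : ℝ) / (n / Real.log n)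

end Lamplighter

end

open Lamplighter

open scoped ENNReal

/-! Let `R_n` be the number of vertices visited by the lamplighter up to time `n`, and `D_n` the
number of lamps whose states differ between times `0` and `n`. Then `D_n ≤ d(Y_0, Y_n) ≤ 5 R_n`
(`dist_bounds`): an edge changes at most one lamp, while a closed tour of the visited set, a walk
along that tour to the final position and the switches cost at most `2 R_n`, `2 R_n` and `R_n`. An
infinite connected graph has a vertex of degree at least 2, so `5 ≤ 2 max deg + 1`. Both walks are
handled through `IsLamplighterStep`; the lamplighter moves at worst like a lazy simple random walk,
so its range is stochastically dominated by that of the simple random walk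
(`lintegral_visited_posPath_le`).

Upper bound. Counting each visited vertex at its last visit gives `E R_N ≤ ∑_{j ≤ N} sup_x P^x(T_x >
j)`, eventually at most `ρ N / log N` for each `ρ > r_sup`. The range is subadditive over blocks of
time, so a Chernoff bound with about `log³ n` blocks gives an upper tail `n⁻²`, uniformly in the
starting point, and Borel-Cantelli applies.

Lower bound. A lamp that is left flipped and not visited again counts in `D_N`. For the simple
random walk the present lamp is flipped about half of the time, and a step moves away with
probability at least one half; the switch-walk-switch walk does no worse. Hence `E D_N ≥ r N / log
N` eventually, for `4 r < r_inf` (`mul_le_lintegral_diffCount`), while `E D_N² ≤ E R_N² ≤ 2 (sup E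
R_N)²`. Cut `[0, n]` into about `(log n)^(1/6)` blocks: an exponential Chebyshev bound controls the
sum of the changes over the blocks, and changes cancel between blocks only at vertices visited
before. The bounds `p_k = O(1/k)` and `∑_{k ≤ N} p_k(v, v) ≥ c log N` show that a given set of `O(n
/ log n)` vertices receives on average only `O(n log log n / log² n)` visited ones in a block, which
is negligible. The total failure probability `(log n)^(-5/4)` is summable along the times `i 2^j`;
the range bound fills the gaps between them. The lower bound in probability follows from the almost
sure one. -/

namespace Lamplighter

/-! ### The Markov property of `chainLaw`. -/

section Markov

variable {S : Type*} [MeasurableSpace S] [DiscreteMeasurableSpace S]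

instance isProbabilityMeasure_chainLaw (Q : S → PMF S) (x : S) :
    IsProbabilityMeasure (chainLaw Q x) := by
  unfold chainLaw; infer_instance

variable [Countable S]

/-- Such an `F` factors through finitely many coordinates, hence through a countable discrete space,
on which every function is measurable. This disposes of nearly all measurability questions below. -/
theorem measurable_of_dependsOn {β : Type*} [MeasurableSpace β] {F : (ℕ → S) → β} {n : ℕ}
    (hF : DependsOn F (Set.Iic n)) : Measurable F := by
  have h : F = (fun h : (Finset.Iic n) → S =>
      F (fun i => if hi : i ≤ n then h ⟨i, Finset.mem_Iic.2 hi⟩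
        else h ⟨n, Finset.mem_Iic.2 le_rfl⟩)) ∘ Preorder.frestrictLe n := by
    funext ω
    refine hF fun i hi => ?_
    simp [Set.mem_Iic.1 hi]
  rw [h]
  exact Measurable.of_discrete.comp (Preorder.measurable_frestrictLe n)

theorem lintegral_toMeasure_eq_tsum (p : PMF S) (f : S → ℝ≥0∞) :
    ∫⁻ y, f y ∂p.toMeasure = ∑' y, p y * f y := by
  rw [lintegral_countable']
  refine tsum_congr fun y => ?_
  rw [PMF.toMeasure_apply_singleton _ _ (measurableSet_singleton y), mul_comm]

/-- Integrating out the last coordinate. Together with `chainLaw_zero` this carries everything that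
the Markov property needs from the construction of `chainLaw`. -/
theorem lintegral_chainLaw_succ (Q : S → PMF S) (x : S) {n : ℕ} {F : (ℕ → S) → ℝ≥0∞}
    (hF : DependsOn F (Set.Iic (n + 1))) :
    ∫⁻ ω, F ω ∂chainLaw Q x =
      ∫⁻ ω, ∑' y, Q (ω n) y * F (Function.update ω (n + 1) y) ∂chainLaw Q x := by
  let G : ((Finset.Iic n) → S) × S → ℝ≥0∞ := fun p =>
    F (fun i => if hi : i ≤ n then p.1 ⟨i, Finset.mem_Iic.2 hi⟩ else p.2)
  have hG : Measurable G := Measurable.of_discrete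
  have h1 : ∀ ω : ℕ → S, F ω = G (Preorder.frestrictLe n ω, ω (n + 1)) := by
    intro ω
    refine hF fun i hi => ?_
    by_cases h : i ≤ n
    · simp [h]
    · have : i = n + 1 := le_antisymm hi (by omega)
      simp [this]
  have h2 : ∀ (ω : ℕ → S) y, F (Function.update ω (n + 1) y) =
      G (Preorder.frestrictLe n ω, y) := by
    intro ω y
    refine hF fun i hi => ?_
    by_cases h : i ≤ n
    · have : i ≠ n + 1 := by omega
      simp [h, this]
    · have : i = n + 1 := le_antisymm hi (by omega)
      simp [this]
  have hm : Measurable (fun ω : ℕ → S => (Preorder.frestrictLe (π := fun _ => S) n ω, ω (n + 1))) :=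
    (Preorder.measurable_frestrictLe n).prodMk (measurable_pi_apply _)
  rw [lintegral_congr h1, lintegral_congr fun ω => tsum_congr fun y => by rw [h2 ω y],
    ← lintegral_map (f := G) hG hm, chainLaw,
    ← Kernel.map_frestrictLe_trajMeasure_compProd_eq_map_trajMeasure,
    Measure.lintegral_compProd hG, lintegral_map (by exact hG.lintegral_kernel_prod_right')
      (Preorder.measurable_frestrictLe n)]
  refine lintegral_congr fun ω => ?_
  exact lintegral_toMeasure_eq_tsum (Q (ω n)) _

theorem chainLaw_zero (Q : S → PMF S) (x : S) : ∀ᵐ ω ∂chainLaw Q x, ω 0 = x := by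
  have h : (chainLaw Q x).map (fun ω => ω 0) = Measure.dirac x := by
    have e : (fun ω : ℕ → S => ω 0) = (fun h : (Finset.Iic 0) → S => h ⟨0, by simp⟩) ∘
      Preorder.frestrictLe 0 := rfl
    rw [e, ← Measure.map_map (by fun_prop) (by fun_prop), chainLaw, Kernel.trajMeasure,
      Measure.map_comp _ _ (by fun_prop), Kernel.traj_map_frestrictLe, Kernel.partialTraj_self,
      Measure.id_comp, Measure.map_map (by fun_prop) (by fun_prop)]
    exact Measure.map_id
  have h3 : ∀ᵐ y ∂((chainLaw Q x).map (fun ω => ω 0)), y = x := by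
    rw [h, ae_dirac_eq]; simp
  exact ae_of_ae_map (measurable_pi_apply 0).aemeasurable h3

/-- The functional `K` has separate arguments for past and future, so the future may be tested
against an object determined by the past, such as the set of points already visited. Induction on
the horizon `k` of the future, its last coordinate being integrated out on both sides. -/
theorem lintegral_markov (Q : S → PMF S) (x : S) {n k : ℕ} {K : (ℕ → S) → (ℕ → S) → ℝ≥0∞}
    (h1 : ∀ ω', DependsOn (fun ω => K ω ω') (Set.Iic n))
    (h2 : ∀ ω, DependsOn (K ω) (Set.Iic k)) :
    ∫⁻ ω, K ω (fun i => ω (n + i)) ∂chainLaw Q x =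
      ∫⁻ ω, ∫⁻ ω', K ω ω' ∂chainLaw Q (ω n) ∂chainLaw Q x := by
  induction k generalizing K with
  | zero =>
    refine lintegral_congr fun ω => ?_
    have : ∀ᵐ ω' ∂chainLaw Q (ω n), K ω ω' = K ω (fun i => ω (n + i)) := by
      filter_upwards [chainLaw_zero Q (ω n)] with ω' h
      refine h2 ω fun i hi => ?_
      simp only [Set.mem_Iic, Nat.le_zero] at hi
      simp [hi, h]
    rw [lintegral_congr_ae this, lintegral_const, measure_univ, mul_one]
  | succ k ih =>
    have hdep : DependsOn (fun ω : ℕ → S => K ω (fun i => ω (n + i))) (Set.Iic (n + k + 1)) := by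
      intro ω ω' h
      have e1 : K ω (fun i => ω (n + i)) = K ω' (fun i => ω (n + i)) :=
        h1 _ fun i hi => h i (by simp only [Set.mem_Iic] at *; omega)
      simp only [e1]
      exact h2 _ fun i hi => h _ (by simp only [Set.mem_Iic] at *; omega)
    rw [lintegral_chainLaw_succ Q x hdep]
    have hK' := ih (K := fun ω ω' => ∑' y, Q (ω' k) y * K ω (Function.update ω' (k + 1) y))
      (fun ω' ω₁ ω₂ h => by
        simp only
        refine tsum_congr fun y => ?_
        exact congrArg _ (h1 (Function.update ω' (k + 1) y) h))
      (fun ω ω₁ ω₂ h => by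
        simp only
        rw [h k (by simp)]
        refine tsum_congr fun y => ?_
        congr 1
        refine h2 ω fun i hi => ?_
        by_cases hik : i = k + 1
        · simp [hik]
        · simp only [Function.update_of_ne hik]
          exact h i (by simp only [Set.mem_Iic] at *; omega))
    refine Eq.trans (lintegral_congr fun ω => tsum_congr fun y => ?_) (hK'.trans ?_)
    · congr 1
      have e1 : K (Function.update ω (n + k + 1) y)
          (fun i => Function.update ω (n + k + 1) y (n + i)) =
          K ω (fun i => Function.update ω (n + k + 1) y (n + i)) := by
        refine h1 _ fun i hi => ?_
        simp only [Set.mem_Iic] at hi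
        rw [Function.update_of_ne (by omega)]
      rw [e1]
      refine congrArg _ (funext fun i => ?_)
      by_cases hik : i = k + 1
      · subst hik; simp [← add_assoc]
      · rw [Function.update_of_ne hik, Function.update_of_ne (by omega)]
    · refine lintegral_congr fun ω => ?_
      rw [lintegral_chainLaw_succ Q (ω n) (h2 ω)]

theorem lintegral_chainLaw_coord (Q : S → PMF S) (x : S) (f : S → ℝ≥0∞) :
    ∫⁻ ω, f (ω 0) ∂chainLaw Q x = f x := by
  have : ∀ᵐ ω ∂chainLaw Q x, f (ω 0) = f x := by
    filter_upwards [chainLaw_zero Q x] with ω h using by rw [h]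
  rw [lintegral_congr_ae this, lintegral_const, measure_univ, mul_one]

theorem lintegral_first_step (Q : S → PMF S) (x : S) {k : ℕ} {K : S → (ℕ → S) → ℝ≥0∞}
    (hK : ∀ u, DependsOn (K u) (Set.Iic k)) :
    ∫⁻ ω, K (ω 0) (fun i => ω (1 + i)) ∂chainLaw Q x =
      ∑' y, Q x y * ∫⁻ ω, K x ω ∂chainLaw Q y := by
  rw [lintegral_markov Q x (n := 1) (K := fun ω ω' => K (ω 0) ω')
      (fun ω' ω₁ ω₂ h => by simp only [h 0 (by simp)]) (fun ω => hK _),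
    lintegral_chainLaw_succ Q x (n := 0) (F := fun ω => ∫⁻ ω', K (ω 0) ω' ∂chainLaw Q (ω 1))
      (fun ω₁ ω₂ h => by simp only [h 0 (by simp), h 1 (by simp)])]
  simp only [zero_add, Function.update_self, ne_eq, zero_ne_one, not_false_eq_true,
    Function.update_of_ne]
  exact lintegral_chainLaw_coord Q x
    (fun u => ∑' y, Q u y * ∫⁻ ω', K u ω' ∂chainLaw Q y)

/-- Deterministic facts about admissible paths hold almost surely through this lemma. -/
theorem ae_step_ne_zero (Q : S → PMF S) (x : S) :
    ∀ᵐ ω ∂chainLaw Q x, ∀ n, Q (ω n) (ω (n + 1)) ≠ 0 := by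
  rw [ae_all_iff]
  intro n
  have hdep : DependsOn (fun ω : ℕ → S => Set.indicator {ω : ℕ → S | Q (ω n) (ω (n + 1)) = 0}
      (1 : (ℕ → S) → ℝ≥0∞) ω) (Set.Iic (n + 1)) := by
    intro ω ω' h
    simp only [Set.indicator, Set.mem_ofPred_eq, h n (by simp), h (n + 1) (by simp), Pi.one_apply]
  have hm : MeasurableSet {ω : ℕ → S | Q (ω n) (ω (n + 1)) = 0} := by
    have : Measurable (fun ω : ℕ → S => Q (ω n) (ω (n + 1))) :=
      measurable_of_dependsOn (n := n + 1) fun ω ω' h => by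
        simp only [h n (by simp), h (n + 1) (by simp)]
    exact this (measurableSet_singleton 0)
  have h := lintegral_chainLaw_succ Q x hdep
  rw [lintegral_indicator_one hm] at h
  rw [ae_iff]
  simp only [not_not]
  rw [h]
  have : ∀ (ω : ℕ → S) y, Q (ω n) y * Set.indicator {ω : ℕ → S | Q (ω n) (ω (n + 1)) = 0}
      (1 : (ℕ → S) → ℝ≥0∞) (Function.update ω (n + 1) y) = 0 := by
    intro ω y
    by_cases h : Q (ω n) y = 0 <;> simp [Set.indicator, h]
  simp [this]

/-- A functional of consecutive blocks of `N` steps multiplies along the blocks. -/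
theorem lintegral_prod_blocks_le (Q : S → PMF S) {N : ℕ} {F : (ℕ → S) → ℝ≥0∞}
    (hF : DependsOn F (Set.Iic N)) {c : ℝ≥0∞} (hc : ∀ x, ∫⁻ ω, F ω ∂chainLaw Q x ≤ c)
    (m : ℕ) (x : S) :
    ∫⁻ ω, ∏ i ∈ Finset.range m, F (fun j => ω (i * N + j)) ∂chainLaw Q x ≤ c ^ m := by
  induction m with
  | zero => simp
  | succ m ih =>
    simp_rw [Finset.prod_range_succ]
    rw [lintegral_markov Q x (n := m * N) (k := N)
      (K := fun ω ω' => (∏ i ∈ Finset.range m, F (fun j => ω (i * N + j))) * F ω')]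
    · calc _ ≤ ∫⁻ ω, (∏ i ∈ Finset.range m, F (fun j => ω (i * N + j))) * c ∂chainLaw Q x := by
            refine lintegral_mono fun ω => ?_
            simp only
            rw [lintegral_const_mul _ (measurable_of_dependsOn hF)]
            gcongr
            exact hc _
        _ ≤ c ^ (m + 1) := by
            rw [lintegral_mul_const, pow_succ]
            · gcongr
            · refine Finset.measurable_prod _ fun i _ => ?_
              exact (measurable_of_dependsOn hF).comp (by fun_prop)
    · intro ω' ω₁ ω₂ h
      simp only
      congr 1
      refine Finset.prod_congr rfl fun i hi => hF fun j hj => h _ ?_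
      simp only [Finset.mem_range, Set.mem_Iic] at *
      nlinarith
    · intro ω ω₁ ω₂ h
      simp only [hF h]

end Markov

/-- The set of states visited up to time `n`. -/
noncomputable def visited {S : Type*} (n : ℕ) (ω : ℕ → S) : Finset S :=
  open Classical in (Finset.range (n + 1)).image ω

/-! ### The visited set and its decompositions. -/

section Visited

variable {S : Type*}

theorem mem_visited {n : ℕ} {ω : ℕ → S} {v : S} : v ∈ visited n ω ↔ ∃ k ≤ n, ω k = v := by
  simp [visited]

theorem dependsOn_visited (n : ℕ) : DependsOn (visited (S := S) n) (Set.Iic n) := by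
  intro ω ω' h
  ext v
  simp only [mem_visited]
  exact exists_congr fun k => and_congr_right fun hk => by rw [h k hk]

theorem visited_mono (ω : ℕ → S) {m n : ℕ} (h : m ≤ n) : visited m ω ⊆ visited n ω := by
  intro v
  simp only [mem_visited]
  exact fun ⟨k, hk, e⟩ => ⟨k, hk.trans h, e⟩

theorem card_visited_le (n : ℕ) (ω : ℕ → S) : (visited n ω).card ≤ n + 1 := by
  classical
  unfold visited
  exact Finset.card_image_le.trans (by simp)

theorem visited_zero (ω : ℕ → S) : visited 0 ω = {ω 0} := by
  ext v; simp [mem_visited, eq_comm]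

open Classical in
theorem visited_succ (n : ℕ) (ω : ℕ → S) :
    visited (n + 1) ω = insert (ω 0) (visited n (fun i => ω (1 + i))) := by
  ext v
  simp only [mem_visited, Finset.mem_insert]
  constructor
  · rintro ⟨k, hk, rfl⟩
    rcases k with _ | k
    · exact Or.inl rfl
    · exact Or.inr ⟨k, by omega, by rw [add_comm]⟩
  · rintro (rfl | ⟨k, hk, rfl⟩)
    · exact ⟨0, by omega, rfl⟩
    · exact ⟨1 + k, by omega, rfl⟩

open Classical in
theorem visited_add (m n : ℕ) (ω : ℕ → S) :
    visited (m + n) ω = visited m ω ∪ visited n (fun i => ω (m + i)) := by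
  ext v
  simp only [mem_visited, Finset.mem_union]
  constructor
  · rintro ⟨k, hk, rfl⟩
    by_cases h : k ≤ m
    · exact Or.inl ⟨k, h, rfl⟩
    · exact Or.inr ⟨k - m, by omega, by congr 1; omega⟩
  · rintro (⟨k, hk, rfl⟩ | ⟨k, hk, rfl⟩)
    · exact ⟨k, by omega, rfl⟩
    · exact ⟨m + k, by omega, rfl⟩

/-- The blocks cover all times up to `m * N`; the `+ 1` is needed only when `m = 0`. -/
theorem card_visited_mul_le (m N : ℕ) (ω : ℕ → S) :
    (visited (m * N) ω).card ≤
      (∑ i ∈ Finset.range m, (visited N (fun j => ω (i * N + j))).card) + 1 := by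
  classical
  induction m with
  | zero => simp [visited_zero]
  | succ m ih =>
    rw [Finset.sum_range_succ, Nat.succ_mul, visited_add]
    have := Finset.card_union_le (visited (m * N) ω) (visited N (fun i => ω (m * N + i)))
    omega

end Visited

end Lamplighter

namespace Lamplighter

/-- The indicator of a proposition, as an extended nonnegative real. -/
noncomputable def ind (p : Prop) : ℝ≥0∞ := open Classical in if p then 1 else 0

theorem ind_true {p : Prop} (h : p) : ind p = 1 := by simp [ind, h]
theorem ind_false {p : Prop} (h : ¬ p) : ind p = 0 := by simp [ind, h]
theorem ind_le_one (p : Prop) : ind p ≤ 1 := by unfold ind; split_ifs <;> simp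
theorem ind_mono {p q : Prop} (h : p → q) : ind p ≤ ind q := by
  by_cases hp : p
  · rw [ind_true hp, ind_true (h hp)]
  · simp [ind_false hp]
theorem ind_and (p q : Prop) : ind (p ∧ q) = ind p * ind q := by
  by_cases hp : p <;> by_cases hq : q <;> simp [ind, hp, hq]

theorem card_filter_eq_sum_ind {ι : Type*} (s : Finset ι) (p : ι → Prop) [DecidablePred p] :
    ((s.filter p).card : ℝ≥0∞) = ∑ i ∈ s, ind (p i) := by
  rw [Finset.card_filter]
  push_cast
  refine Finset.sum_congr rfl fun i _ => ?_
  by_cases h : p i <;> simp [ind, h]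

theorem card_eq_tsum_ind {ι : Type*} (s : Finset ι) : (s.card : ℝ≥0∞) = ∑' i, ind (i ∈ s) := by
  rw [tsum_eq_sum (s := s) fun b hb => ind_false hb,
    Finset.sum_congr rfl fun i hi => ind_true hi]
  simp

/-! ### Events determined by finitely many coordinates. -/

section PathEvents

variable {S : Type*}

theorem dependsOn_coord_eq (n : ℕ) (y : S) :
    DependsOn (fun ω : ℕ → S => ω n = y) (Set.Iic n) := fun ω ω' h => by
  simp only [h n (by simp)]

theorem dependsOn_mem_visited (n : ℕ) (y : S) :
    DependsOn (fun ω : ℕ → S => y ∈ visited n ω) (Set.Iic n) := fun ω ω' h => by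
  simp only [dependsOn_visited n h]

theorem dependsOn_avoid (n : ℕ) (y : S) :
    DependsOn (fun ω : ℕ → S => ∀ j, 1 ≤ j → j ≤ n → ω j ≠ y) (Set.Iic n) := fun ω ω' h => by
  simp only [eq_iff_iff]
  exact forall_congr' fun j => imp_congr_right fun _ => imp_congr_right fun hj => by
    rw [h j hj]

/-- `v` is visited at time `t` for the first time. -/
def FirstHit (v : S) (t : ℕ) (ω : ℕ → S) : Prop := ω t = v ∧ ∀ j < t, ω j ≠ v

theorem dependsOn_firstHit (v : S) (t : ℕ) : DependsOn (FirstHit v t) (Set.Iic t) := by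
  intro ω ω' h
  simp only [FirstHit, eq_iff_iff]
  rw [h t (by simp)]
  exact and_congr_right fun _ => forall_congr' fun j => imp_congr_right fun hj => by
    rw [h j (by simp only [Set.mem_Iic]; omega)]

end PathEvents

/-! ### Transition probabilities and reversibility. -/

section ChainProb

variable {S : Type*} [MeasurableSpace S] [DiscreteMeasurableSpace S] [Countable S]

theorem lintegral_ind (μ : Measure (ℕ → S)) {n : ℕ} {p : (ℕ → S) → Prop}
    (hp : DependsOn p (Set.Iic n)) : ∫⁻ ω, ind (p ω) ∂μ = μ {ω | p ω} := by
  have hm : MeasurableSet {ω | p ω} := measurableSet_setOfPred.2 (measurable_of_dependsOn hp)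
  rw [← lintegral_indicator_one hm]
  refine lintegral_congr fun ω => ?_
  by_cases h : p ω <;> simp [ind, h]

theorem measurable_ind {n : ℕ} {p : (ℕ → S) → Prop} (hp : DependsOn p (Set.Iic n)) :
    Measurable fun ω => ind (p ω) :=
  measurable_of_dependsOn (n := n) fun ω ω' h => by rw [hp h]

/-- `P^x(ω_n = y)`. -/
noncomputable def transProb (Q : S → PMF S) (n : ℕ) (x y : S) : ℝ≥0∞ :=
  chainLaw Q x {ω | ω n = y}

/-- The probability that `y` is visited up to time `N`. -/
noncomputable def hitProb (Q : S → PMF S) (N : ℕ) (x y : S) : ℝ≥0∞ :=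
  chainLaw Q x {ω | y ∈ visited N ω}

/-- The probability of no return to the starting point up to time `n`. -/
noncomputable def escapeProb (Q : S → PMF S) (n : ℕ) (x : S) : ℝ≥0∞ :=
  chainLaw Q x {ω | ∀ j, 1 ≤ j → j ≤ n → ω j ≠ x}

variable (Q : S → PMF S)

theorem lintegral_coord_eq (x : S) (n : ℕ) (f : S → ℝ≥0∞) :
    ∫⁻ ω, f (ω n) ∂chainLaw Q x = ∑' z, transProb Q n x z * f z := by
  rw [← lintegral_map (f := f) Measurable.of_discrete (measurable_pi_apply n),
    lintegral_countable']
  refine tsum_congr fun z => ?_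
  rw [Measure.map_apply (measurable_pi_apply n) (measurableSet_singleton z), mul_comm]
  rfl

theorem transProb_add (m n : ℕ) (x y : S) :
    transProb Q (m + n) x y = ∑' z, transProb Q m x z * transProb Q n z y := by
  rw [← lintegral_coord_eq, transProb, ← lintegral_ind _ (dependsOn_coord_eq (m + n) y)]
  have := lintegral_markov Q x (n := m) (k := n) (K := fun _ ω' => ind (ω' n = y))
    (fun ω' ω₁ ω₂ _ => rfl) (fun ω ω₁ ω₂ h => by simp only [h n (by simp)])
  rw [this]
  refine lintegral_congr fun ω => ?_
  rw [lintegral_ind _ (dependsOn_coord_eq n y), transProb]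

theorem transProb_one (x y : S) : transProb Q 1 x y = Q x y := by
  rw [transProb, ← lintegral_ind _ (dependsOn_coord_eq 1 y)]
  rw [lintegral_chainLaw_succ Q x (n := 0) (F := fun ω => ind (ω 1 = y))
    (fun ω ω' h => by simp only [h 1 (by simp)])]
  simp only [zero_add, Function.update_self]
  have : ∀ u, ∑' z, Q u z * ind (z = y) = Q u y := fun u => by
    rw [tsum_eq_single y fun z hz => by rw [ind_false hz, mul_zero], ind_true rfl, mul_one]
  simp_rw [this]
  exact lintegral_chainLaw_coord Q x fun u => Q u y

theorem transProb_zero (x y : S) : transProb Q 0 x y = ind (x = y) := by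
  rw [transProb, ← lintegral_ind _ (dependsOn_coord_eq 0 y)]
  exact lintegral_chainLaw_coord Q x fun u => ind (u = y)

theorem tsum_transProb (n : ℕ) (x : S) : ∑' z, transProb Q n x z = 1 := by
  have := lintegral_coord_eq Q x n 1
  simpa using this.symm

theorem transProb_symm {d : S → ℝ≥0∞} (hd : ∀ x y, d x * Q x y = d y * Q y x) (n : ℕ) (x y : S) :
    d x * transProb Q n x y = d y * transProb Q n y x := by
  induction n generalizing x y with
  | zero =>
    rw [transProb_zero, transProb_zero]
    by_cases h : x = y
    · simp [h]
    · simp [ind_false h, ind_false (Ne.symm h)]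
  | succ n ih =>
    rw [transProb_add, add_comm n 1, transProb_add, ← ENNReal.tsum_mul_left,
      ← ENNReal.tsum_mul_left]
    refine tsum_congr fun z => ?_
    rw [transProb_one, transProb_one, ← mul_assoc, ih x z, mul_comm (d z), mul_assoc, hd z y]
    ring

theorem two_mul_le_sq_add_sq_ennreal (a b : ℝ≥0∞) : 2 * (a * b) ≤ a * a + b * b := by
  by_cases ha : a = ∞
  · simp [ha]
  by_cases hb : b = ∞
  · simp [hb]
  lift a to NNReal using ha
  lift b to NNReal using hb
  norm_cast
  have := two_mul_le_add_sq a b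
  nlinarith

/-- Off-diagonal by on-diagonal: Chapman-Kolmogorov at the midpoint, then `2ab ≤ a² + b²`, then
reversibility turns each sum of squares into a return probability, at the cost of a factor `D`
because the reversing measure `d` is only comparable to the counting measure. -/
theorem two_mul_transProb_le {d : S → ℝ≥0∞} (hd : ∀ x y, d x * Q x y = d y * Q y x)
    {D : ℝ≥0∞} (h1 : ∀ x, 1 ≤ d x) (hD : ∀ x, d x ≤ D) (n : ℕ) (x y : S) :
    2 * transProb Q (n + n) x y ≤
      D * (transProb Q (n + n) x x + transProb Q (n + n) y y) := by
  have key : ∀ u v, transProb Q n u v ≤ D * transProb Q n v u := fun u v =>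
    calc transProb Q n u v ≤ d u * transProb Q n u v := le_mul_of_one_le_left' (h1 u)
      _ = d v * transProb Q n v u := transProb_symm Q hd n u v
      _ ≤ D * transProb Q n v u := by gcongr; exact hD v
  simp_rw [transProb_add]
  rw [← ENNReal.tsum_add, ← ENNReal.tsum_mul_left, ← ENNReal.tsum_mul_left]
  refine ENNReal.tsum_le_tsum fun z => (two_mul_le_sq_add_sq_ennreal _ _).trans ?_
  rw [mul_add]
  refine add_le_add ?_ ?_
  · calc _ ≤ transProb Q n x z * (D * transProb Q n z x) := by gcongr; exact key x z
      _ = _ := by ring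
  · calc _ ≤ (D * transProb Q n y z) * transProb Q n z y := by gcongr; exact key z y
      _ = _ := by ring

end ChainProb

end Lamplighter

namespace Lamplighter

/-! ### First hits and last visits along a path. -/

section FirstLast

variable {S : Type*}

/-- At most one time is the first hit, so at most one term survives. -/
theorem sum_ind_firstHit_mul_le (v : S) (N : ℕ) (ω : ℕ → S) {a : ℕ → ℝ≥0∞} {b : ℝ≥0∞}
    (hab : ∀ t ≤ N, FirstHit v t ω → a t ≤ b) :
    ∑ t ∈ Finset.range (N + 1), ind (FirstHit v t ω) * a t ≤ b := by
  by_cases h : ∃ t ≤ N, FirstHit v t ω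
  · obtain ⟨t, ht, hF⟩ := h
    rw [Finset.sum_eq_single t, ind_true hF, one_mul]
    · exact hab t ht hF
    · intro s _ hst
      rw [ind_false, zero_mul]
      intro hs
      rcases lt_or_gt_of_ne hst with h | h
      · exact hF.2 s h hs.1
      · exact hs.2 t h hF.1
    · intro h; exact absurd (Finset.mem_range.2 (by omega)) h
  · rw [Finset.sum_eq_zero]
    · exact zero_le
    · intro t ht
      rw [ind_false, zero_mul]
      exact fun hF => h ⟨t, by simpa [Nat.lt_succ_iff] using ht, hF⟩

theorem exists_firstHit {v : S} {N : ℕ} {ω : ℕ → S} (h : v ∈ visited N ω) :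
    ∃ t ≤ N, FirstHit v t ω := by
  classical
  obtain ⟨k, hk, e⟩ := mem_visited.1 h
  have hex : ∃ t, ω t = v := ⟨k, e⟩
  exact ⟨Nat.find hex, (Nat.find_min' hex e).trans hk, Nat.find_spec hex,
    fun j hj => Nat.find_min hex hj⟩

theorem sum_ind_firstHit (v : S) (N : ℕ) (ω : ℕ → S) :
    ∑ t ∈ Finset.range (N + 1), ind (FirstHit v t ω) = ind (v ∈ visited N ω) := by
  refine le_antisymm ?_ ?_
  · have := sum_ind_firstHit_mul_le v N ω (a := fun _ => 1) (b := ind (v ∈ visited N ω))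
      (fun t ht h => by rw [ind_true (mem_visited.2 ⟨t, ht, h.1⟩)])
    simpa using this
  · by_cases h : v ∈ visited N ω
    · obtain ⟨t, ht, hF⟩ := exists_firstHit h
      rw [ind_true h, ← ind_true hF]
      exact Finset.single_le_sum (f := fun t => ind (FirstHit v t ω)) (fun _ _ => zero_le)
        (Finset.mem_range.2 (by omega))
    · rw [ind_false h]; exact zero_le

-- Last visits are used rather than first ones because after a last visit the future avoids the
-- present state, an event to which the Markov property applies directly.
open Classical in
theorem card_visited_eq_card_lastVisit (N : ℕ) (ω : ℕ → S) :
    (visited N ω).card =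
      ((Finset.range (N + 1)).filter fun k => ∀ j, k < j → j ≤ N → ω j ≠ ω k).card := by
  symm
  refine Finset.card_bij (fun k _ => ω k) ?_ ?_ ?_
  · intro k hk
    simp only [Finset.mem_filter, Finset.mem_range] at hk
    exact mem_visited.2 ⟨k, by omega, rfl⟩
  · intro k hk l hl e
    simp only [Finset.mem_filter, Finset.mem_range] at hk hl
    by_contra hne
    rcases lt_or_gt_of_ne hne with h | h
    · exact hk.2 l h (by omega) e.symm
    · exact hl.2 k h (by omega) e
  · intro v hv
    obtain ⟨k, hk, e⟩ := mem_visited.1 hv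
    have hne : ((Finset.range (N + 1)).filter fun k => ω k = v).Nonempty :=
      ⟨k, by simp only [Finset.mem_filter, Finset.mem_range]; exact ⟨by omega, e⟩⟩
    refine ⟨_, ?_, (Finset.mem_filter.1 (Finset.max'_mem _ hne)).2⟩
    simp only [Finset.mem_filter, Finset.mem_range]
    have hm := Finset.mem_filter.1 (Finset.max'_mem _ hne)
    refine ⟨Finset.mem_range.1 hm.1, fun j hj hjN e' => ?_⟩
    have := Finset.le_max' ((Finset.range (N + 1)).filter fun k => ω k = v) j
      (by simp only [Finset.mem_filter, Finset.mem_range]; exact ⟨by omega, e'.trans hm.2⟩)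
    omega

/-- The number of points of `A` visited up to time `N`. -/
noncomputable def visitedIn (N : ℕ) (A : Set S) (ω : ℕ → S) : ℕ :=
  open Classical in ((visited N ω).filter (· ∈ A)).card

theorem visitedIn_eq_tsum (N : ℕ) (A : Set S) (ω : ℕ → S) :
    (visitedIn N A ω : ℝ≥0∞) = ∑' v, ind (v ∈ A) * ind (v ∈ visited N ω) := by
  classical
  rw [visitedIn, card_eq_tsum_ind]
  refine tsum_congr fun v => ?_
  rw [← ind_and, Finset.mem_filter, and_comm]

/-- One of the two points is hit first, and the other one later. The window for the second hit is
relaxed from `N - t` to `N`, so that it no longer depends on the first hitting time. -/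
theorem ind_visited_mul_le (v w : S) (N : ℕ) (ω : ℕ → S) :
    ind (v ∈ visited N ω) * ind (w ∈ visited N ω) ≤
      (∑ t ∈ Finset.range (N + 1), ind (FirstHit v t ω) * ind (w ∈ visited N fun i => ω (t + i))) +
      ∑ t ∈ Finset.range (N + 1), ind (FirstHit w t ω) * ind (v ∈ visited N fun i => ω (t + i)) := by
  have key : ∀ v w : S, ∀ s t, FirstHit v s ω → FirstHit w t ω → s ≤ t → t ≤ N →
      1 ≤ ∑ t ∈ Finset.range (N + 1),
        ind (FirstHit v t ω) * ind (w ∈ visited N fun i => ω (t + i)) := by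
    intro v w s t hs ht hst htN
    refine le_trans ?_ (Finset.single_le_sum (f := fun t =>
        ind (FirstHit v t ω) * ind (w ∈ visited N fun i => ω (t + i))) (fun _ _ => zero_le)
        (Finset.mem_range.2 (show s < N + 1 by omega)))
    rw [ind_true hs, ind_true, one_mul]
    refine mem_visited.2 ⟨t - s, by omega, ?_⟩
    rw [← ht.1]
    congr 1
    omega
  by_cases hv : v ∈ visited N ω
  · by_cases hw : w ∈ visited N ω
    · obtain ⟨s, hs, hsF⟩ := exists_firstHit hv
      obtain ⟨t, ht, htF⟩ := exists_firstHit hw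
      rw [ind_true hv, ind_true hw, one_mul]
      rcases le_total s t with h | h
      · exact (key v w s t hsF htF h ht).trans le_self_add
      · exact (key w v t s htF hsF h hs).trans le_add_self
    · simp [ind_false hw]
  · simp [ind_false hv]

end FirstLast

/-! ### Hitting probabilities, Green functions and moments of the range. -/

section Hitting

variable {S : Type*} [MeasurableSpace S] [DiscreteMeasurableSpace S] [Countable S]
  (Q : S → PMF S)

/-- The strong Markov property at the first hit of `v`, obtained by summing the Markov property over
the values `t ≤ N` of the hitting time. -/
theorem sum_lintegral_firstHit (v : S) (N : ℕ) (x : S) {k : ℕ} {F : (ℕ → S) → ℝ≥0∞}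
    (hF : DependsOn F (Set.Iic k)) :
    ∫⁻ ω, ∑ t ∈ Finset.range (N + 1), ind (FirstHit v t ω) * F (fun i => ω (t + i))
      ∂chainLaw Q x = hitProb Q N x v * ∫⁻ ω, F ω ∂chainLaw Q v := by
  have hFm := measurable_of_dependsOn hF
  have hI : ∀ t, Measurable fun ω : ℕ → S => ind (FirstHit v t ω) := fun t =>
    measurable_ind (dependsOn_firstHit v t)
  rw [lintegral_finsetSum]
  · have : ∀ t, ∫⁻ ω, ind (FirstHit v t ω) * F (fun i => ω (t + i)) ∂chainLaw Q x =
        (∫⁻ ω, ind (FirstHit v t ω) ∂chainLaw Q x) * ∫⁻ ω, F ω ∂chainLaw Q v := fun t => by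
      rw [lintegral_markov Q x (n := t) (k := k)
        (K := fun ω ω' => ind (FirstHit v t ω) * F ω')
        (fun ω' ω₁ ω₂ h => by simp only [dependsOn_firstHit v t h])
        (fun ω ω₁ ω₂ h => by simp only [hF h]), ← lintegral_mul_const _ (hI t)]
      refine lintegral_congr fun ω => ?_
      rw [lintegral_const_mul _ hFm]
      by_cases h : FirstHit v t ω
      · rw [h.1]
      · simp [ind_false h]
    rw [Finset.sum_congr rfl fun t _ => this t, ← Finset.sum_mul,
      ← lintegral_finsetSum _ fun t _ => hI t]
    simp_rw [sum_ind_firstHit]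
    rw [lintegral_ind _ (dependsOn_mem_visited N v)]
    rfl
  · intro t _
    exact (hI t).mul (hFm.comp (by fun_prop))

/-- The expected number of visits to `y` up to time `n`. -/
noncomputable def green (n : ℕ) (x y : S) : ℝ≥0∞ :=
  ∑ k ∈ Finset.range (n + 1), transProb Q k x y

theorem lintegral_sum_ind_eq_green (n : ℕ) (x y : S) :
    ∫⁻ ω, ∑ k ∈ Finset.range (n + 1), ind (ω k = y) ∂chainLaw Q x = green Q n x y := by
  rw [lintegral_finsetSum _ fun k _ => measurable_ind (dependsOn_coord_eq k y)]
  exact Finset.sum_congr rfl fun k _ => lintegral_ind _ (dependsOn_coord_eq k y)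

/-- The `N` steps following a hit before time `N` end before time `2 * N`, so their expected visits
to `v` are part of those counted on the right. -/
theorem hitProb_mul_green_le (N : ℕ) (x v : S) :
    hitProb Q N x v * green Q N v v ≤ green Q (2 * N) x v := by
  rw [← lintegral_sum_ind_eq_green Q N v v,
    ← sum_lintegral_firstHit Q v N x (k := N)
      (F := fun ω => ∑ k ∈ Finset.range (N + 1), ind (ω k = v)),
    ← lintegral_sum_ind_eq_green Q (2 * N) x v]
  · refine lintegral_mono fun ω => sum_ind_firstHit_mul_le v N ω fun t ht _ => ?_
    calc ∑ k ∈ Finset.range (N + 1), ind (ω (t + k) = v)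
        = ∑ k ∈ (Finset.range (N + 1)).image (fun k => t + k), ind (ω k = v) := by
          rw [Finset.sum_image]; intro a _ b _ h; simpa using h
      _ ≤ _ := by
          refine Finset.sum_le_sum_of_subset fun k hk => ?_
          simp only [Finset.mem_image, Finset.mem_range] at hk ⊢
          omega
  · intro ω ω' h
    simp only
    refine Finset.sum_congr rfl fun k hk => ?_
    rw [h k (by simp only [Finset.mem_range, Set.mem_Iic] at *; omega)]

theorem lintegral_visitedIn (N : ℕ) (A : Set S) (x : S) :
    ∫⁻ ω, visitedIn N A ω ∂chainLaw Q x =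
      ∑' v, ind (v ∈ A) * hitProb Q N x v := by
  simp_rw [visitedIn_eq_tsum]
  rw [lintegral_tsum fun v =>
    ((measurable_ind (dependsOn_mem_visited N v)).const_mul _).aemeasurable]
  refine tsum_congr fun v => ?_
  rw [lintegral_const_mul _ (measurable_ind (dependsOn_mem_visited N v)),
    lintegral_ind _ (dependsOn_mem_visited N v)]
  rfl

/-- The second moment of the number of visited points of `A` is controlled by the supremum of its
first moment over all starting points. -/
theorem lintegral_visitedIn_sq_le (N : ℕ) (A : Set S) {H : ℝ≥0∞}
    (hH : ∀ x, ∫⁻ ω, visitedIn N A ω ∂chainLaw Q x ≤ H) (x : S) :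
    ∫⁻ ω, (visitedIn N A ω : ℝ≥0∞) ^ 2 ∂chainLaw Q x ≤ 2 * H ^ 2 := by
  have hm : ∀ v w : S, Measurable fun ω : ℕ → S => ∑ t ∈ Finset.range (N + 1),
      ind (FirstHit v t ω) * ind (w ∈ visited N fun i => ω (t + i)) := fun v w =>
    Finset.measurable_sum _ fun t _ => (measurable_ind (dependsOn_firstHit v t)).mul
      ((measurable_ind (dependsOn_mem_visited N w)).comp (by fun_prop))
  have hma : ∀ v w : S, Measurable fun ω : ℕ → S => (∑ t ∈ Finset.range (N + 1),
      ind (FirstHit v t ω) * ind (w ∈ visited N fun i => ω (t + i))) +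
      ∑ t ∈ Finset.range (N + 1),
        ind (FirstHit w t ω) * ind (v ∈ visited N fun i => ω (t + i)) := fun v w =>
    (hm v w).add (hm w v)
  have h1 : ∀ ω : ℕ → S, (visitedIn N A ω : ℝ≥0∞) ^ 2 ≤
      ∑' v, ∑' w, (ind (v ∈ A) * ind (w ∈ A)) *
        ((∑ t ∈ Finset.range (N + 1),
          ind (FirstHit v t ω) * ind (w ∈ visited N fun i => ω (t + i))) +
        ∑ t ∈ Finset.range (N + 1),
          ind (FirstHit w t ω) * ind (v ∈ visited N fun i => ω (t + i))) := by
    intro ω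
    rw [sq, visitedIn_eq_tsum, ← ENNReal.tsum_mul_right]
    refine ENNReal.tsum_le_tsum fun v => ?_
    rw [← ENNReal.tsum_mul_left]
    refine ENNReal.tsum_le_tsum fun w => ?_
    calc _ = (ind (v ∈ A) * ind (w ∈ A)) * (ind (v ∈ visited N ω) * ind (w ∈ visited N ω)) := by
          ring
      _ ≤ _ := by gcongr; exact ind_visited_mul_le v w N ω
  have h2 : ∀ v w, ∫⁻ ω, ∑ t ∈ Finset.range (N + 1),
      ind (FirstHit v t ω) * ind (w ∈ visited N fun i => ω (t + i)) ∂chainLaw Q x =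
      hitProb Q N x v * hitProb Q N v w := fun v w => by
    rw [sum_lintegral_firstHit Q v N x (F := fun ω => ind (w ∈ visited N ω)) (k := N)
      (fun ω ω' h => by simp only [dependsOn_visited N h]),
      lintegral_ind _ (dependsOn_mem_visited N w)]
    rfl
  -- The sum over `w` is a first moment for the chain started at `v`; this is where a bound uniform
  -- over starting points is needed.
  have h3 : ∑' v, ∑' w, (ind (v ∈ A) * ind (w ∈ A)) * (hitProb Q N x v * hitProb Q N v w) ≤
      H ^ 2 := by
    calc _ = ∑' v, (ind (v ∈ A) * hitProb Q N x v) * ∑' w, ind (w ∈ A) * hitProb Q N v w := by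
          refine tsum_congr fun v => ?_
          rw [← ENNReal.tsum_mul_left]
          exact tsum_congr fun w => by ring
      _ ≤ ∑' v, (ind (v ∈ A) * hitProb Q N x v) * H := by
          refine ENNReal.tsum_le_tsum fun v => ?_
          gcongr
          rw [← lintegral_visitedIn]
          exact hH v
      _ ≤ H * H := by
          rw [ENNReal.tsum_mul_right]
          gcongr
          rw [← lintegral_visitedIn]
          exact hH x
      _ = H ^ 2 := (sq H).symm
  calc _ ≤ ∫⁻ ω, ∑' v, ∑' w, (ind (v ∈ A) * ind (w ∈ A)) *
        ((∑ t ∈ Finset.range (N + 1),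
          ind (FirstHit v t ω) * ind (w ∈ visited N fun i => ω (t + i))) +
        ∑ t ∈ Finset.range (N + 1),
          ind (FirstHit w t ω) * ind (v ∈ visited N fun i => ω (t + i))) ∂chainLaw Q x :=
        lintegral_mono h1
    _ = ∑' v, ∑' w, (ind (v ∈ A) * ind (w ∈ A)) *
        (hitProb Q N x v * hitProb Q N v w + hitProb Q N x w * hitProb Q N w v) := by
        rw [lintegral_tsum fun v => (Measurable.tsum fun w =>
          (hma v w).const_mul _).aemeasurable]
        refine tsum_congr fun v => ?_
        rw [lintegral_tsum fun w => ((hma v w).const_mul _).aemeasurable]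
        refine tsum_congr fun w => ?_
        rw [lintegral_const_mul _ (hma v w), lintegral_add_left (hm v w), h2, h2]
    _ = (∑' v, ∑' w, (ind (v ∈ A) * ind (w ∈ A)) * (hitProb Q N x v * hitProb Q N v w)) +
        ∑' v, ∑' w, (ind (v ∈ A) * ind (w ∈ A)) * (hitProb Q N x w * hitProb Q N w v) := by
        simp_rw [mul_add, ENNReal.tsum_add]
    _ = (∑' v, ∑' w, (ind (v ∈ A) * ind (w ∈ A)) * (hitProb Q N x v * hitProb Q N v w)) +
        ∑' v, ∑' w, (ind (v ∈ A) * ind (w ∈ A)) * (hitProb Q N x v * hitProb Q N v w) := by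
        congr 1
        rw [ENNReal.tsum_comm]
        exact tsum_congr fun v => tsum_congr fun w => by rw [mul_comm (ind (w ∈ A))]
    _ ≤ 2 * H ^ 2 := by rw [two_mul]; exact add_le_add h3 h3

theorem escapeProb_eq_lintegral (n : ℕ) (x : S) :
    escapeProb Q n x = ∫⁻ ω, ind (∀ j, 1 ≤ j → j ≤ n → ω j ≠ x) ∂chainLaw Q x :=
  (lintegral_ind _ (dependsOn_avoid n x)).symm

theorem lintegral_ind_lastVisit (k n : ℕ) (x : S) (p : S → Prop) :
    ∫⁻ ω, ind (p (ω k) ∧ ∀ j, k < j → j ≤ k + n → ω j ≠ ω k) ∂chainLaw Q x =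
      ∫⁻ ω, ind (p (ω k)) * escapeProb Q n (ω k) ∂chainLaw Q x := by
  have h := lintegral_markov Q x (n := k) (k := n)
    (K := fun ω ω' => ind (p (ω k)) * ind (∀ j, 1 ≤ j → j ≤ n → ω' j ≠ ω k))
    (fun ω' ω₁ ω₂ h => by simp only [h k (by simp)])
    (fun ω ω₁ ω₂ h => by simp only [dependsOn_avoid n (ω k) h])
  refine Eq.trans (lintegral_congr fun ω => ?_) (h.trans (lintegral_congr fun ω => ?_))
  · rw [← ind_and]
    congr 1
    refine propext (and_congr_right fun _ => ⟨fun h j h1 h2 => h _ (by omega) (by omega),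
      fun h j h1 h2 => ?_⟩)
    have := h (j - k) (by omega) (by omega)
    simpa only [Nat.add_sub_cancel' h1.le] using this
  · rw [lintegral_const_mul _ (measurable_ind (dependsOn_avoid n (ω k))),
      ← escapeProb_eq_lintegral]

/-- Each visited point is counted at its last visit. A visit at time `k` is the last one up to time
`N` with probability at most `u (N - k)`, by the Markov property at `k`. -/
theorem lintegral_card_visited_le (N : ℕ) (x : S) {u : ℕ → ℝ≥0∞}
    (hu : ∀ n v, escapeProb Q n v ≤ u n) :
    ∫⁻ ω, (visited N ω).card ∂chainLaw Q x ≤ ∑ j ∈ Finset.range (N + 1), u j := by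
  classical
  have hm : ∀ k, Measurable fun ω : ℕ → S => ind (∀ j, k < j → j ≤ N → ω j ≠ ω k) := fun k => by
    refine measurable_ind (n := max k N) fun ω ω' h => ?_
    simp only [eq_iff_iff]
    rw [h k (by simp)]
    exact forall_congr' fun j => imp_congr_right fun _ => imp_congr_right fun hj => by
      rw [h j (by simp [hj])]
  calc _ = ∫⁻ ω, ∑ k ∈ Finset.range (N + 1), ind (∀ j, k < j → j ≤ N → ω j ≠ ω k)
        ∂chainLaw Q x := by
        refine lintegral_congr fun ω => ?_
        rw [card_visited_eq_card_lastVisit, card_filter_eq_sum_ind]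
    _ = ∑ k ∈ Finset.range (N + 1), ∫⁻ ω, ind (∀ j, k < j → j ≤ N → ω j ≠ ω k) ∂chainLaw Q x :=
        lintegral_finsetSum _ fun k _ => hm k
    _ ≤ ∑ k ∈ Finset.range (N + 1), u (N - k) := by
        refine Finset.sum_le_sum fun k hk => ?_
        have hk' : k + (N - k) = N := by simp only [Finset.mem_range] at hk; omega
        have := lintegral_ind_lastVisit Q k (N - k) x (fun _ => True)
        simp only [true_and, hk', ind_true trivial, one_mul] at this
        rw [this]
        calc _ ≤ ∫⁻ _, u (N - k) ∂chainLaw Q x := lintegral_mono fun ω => hu _ _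
          _ = u (N - k) := by simp
    _ = _ := by
        rw [← Finset.sum_range_reflect]
        refine Finset.sum_congr rfl fun k hk => ?_
        simp only [Finset.mem_range] at hk
        congr 1
        omega

/-- The events "at `x` at time `k` and not again during the next `n` steps", for `k ≤ n`, are
pairwise disjoint, and their probabilities are `p_k(x, x)` times the escape probability. -/
theorem escapeProb_mul_green_le (n : ℕ) (x : S) : escapeProb Q n x * green Q n x x ≤ 1 := by
  have hm : ∀ k, Measurable fun ω : ℕ → S =>
      ind (ω k = x ∧ ∀ j, k < j → j ≤ k + n → ω j ≠ ω k) := fun k => by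
    refine measurable_ind (n := k + n) fun ω ω' h => ?_
    simp only [eq_iff_iff]
    rw [h k (by simp)]
    exact and_congr_right fun _ => forall_congr' fun j => imp_congr_right fun _ =>
      imp_congr_right fun hj => by rw [h j (by simpa using hj)]
  have h1 : ∀ k, ∫⁻ ω, ind (ω k = x ∧ ∀ j, k < j → j ≤ k + n → ω j ≠ ω k) ∂chainLaw Q x =
      transProb Q k x x * escapeProb Q n x := fun k => by
    rw [lintegral_ind_lastVisit Q k n x (fun v => v = x), transProb,
      ← lintegral_ind _ (dependsOn_coord_eq k x),
      ← lintegral_mul_const _ (measurable_ind (dependsOn_coord_eq k x))]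
    refine lintegral_congr fun ω => ?_
    by_cases h : ω k = x
    · rw [h]
    · simp [ind_false h]
  calc _ = ∑ k ∈ Finset.range (n + 1), transProb Q k x x * escapeProb Q n x := by
        rw [green, mul_comm, Finset.sum_mul]
    _ = ∫⁻ ω, ∑ k ∈ Finset.range (n + 1),
          ind (ω k = x ∧ ∀ j, k < j → j ≤ k + n → ω j ≠ ω k) ∂chainLaw Q x := by
        rw [lintegral_finsetSum _ fun k _ => hm k]
        exact Finset.sum_congr rfl fun k _ => (h1 k).symm
    _ ≤ ∫⁻ _, 1 ∂chainLaw Q x := by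
        refine lintegral_mono fun ω => ?_
        classical
        rw [← card_filter_eq_sum_ind]
        refine Nat.cast_le_one.2 (Finset.card_le_one.2 ?_)
        intro a ha b hb
        simp only [Finset.mem_filter, Finset.mem_range] at ha hb
        by_contra hne
        rcases lt_or_gt_of_ne hne with h | h
        · exact ha.2.2 b h (by omega) (hb.2.1.trans ha.2.1.symm)
        · exact hb.2.2 a h (by omega) (ha.2.1.trans hb.2.1.symm)
    _ = 1 := by simp

end Hitting

theorem escapeProb_anti {S : Type*} [MeasurableSpace S] [DiscreteMeasurableSpace S]
    (Q : S → PMF S) {m n : ℕ} (h : m ≤ n) (x : S) : escapeProb Q n x ≤ escapeProb Q m x :=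
  measure_mono fun _ hω j h1 h2 => hω j h1 (h2.trans h)

end Lamplighter

namespace Lamplighter

theorem sum_Ioc_inv_le_log {M L : ℕ} (hM : 1 ≤ M) (hML : M ≤ L) :
    ∑ k ∈ Finset.Ioc M L, (1 : ℝ) / k ≤ Real.log (L / M) := by
  induction L, hML using Nat.le_induction with
  | base => simp [show (M : ℝ) ≠ 0 by positivity]
  | succ L hL ih =>
    have hM0 : (0 : ℝ) < M := by exact_mod_cast hM
    have hL0 : (0 : ℝ) < L := by exact_mod_cast hM.trans hL
    rw [Finset.sum_Ioc_succ_top (by omega)]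
    have h1 : 1 - ((L + 1 : ℝ) / L)⁻¹ ≤ Real.log ((L + 1 : ℝ) / L) :=
      Real.one_sub_inv_le_log_of_pos (by positivity)
    have h2 : 1 - ((L + 1 : ℝ) / L)⁻¹ = 1 / ((L : ℝ) + 1) := by field_simp; ring
    have h3 : Real.log (((L + 1 : ℕ) : ℝ) / M) =
        Real.log (L / M) + Real.log ((L + 1 : ℝ) / L) := by
      rw [← Real.log_mul (by positivity) (by positivity)]
      congr 1
      push_cast
      field_simp
    rw [h3]
    push_cast
    linarith

/-! ### Heat kernel and Green function estimates for the simple random walk. -/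

section SimpleWalk

theorem lt_returnTime_iff {V : Type*} (n : ℕ) (x : V) (ω : ℕ → V) :
    (n : ℕ∞) < returnTime x ω ↔ ∀ j, 1 ≤ j → j ≤ n → ω j ≠ x := by
  unfold returnTime
  constructor
  · intro h j h1 h2 e
    have : sInf ((fun k : ℕ => (k : ℕ∞)) '' {k | 1 ≤ k ∧ ω k = x}) ≤ (j : ℕ∞) :=
      sInf_le ⟨j, ⟨h1, e⟩, rfl⟩
    have h3 := h.trans_le this
    have : n < j := by exact_mod_cast h3
    omega
  · intro h
    have : ((n + 1 : ℕ) : ℕ∞) ≤ sInf ((fun k : ℕ => (k : ℕ∞)) '' {k | 1 ≤ k ∧ ω k = x}) := by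
      refine le_sInf ?_
      rintro _ ⟨k, ⟨h1, h2⟩, rfl⟩
      simp only [Nat.cast_le]
      by_contra hk
      exact h k h1 (by omega) h2
    exact lt_of_lt_of_le (by exact_mod_cast Nat.lt_succ_self n) this

variable {V : Type*} (G : SimpleGraph V) [G.LocallyFinite]

theorem srwStep_apply (hpos : ∀ v, 1 ≤ G.degree v) (v w : V) :
    srwStep G v w = ind (G.Adj v w) * (G.degree v : ℝ≥0∞)⁻¹ := by
  have hne : (G.neighborFinset v).Nonempty := by
    rw [← Finset.card_pos]; exact hpos v
  rw [srwStep, dif_pos hne, PMF.uniformOfFinset_apply]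
  by_cases h : G.Adj v w <;> simp [h, ind]

theorem degree_mul_srwStep (hpos : ∀ v, 1 ≤ G.degree v) (v w : V) :
    (G.degree v : ℝ≥0∞) * srwStep G v w = ind (G.Adj v w) := by
  rw [srwStep_apply G hpos, mul_left_comm, ENNReal.mul_inv_cancel, mul_one]
  · have := hpos v
    simp only [ne_eq, Nat.cast_eq_zero]; omega
  · simp

theorem tsum_srwStep_mul (hpos : ∀ v, 1 ≤ G.degree v) (v : V) (f : V → ℝ≥0∞) :
    ∑' w, srwStep G v w * f w = (G.degree v : ℝ≥0∞)⁻¹ * ∑ w ∈ G.neighborFinset v, f w := by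
  rw [tsum_eq_sum (s := G.neighborFinset v), Finset.mul_sum]
  · refine Finset.sum_congr rfl fun w hw => ?_
    rw [srwStep_apply G hpos, ind_true ((G.mem_neighborFinset v w).1 hw), one_mul]
  · intro w hw
    rw [srwStep_apply G hpos, ind_false (fun h => hw ((G.mem_neighborFinset v w).2 h)), zero_mul,
      zero_mul]

variable [MeasurableSpace V] [DiscreteMeasurableSpace V]

theorem heatKernel_eq_toReal (n : ℕ) (x y : V) :
    heatKernel G n x y = (transProb (srwStep G) n x y).toReal := rfl

theorem noReturnProb_eq_toReal (n : ℕ) (x : V) :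
    noReturnProb G n x = (escapeProb (srwStep G) n x).toReal := by
  simp only [noReturnProb, lt_returnTime_iff]
  rfl

theorem ofReal_noReturnProb (n : ℕ) (x : V) :
    ENNReal.ofReal (noReturnProb G n x) = escapeProb (srwStep G) n x := by
  rw [noReturnProb_eq_toReal, ENNReal.ofReal_toReal]
  exact measure_ne_top _ _

theorem noReturnProb_nonneg (n : ℕ) (x : V) : 0 ≤ noReturnProb G n x := measureReal_nonneg

theorem noReturnProb_le_one (n : ℕ) (x : V) : noReturnProb G n x ≤ 1 := measureReal_le_one

/-- Summing `p_k + p_{k+1} ≥ c / k` gives a harmonic sum, and each `p_k` is used at most twice;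
hence `c / 2`. -/
theorem exists_green_ge (hG : UniformlyWeaklyRecurrent G) :
    ∃ c : ℝ, 0 < c ∧ ∀ N : ℕ, ∀ v,
      ENNReal.ofReal (c * Real.log N) ≤ green (srwStep G) N v v := by
  obtain ⟨c, C, hc, hC, h⟩ := hG
  refine ⟨c / 2, by positivity, fun N v => ?_⟩
  rcases N with _ | N
  · simp
  have hfin : ∀ k, transProb (srwStep G) k v v ≠ ∞ := fun k => measure_ne_top _ _
  have hg : green (srwStep G) (N + 1) v v =
      ENNReal.ofReal (∑ k ∈ Finset.range (N + 2), heatKernel G k v v) := by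
    rw [green, ENNReal.ofReal_sum_of_nonneg (f := fun k => heatKernel G k v v)
      fun k _ => measureReal_nonneg]
    exact Finset.sum_congr rfl fun k _ => (ENNReal.ofReal_toReal (hfin k)).symm
  rw [hg]
  refine ENNReal.ofReal_le_ofReal ?_
  have hnn : ∀ k, 0 ≤ heatKernel G k v v := fun k => measureReal_nonneg
  have h1 : c * Real.log ((N : ℝ) + 1) ≤
      ∑ k ∈ Finset.range N, (heatKernel G (k + 1) v v + heatKernel G (k + 2) v v) := by
    calc c * Real.log ((N : ℝ) + 1) ≤ c * (harmonic N : ℝ) := by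
          gcongr
          exact_mod_cast log_add_one_le_harmonic N
      _ = ∑ k ∈ Finset.range N, c * ((k : ℝ) + 1)⁻¹ := by
          rw [harmonic]; push_cast; rw [Finset.mul_sum]
      _ ≤ _ := by
          refine Finset.sum_le_sum fun k _ => ?_
          have := (h (k + 1) (by omega) v).1
          have hk : (0 : ℝ) < (k : ℝ) + 1 := by positivity
          rw [← div_eq_mul_inv, div_le_iff₀ hk]
          push_cast at this
          linarith [mul_comm ((k : ℝ) + 1)
            (heatKernel G (k + 1) v v + heatKernel G (k + 1 + 1) v v)]
  have h2 : ∑ k ∈ Finset.range N, heatKernel G (k + 1) v v ≤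
      ∑ k ∈ Finset.range (N + 2), heatKernel G k v v := by
    rw [Finset.sum_range_succ, Finset.sum_range_succ']
    linarith [hnn (N + 1), hnn 0]
  have h3 : ∑ k ∈ Finset.range N, heatKernel G (k + 2) v v ≤
      ∑ k ∈ Finset.range (N + 2), heatKernel G k v v := by
    rw [Finset.sum_range_succ', Finset.sum_range_succ']
    linarith [hnn (0 + 1), hnn 0]
  rw [Finset.sum_add_distrib] at h1
  push_cast
  linarith

variable [Countable V]

/-- The diagonal bound is the recurrence assumption; `two_mul_transProb_le` extends it to all pairs
at even times, and an odd time is reached by conditioning on one step. -/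
theorem exists_transProb_le (hpos : ∀ v, 1 ≤ G.degree v) {Δ : ℕ} (hΔ : ∀ v, G.degree v ≤ Δ)
    (hG : UniformlyWeaklyRecurrent G) :
    ∃ K : ℝ, 0 < K ∧ ∀ k, 1 ≤ k → ∀ u v,
      transProb (srwStep G) k u v ≤ ENNReal.ofReal (K / k) := by
  obtain ⟨c, C, hc, hC, h⟩ := hG
  have hdiag : ∀ n, 1 ≤ n → ∀ x, transProb (srwStep G) n x x ≤ ENNReal.ofReal (C / n) := by
    intro n hn x
    have hn' : (0 : ℝ) < n := by exact_mod_cast hn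
    rw [← ENNReal.ofReal_toReal (a := transProb (srwStep G) n x x) (measure_ne_top _ _)]
    refine ENNReal.ofReal_le_ofReal ?_
    have h2 := (h n hn x).2
    rw [heatKernel_eq_toReal, heatKernel_eq_toReal] at h2
    have h3 : 0 ≤ (transProb (srwStep G) (n + 1) x x).toReal := ENNReal.toReal_nonneg
    rw [le_div_iff₀ hn']
    nlinarith
  have hsymm : ∀ x y, (G.degree x : ℝ≥0∞) * srwStep G x y = G.degree y * srwStep G y x := by
    intro x y
    rw [degree_mul_srwStep G hpos, degree_mul_srwStep G hpos, G.adj_comm]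
  have heven : ∀ n, 1 ≤ n → ∀ x y,
      transProb (srwStep G) (n + n) x y ≤ ENNReal.ofReal (Δ * C / (n + n : ℕ)) := by
    intro n hn x y
    have h2 := two_mul_transProb_le (srwStep G) hsymm (D := Δ)
      (fun x => by exact_mod_cast hpos x) (fun x => by exact_mod_cast hΔ x) n x y
    have h3 : 2 * transProb (srwStep G) (n + n) x y ≤
        2 * ENNReal.ofReal (Δ * C / (n + n : ℕ)) := by
      refine h2.trans ?_
      calc _ ≤ (Δ : ℝ≥0∞) * (ENNReal.ofReal (C / (n + n : ℕ)) + ENNReal.ofReal (C / (n + n : ℕ))) := by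
            gcongr <;> exact hdiag _ (by omega) _
        _ = _ := by
            rw [← two_mul, mul_left_comm, mul_div_assoc, ENNReal.ofReal_mul (by positivity),
              ENNReal.ofReal_natCast]
    exact (ENNReal.mul_le_mul_iff_right (by simp) (by simp)).1 h3
  -- The factor 2 absorbs the passage from `2n` to `2n + 1`; the summand 1 covers `k = 1`, where
  -- only `p ≤ 1` is used.
  refine ⟨2 * Δ * C + 1, by positivity, fun k hk u v => ?_⟩
  rcases Nat.even_or_odd' k with ⟨n, rfl | rfl⟩
  · rw [two_mul]
    refine (heven n (by omega) u v).trans (ENNReal.ofReal_le_ofReal ?_)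
    gcongr
    nlinarith [mul_nonneg (Nat.cast_nonneg (α := ℝ) Δ) hC.le]
  · rcases Nat.eq_zero_or_pos n with rfl | hn
    · refine (prob_le_one).trans ?_
      rw [← ENNReal.ofReal_one]
      refine ENNReal.ofReal_le_ofReal ?_
      have : 0 ≤ 2 * (Δ : ℝ) * C := by positivity
      simp only [mul_zero, zero_add, Nat.cast_one, div_one]
      linarith
    · rw [add_comm, transProb_add]
      calc _ ≤ ∑' z, transProb (srwStep G) 1 u z * ENNReal.ofReal ((2 * Δ * C + 1) / (1 + 2 * n : ℕ)) := by
            refine ENNReal.tsum_le_tsum fun z => ?_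
            gcongr
            rw [two_mul]
            refine (heven n hn z v).trans (ENNReal.ofReal_le_ofReal ?_)
            have hn' : (1 : ℝ) ≤ n := by exact_mod_cast hn
            have : 0 ≤ (Δ : ℝ) * C := by positivity
            push_cast
            rw [div_le_div_iff₀ (by positivity) (by positivity)]
            nlinarith
        _ = _ := by rw [ENNReal.tsum_mul_right, tsum_transProb, one_mul]

/-- The hitting probability of `v` is at most `green (2 * N) x v / green N v v`. Summed over `A`,
the numerator is estimated by total mass 1 at each time up to `M`, and by `a K / k` at later times.
Applied with `M` of the order of `a`, this shows that a walk rediscovers only a small part of `A`.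
-/
theorem lintegral_visitedIn_mul_log_le {K c : ℝ} (hK : 0 < K)
    (hp : ∀ k, 1 ≤ k → ∀ u v, transProb (srwStep G) k u v ≤ ENNReal.ofReal (K / k))
    (hg : ∀ N : ℕ, ∀ v, ENNReal.ofReal (c * Real.log N) ≤ green (srwStep G) N v v)
    (A : Finset V) {a : ℝ} (ha : A.card ≤ a) {M N : ℕ} (hM : 1 ≤ M) (hMN : M ≤ 2 * N) (x : V) :
    (∫⁻ ω, visitedIn N (A : Set V) ω ∂chainLaw (srwStep G) x) *
      ENNReal.ofReal (c * Real.log N) ≤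
      ENNReal.ofReal (M + 1 + K * a * Real.log ((2 * N : ℕ) / M)) := by
  have ha0 : 0 ≤ a := (Nat.cast_nonneg _).trans ha
  rw [lintegral_visitedIn]
  have hfin : ∀ f : V → ℝ≥0∞, ∑' v, ind (v ∈ (A : Set V)) * f v = ∑ v ∈ A, f v := by
    intro f
    rw [tsum_eq_sum (s := A) fun v hv => by rw [ind_false (by simpa using hv), zero_mul]]
    exact Finset.sum_congr rfl fun v hv => by rw [ind_true (by simpa using hv), one_mul]
  rw [hfin, Finset.sum_mul]
  have hsmall : ∀ k, ∑ v ∈ A, transProb (srwStep G) k x v ≤ 1 := fun k => by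
    rw [← tsum_transProb (srwStep G) k x]
    exact ENNReal.sum_le_tsum A
  have hlarge : ∀ k, 1 ≤ k → ∑ v ∈ A, transProb (srwStep G) k x v ≤
      ENNReal.ofReal (K * a * (1 / k)) := fun k hk => by
    calc _ ≤ ∑ v ∈ A, ENNReal.ofReal (K / k) := Finset.sum_le_sum fun v _ => hp k hk x v
      _ = ENNReal.ofReal (A.card * (K / k)) := by
          rw [Finset.sum_const, nsmul_eq_mul, ENNReal.ofReal_mul (by positivity),
            ENNReal.ofReal_natCast]
      _ ≤ _ := by
          refine ENNReal.ofReal_le_ofReal ?_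
          calc (A.card : ℝ) * (K / k) ≤ a * (K / k) := by gcongr
            _ = _ := by ring
  calc _ ≤ ∑ v ∈ A, green (srwStep G) (2 * N) x v := by
        refine Finset.sum_le_sum fun v _ => le_trans ?_ (hitProb_mul_green_le (srwStep G) N x v)
        gcongr
        exact hg N v
    _ = ∑ k ∈ Finset.range (2 * N + 1), ∑ v ∈ A, transProb (srwStep G) k x v := by
        simp only [green]; rw [Finset.sum_comm]
    _ = ∑ k ∈ Finset.range (M + 1), ∑ v ∈ A, transProb (srwStep G) k x v +
          ∑ k ∈ Finset.Ioc M (2 * N), ∑ v ∈ A, transProb (srwStep G) k x v := by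
        rw [← Finset.sum_range_add_sum_Ico _ (show M + 1 ≤ 2 * N + 1 by omega)]
        congr 1
        exact Finset.sum_congr (by ext; simp only [Finset.mem_Ico, Finset.mem_Ioc]; omega)
          fun _ _ => rfl
    _ ≤ ∑ k ∈ Finset.range (M + 1), 1 +
          ∑ k ∈ Finset.Ioc M (2 * N), ENNReal.ofReal (K * a * (1 / k)) := by
        refine add_le_add (Finset.sum_le_sum fun k _ => hsmall k) (Finset.sum_le_sum fun k hk => ?_)
        exact hlarge k (by simp only [Finset.mem_Ioc] at hk; omega)
    _ = ENNReal.ofReal (M + 1 + K * a * ∑ k ∈ Finset.Ioc M (2 * N), (1 : ℝ) / k) := by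
        rw [ENNReal.ofReal_add (by positivity) (by positivity), Finset.mul_sum,
          ENNReal.ofReal_sum_of_nonneg fun k _ => by positivity]
        congr 1
        simp only [Finset.sum_const, Finset.card_range, nsmul_eq_mul, mul_one]
        rw [← Nat.cast_one (R := ℝ), ← Nat.cast_add, ENNReal.ofReal_natCast]
    _ ≤ _ := by
        refine ENNReal.ofReal_le_ofReal ?_
        gcongr
        exact sum_Ioc_inv_le_log hM hMN

end SimpleWalk

end Lamplighter

namespace Lamplighter

/-! ### Comparison of powers and logarithms. -/

section Asymptotics

theorem eventually_rpow_add_two_le {s ε : ℝ} (hs : s < 1) (hε : 0 < ε) :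
    ∀ᶠ N : ℕ in atTop, ((N : ℝ) ^ s + 2) ≤ ε * (N / Real.log N) := by
  have hlog : Tendsto (fun N : ℕ => Real.log (N : ℝ)) atTop atTop :=
    Real.tendsto_log_atTop.comp tendsto_natCast_atTop_atTop
  have h0 : 0 ≤ max s 0 := le_max_right _ _
  have hs' : 0 < 1 - max s 0 := by
    have : max s 0 < 1 := max_lt hs one_pos
    linarith
  have h1 := (isLittleO_log_rpow_atTop hs').comp_tendsto tendsto_natCast_atTop_atTop
  have h2 := h1.def (show 0 < ε / 3 by positivity)
  filter_upwards [h2, hlog.eventually_gt_atTop 0, eventually_ge_atTop 1] with N h hl hN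
  have hN' : (1 : ℝ) ≤ N := by exact_mod_cast hN
  have hN0 : (0 : ℝ) < N := by linarith
  simp only [Function.comp_apply, Real.norm_eq_abs, abs_of_pos hl,
    abs_of_nonneg (Real.rpow_nonneg hN0.le _)] at h
  rw [mul_div_assoc', le_div_iff₀ hl]
  have h3 : (N : ℝ) ^ s ≤ (N : ℝ) ^ max s 0 :=
    Real.rpow_le_rpow_of_exponent_le hN' (le_max_left _ _)
  have h4 : (1 : ℝ) ≤ (N : ℝ) ^ max s 0 := Real.one_le_rpow hN' h0
  calc ((N : ℝ) ^ s + 2) * Real.log N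
      ≤ (3 * (N : ℝ) ^ max s 0) * (ε / 3 * (N : ℝ) ^ (1 - max s 0)) := by
        gcongr; linarith
    _ = ε * ((N : ℝ) ^ max s 0 * (N : ℝ) ^ (1 - max s 0)) := by ring
    _ = ε * N := by rw [← Real.rpow_add hN0]; simp

theorem eventually_log_pow_le (p : ℕ) (C : ℝ) {ε : ℝ} (hε : 0 < ε) :
    ∀ᶠ n : ℕ in atTop, C * Real.log n ^ p + C ≤ (n : ℝ) ^ ε := by
  have h1 : (fun x : ℝ => C * Real.log x ^ p + C) =o[atTop] fun x : ℝ => x ^ ε := by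
    refine Asymptotics.IsLittleO.add ?_ ?_
    · have := (isLittleO_log_rpow_rpow_atTop (p : ℝ) hε).const_mul_left C
      simpa using this
    · exact Asymptotics.isLittleO_const_left.2 (Or.inr (tendsto_norm_atTop_atTop.comp
        (tendsto_rpow_atTop hε)))
  filter_upwards [(h1.comp_tendsto tendsto_natCast_atTop_atTop).def one_pos] with n hn
  simp only [Function.comp_apply, one_mul, Real.norm_eq_abs] at hn
  exact (le_abs_self _).trans (hn.trans (abs_of_nonneg (by positivity)).le)

end Asymptotics

/-! ### Mean and upper tail of the range of the simple random walk. -/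

section SimpleWalk

variable {V : Type*} (G : SimpleGraph V) [G.LocallyFinite]
  [MeasurableSpace V] [DiscreteMeasurableSpace V]

theorem bddAbove_noReturnProb (n : ℕ) : BddAbove (Set.range fun x : V => noReturnProb G n x) :=
  ⟨1, by rintro _ ⟨x, rfl⟩; exact noReturnProb_le_one G n x⟩

theorem bddBelow_noReturnProb (n : ℕ) : BddBelow (Set.range fun x : V => noReturnProb G n x) :=
  ⟨0, by rintro _ ⟨x, rfl⟩; exact noReturnProb_nonneg G n x⟩

theorem eventually_noReturnProb_le {ρ : ℝ} (hρ : rSup G < ρ) :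
    ∀ᶠ n : ℕ in atTop, ∀ x, Real.log n * noReturnProb G n x ≤ ρ := by
  filter_upwards [eventually_lt_of_limsup_lt hρ, eventually_ge_atTop 1] with n hn h1 x
  have hn' : Real.log n * ⨆ x : V, noReturnProb G n x < ρ := by exact_mod_cast hn
  have hl : 0 ≤ Real.log n := Real.log_nonneg (by exact_mod_cast h1)
  exact (mul_le_mul_of_nonneg_left (le_ciSup (bddAbove_noReturnProb G n) x) hl).trans hn'.le

theorem eventually_le_noReturnProb {r : ℝ} (hr : r < rInf G) :
    ∀ᶠ n : ℕ in atTop, ∀ x, r ≤ Real.log n * noReturnProb G n x := by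
  filter_upwards [eventually_lt_of_lt_liminf hr, eventually_ge_atTop 1] with n hn h1 x
  have hn' : r < Real.log n * ⨅ x : V, noReturnProb G n x := by exact_mod_cast hn
  have hl : 0 ≤ Real.log n := Real.log_nonneg (by exact_mod_cast h1)
  exact hn'.le.trans (mul_le_mul_of_nonneg_left (ciInf_le (bddBelow_noReturnProb G n) x) hl)

theorem rInf_le_rSup [Nonempty V] : rInf G ≤ rSup G := by
  refine (liminf_le_liminf ?_).trans liminf_le_limsup
  filter_upwards [eventually_ge_atTop 1] with n hn
  have hl : 0 ≤ Real.log n := Real.log_nonneg (by exact_mod_cast hn)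
  have : ⨅ x : V, noReturnProb G n x ≤ ⨆ x : V, noReturnProb G n x :=
    ciInf_le_ciSup (bddBelow_noReturnProb G n) (bddAbove_noReturnProb G n)
  exact_mod_cast mul_le_mul_of_nonneg_left this hl

theorem rInf_nonneg : 0 ≤ rInf G := by
  refine le_liminf_of_le (by isBoundedDefault) ?_
  filter_upwards [eventually_ge_atTop 1] with n hn
  have hl : 0 ≤ Real.log n := Real.log_nonneg (by exact_mod_cast hn)
  have : 0 ≤ ⨅ x : V, noReturnProb G n x := Real.iInf_nonneg fun x => noReturnProb_nonneg G n x
  exact_mod_cast mul_nonneg hl this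

variable [Countable V]

/-- The escape probability is at most the inverse of the Green function, which is at least `c log
n`. -/
theorem exists_rSup_le [Nonempty V] (hG : UniformlyWeaklyRecurrent G) :
    ∃ C : ℝ, 0 < C ∧ rSup G ≤ C := by
  obtain ⟨c, hc, h⟩ := exists_green_ge G hG
  refine ⟨1 / c, by positivity, limsup_le_of_le (by isBoundedDefault) ?_⟩
  filter_upwards [eventually_ge_atTop 1] with n hn
  have hl : 0 ≤ Real.log n := Real.log_nonneg (by exact_mod_cast hn)
  rw [EReal.coe_le_coe_iff, Real.mul_iSup_of_nonneg hl]
  refine ciSup_le fun x => ?_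
  have h1 : escapeProb (srwStep G) n x * ENNReal.ofReal (c * Real.log n) ≤ 1 :=
    (mul_le_mul_right (h n x) _).trans (escapeProb_mul_green_le (srwStep G) n x)
  rw [← ofReal_noReturnProb, ← ENNReal.ofReal_mul (noReturnProb_nonneg G n x),
    ENNReal.ofReal_le_one] at h1
  rw [le_div_iff₀ hc]
  linarith

/-- The sum of escape probabilities is split at `M = ⌈N ^ s⌉` with `s < 1`. The terms before `M` are
bounded by 1 and are negligible in total; the later ones are at most `ρ' / log M ≤ (ρ' / s) / log
N`. -/
theorem eventually_lintegral_card_visited_le {ρ : ℝ} (hρ0 : 0 < ρ) (hρ : rSup G < ρ) :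
    ∀ᶠ N : ℕ in atTop, ∀ x, ∫⁻ ω, (visited N ω).card ∂chainLaw (srwStep G) x ≤
      ENNReal.ofReal (ρ * (N / Real.log N)) := by
  obtain ⟨ρ₁, h1, h2⟩ := EReal.lt_iff_exists_real_btwn.1 hρ
  have h2 : ρ₁ < ρ := by exact_mod_cast h2
  set ρ' := max ρ₁ (ρ / 2) with hρ'
  have hρ'0 : 0 < ρ' := lt_max_of_lt_right (by positivity)
  have hρ'ρ : ρ' < ρ := max_lt h2 (by linarith)
  have hρ'S : rSup G < ρ' := h1.trans_le (by exact_mod_cast le_max_left _ _)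
  -- The choice `ρ' / ρ < s < 1` makes `ρ' / s < ρ`.
  obtain ⟨s, hs1, hs2⟩ := exists_between ((div_lt_one hρ0).2 hρ'ρ)
  have hs0 : 0 < s := (by positivity : 0 < ρ' / ρ).trans hs1
  have hε : 0 < ρ - ρ' / s := by
    rw [sub_pos, div_lt_iff₀ hs0, ← div_lt_iff₀' hρ0]; exact hs1
  have hpow : Tendsto (fun N : ℕ => ⌈(N : ℝ) ^ s⌉₊) atTop atTop :=
    tendsto_nat_ceil_atTop.comp ((tendsto_rpow_atTop hs0).comp tendsto_natCast_atTop_atTop)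
  have hlog : Tendsto (fun N : ℕ => Real.log (N : ℝ)) atTop atTop :=
    Real.tendsto_log_atTop.comp tendsto_natCast_atTop_atTop
  have hε2 : 0 < (ρ - ρ' / s) / 2 := by positivity
  filter_upwards [hpow.eventually (eventually_noReturnProb_le G hρ'S),
    eventually_rpow_add_two_le hs2 hε2, hlog.eventually_gt_atTop 0,
    hlog.eventually_gt_atTop (2 * (ρ' / s) / (ρ - ρ' / s)),
    eventually_ge_atTop 1] with N hM hN hl hl2 hN1 x
  set M := ⌈(N : ℝ) ^ s⌉₊ with hMdef
  have hN' : (1 : ℝ) ≤ N := by exact_mod_cast hN1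
  have hMs : (N : ℝ) ^ s ≤ M := Nat.le_ceil _
  have hMs' : (M : ℝ) ≤ (N : ℝ) ^ s + 1 := (Nat.ceil_lt_add_one (by positivity)).le
  have hlogM : s * Real.log N ≤ Real.log M := by
    rw [← Real.log_rpow (by linarith)]
    exact Real.log_le_log (by positivity) hMs
  have hsl : 0 < s * Real.log N := by positivity
  have hesc : ∀ n v, escapeProb (srwStep G) n v ≤
      ENNReal.ofReal (if n < M then 1 else ρ' / (s * Real.log N)) := by
    intro n v
    split_ifs with h
    · rw [ENNReal.ofReal_one]; exact prob_le_one
    · refine (escapeProb_anti _ (not_lt.1 h) v).trans ?_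
      rw [← ofReal_noReturnProb]
      refine ENNReal.ofReal_le_ofReal ?_
      rw [le_div_iff₀ hsl]
      have := hM v
      nlinarith [noReturnProb_nonneg G M v]
  refine (lintegral_card_visited_le (srwStep G) N x hesc).trans ?_
  have hnn : ∀ n : ℕ, 0 ≤ (if n < M then 1 else ρ' / (s * Real.log N)) := fun n => by
    split_ifs <;> positivity
  rw [← ENNReal.ofReal_sum_of_nonneg fun n _ => hnn n]
  refine ENNReal.ofReal_le_ofReal ?_
  calc ∑ n ∈ Finset.range (N + 1), (if n < M then 1 else ρ' / (s * Real.log N))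
      ≤ ∑ n ∈ Finset.range (N + 1), ((if n < M then 1 else 0) + ρ' / (s * Real.log N)) := by
        refine Finset.sum_le_sum fun n _ => ?_
        have : 0 < ρ' / (s * Real.log N) := by positivity
        split_ifs <;> linarith
    _ ≤ M + (N + 1) * (ρ' / (s * Real.log N)) := by
        rw [Finset.sum_add_distrib]
        simp only [Finset.sum_boole, Finset.sum_const, Finset.card_range, nsmul_eq_mul]
        push_cast
        gcongr
        calc _ ≤ (Finset.range M).card := by
              refine Finset.card_le_card fun n hn => ?_
              simp only [Finset.mem_filter] at hn
              exact Finset.mem_range.2 hn.2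
          _ = M := Finset.card_range M
    _ = M + (ρ' / s) * (N / Real.log N) + (ρ' / s) / Real.log N := by field_simp; ring
    _ ≤ ρ * (N / Real.log N) := by
        have h3 : (ρ' / s) / Real.log N ≤ (ρ - ρ' / s) / 2 := by
          rw [div_le_iff₀ hl]
          rw [div_lt_iff₀ hε] at hl2
          nlinarith
        have h5 : (ρ - ρ' / s) / 2 ≤ (ρ - ρ' / s) / 2 * (N / Real.log N) := by
          refine le_mul_of_one_le_right hε2.le ?_
          rw [one_le_div hl]
          exact (Real.log_le_sub_one_of_pos (by linarith)).trans (by linarith)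
        nlinarith

/-- The chord of the convex function `exp` over `[0, θ * B]`: for a variable with values in `[0,
B]`, a bound on the mean gives one on the exponential moment. -/
theorem exp_mul_le_of_le {θ B k : ℝ} (hB : 0 < B) (hk0 : 0 ≤ k) (hk : k ≤ B) :
    Real.exp (θ * k) ≤ 1 + k * ((Real.exp (θ * B) - 1) / B) := by
  have h := convexOn_exp.2 (Set.mem_univ 0) (Set.mem_univ (θ * B))
    (show 0 ≤ 1 - k / B by rw [sub_nonneg, div_le_one hB]; exact hk)
    (show 0 ≤ k / B by positivity) (by ring)
  simp only [smul_eq_mul, mul_zero, zero_add, Real.exp_zero, mul_one] at h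
  have e : k / B * (θ * B) = θ * k := by field_simp
  rw [e] at h
  calc _ ≤ _ := h
    _ = _ := by field_simp; ring

/-- Exponential Chebyshev bound for the range, through its subadditivity over blocks. -/
theorem measure_card_visited_ge_le (Q : V → PMF V) {L : ℕ} {b : ℝ} (hb0 : 0 ≤ b)
    (hb : ∀ x, ∫⁻ ω, (visited L ω).card ∂chainLaw Q x ≤ ENNReal.ofReal b) {t : ℝ} (ht : 0 ≤ t)
    (m : ℕ) (y : ℝ) (x : V) :
    chainLaw Q x {ω | y ≤ (visited (m * L) ω).card} ≤
      ENNReal.ofReal (Real.exp (m * (b / (L + 1) * (Real.exp t - 1)) - t / (L + 1) * (y - 1))) := by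
  -- A block of `L` steps visits at most `L + 1` points, so `θ` times its range stays below `t`.
  set θ := t / ((L : ℝ) + 1) with hθ
  have hL : (0 : ℝ) < (L : ℝ) + 1 := by positivity
  have hθ0 : 0 ≤ θ := by positivity
  have hθL : θ * (L + 1) = t := by rw [hθ]; field_simp
  set F : (ℕ → V) → ℝ≥0∞ := fun ω => ENNReal.ofReal (Real.exp (θ * (visited L ω).card)) with hF
  have hFdep : DependsOn F (Set.Iic L) := fun ω ω' h => by simp only [hF, dependsOn_visited L h]
  have het : 0 ≤ (Real.exp t - 1) / (L + 1) :=
    div_nonneg (by linarith [Real.add_one_le_exp t]) hL.le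
  have hcF : ∀ x, ∫⁻ ω, F ω ∂chainLaw Q x ≤
      ENNReal.ofReal (Real.exp (b / (L + 1) * (Real.exp t - 1))) := by
    intro x
    calc _ ≤ ∫⁻ ω, (1 + (visited L ω).card * ENNReal.ofReal ((Real.exp t - 1) / (L + 1)))
          ∂chainLaw Q x := by
          refine lintegral_mono fun ω => ?_
          rw [← ENNReal.ofReal_natCast, ← ENNReal.ofReal_mul (by positivity), ← ENNReal.ofReal_one,
            ← ENNReal.ofReal_add (by norm_num) (by positivity)]
          refine ENNReal.ofReal_le_ofReal ?_
          have := exp_mul_le_of_le (θ := θ) hL (Nat.cast_nonneg (visited L ω).card)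
            (by exact_mod_cast card_visited_le L ω)
          rwa [hθL] at this
      _ = 1 + (∫⁻ ω, (visited L ω).card ∂chainLaw Q x) *
            ENNReal.ofReal ((Real.exp t - 1) / (L + 1)) := by
          rw [lintegral_add_left measurable_const, lintegral_const, measure_univ, mul_one,
            lintegral_mul_const' _ _ ENNReal.ofReal_ne_top]
      _ ≤ 1 + ENNReal.ofReal b * ENNReal.ofReal ((Real.exp t - 1) / (L + 1)) := by
          gcongr; exact hb x
      _ ≤ _ := by
          rw [← ENNReal.ofReal_mul hb0, ← ENNReal.ofReal_one,
            ← ENNReal.ofReal_add (by norm_num) (by positivity)]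
          refine ENNReal.ofReal_le_ofReal ?_
          have := Real.add_one_le_exp (b / (L + 1) * (Real.exp t - 1))
          calc _ = b / (L + 1) * (Real.exp t - 1) + 1 := by ring
            _ ≤ _ := this
  have hprod := lintegral_prod_blocks_le Q hFdep hcF m x
  have hmk : ENNReal.ofReal (Real.exp (θ * (y - 1))) * chainLaw Q x {ω | y ≤ (visited (m * L) ω).card} ≤
      ENNReal.ofReal (Real.exp (b / (L + 1) * (Real.exp t - 1))) ^ m := by
    refine le_trans ?_ hprod
    rw [← lintegral_ind _ (n := m * L) (p := fun ω => y ≤ (visited (m * L) ω).card)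
      (fun ω ω' h => by simp only [dependsOn_visited _ h]), ← lintegral_const_mul' _ _ (by simp)]
    refine lintegral_mono fun ω => ?_
    by_cases h : y ≤ (visited (m * L) ω).card
    · rw [ind_true h, mul_one, ← ENNReal.ofReal_prod_of_nonneg fun _ _ => (Real.exp_pos _).le,
        ← Real.exp_sum]
      refine ENNReal.ofReal_le_ofReal (Real.exp_le_exp.2 ?_)
      rw [← Finset.mul_sum]
      refine mul_le_mul_of_nonneg_left ?_ hθ0
      have := card_visited_mul_le m L ω
      have : ((visited (m * L) ω).card : ℝ) ≤
        (∑ i ∈ Finset.range m, ((visited L (fun j => ω (i * L + j))).card : ℝ)) + 1 := by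
        exact_mod_cast this
      linarith
    · rw [ind_false h, mul_zero]; exact zero_le
  rw [← ENNReal.ofReal_pow (Real.exp_pos _).le, ← Real.exp_nat_mul] at hmk
  rw [Real.exp_sub, ENNReal.ofReal_div_of_pos (Real.exp_pos _),
    ENNReal.le_div_iff_mul_le (by simp [Real.exp_pos]) (by simp), mul_comm]
  exact hmk

/-- The exponent is at most `-ε²ρ n / (ℓ (L + 1))`, and `n / (L + 1)` is at least `ℓ³ / 4`; the gain
is thus of order `ℓ²` and exceeds `2ℓ` for large `ℓ`. This is why at least `ℓ³` blocks are used. -/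
theorem chernoff_exponent_le {ε ρ ℓ m L n b : ℝ} (hε0 : 0 < ε) (hε1 : ε < 1) (hρ : 0 < ρ)
    (hl : 0 < ℓ) (hn : 0 ≤ n) (hm : ℓ ^ 3 ≤ m) (hb0 : 0 ≤ b) (hL : 0 ≤ L)
    (hmL : m * L ≤ (1 + ε) * n) (hmn : m ≤ n) (hexp : Real.exp ε - 1 ≤ ε * (1 + ε))
    (hmb : m * b * (1 + ε) ≤ (1 - ε) ^ 2 * (ρ * (n / ℓ)))
    (hy : 1 ≤ ε * (1 - ε) * (ρ * (n / ℓ))) (hl8 : 8 / (ε * ε * ρ) ≤ ℓ) :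
    m * (b / (L + 1) * (Real.exp ε - 1)) - ε / (L + 1) * (ρ * (n / ℓ) - 1) ≤ -(2 * ℓ) := by
  have hLp : (0 : ℝ) < L + 1 := by positivity
  have hm0 : 0 ≤ m := (by positivity : 0 ≤ ℓ ^ 3).trans hm
  have h4 : ℓ ^ 3 / 4 ≤ n / (L + 1) := by
    rw [le_div_iff₀ hLp]
    have h6 : (1 + ε) * n ≤ 2 * n := mul_le_mul_of_nonneg_right (by linarith) hn
    have h5 : m * (L + 1) ≤ 3 * n := by rw [mul_add, mul_one]; linarith
    have h7 : ℓ ^ 3 * (L + 1) ≤ m * (L + 1) := mul_le_mul_of_nonneg_right hm hLp.le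
    linarith
  calc _ ≤ m * (b / (L + 1) * (ε * (1 + ε))) - ε / (L + 1) * (ρ * (n / ℓ) - 1) := by gcongr
    _ = ε / (L + 1) * (m * b * (1 + ε) - ρ * (n / ℓ) + 1) := by ring
    _ ≤ ε / (L + 1) * (-(ε * (ρ * (n / ℓ)))) := by
        refine mul_le_mul_of_nonneg_left ?_ (by positivity)
        have : (1 - ε) ^ 2 * (ρ * (n / ℓ)) + ε * (1 - ε) * (ρ * (n / ℓ)) - ρ * (n / ℓ) =
          -(ε * (ρ * (n / ℓ))) := by ring
        linarith
    _ = -(ε * ε * ρ * (n / (L + 1)) / ℓ) := by field_simp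
    _ ≤ -(2 * ℓ) := by
        rw [neg_le_neg_iff, le_div_iff₀ hl]
        rw [div_le_iff₀ (by positivity)] at hl8
        calc 2 * ℓ * ℓ = 8 * ℓ ^ 2 / 4 := by ring
          _ ≤ (ℓ * (ε * ε * ρ)) * ℓ ^ 2 / 4 := by gcongr
          _ = ε * ε * ρ * (ℓ ^ 3 / 4) := by ring
          _ ≤ _ := by gcongr

/-- Upper tail of the range at the scale given by `rSup`, with summable error. -/
theorem eventually_measure_card_visited_ge_le [Nonempty V] {ρ : ℝ} (hρ : rSup G < ρ) :
    ∀ᶠ n : ℕ in atTop, ∀ x, chainLaw (srwStep G) x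
      {ω | ρ * (n / Real.log n) ≤ (visited n ω).card} ≤ ENNReal.ofReal (1 / (n : ℝ) ^ 2) := by
  obtain ⟨ρ₁, hρ₁, hρ₁ρ⟩ := EReal.lt_iff_exists_real_btwn.1 hρ
  have hρ₁ρ : ρ₁ < ρ := by exact_mod_cast hρ₁ρ
  have hρ₁0 : 0 < ρ₁ := by
    have : (0 : EReal) < ρ₁ := ((rInf_nonneg G).trans (rInf_le_rSup G)).trans_lt hρ₁
    exact_mod_cast this
  have hρ0 : 0 < ρ := hρ₁0.trans hρ₁ρ
  -- The losses to be absorbed between `ρ₁` and `ρ`: a factor `1 + ε` from `m L ≤ (1 + ε) n`,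
  -- another from `exp ε - 1 ≤ ε (1 + ε)`, and `1 - ε` from `log L ≥ (1 - ε) log n`. The remaining
  -- `(1 - ε)²` makes the Chernoff exponent negative.
  obtain ⟨ε, hε, hε0, hε1⟩ : ∃ ε : ℝ, ρ₁ * (1 + ε) ^ 2 < ρ * (1 - ε) ^ 3 ∧ 0 < ε ∧ ε < 1 := by
    have hc : Tendsto (fun ε : ℝ => ρ * (1 - ε) ^ 3 - ρ₁ * (1 + ε) ^ 2) (𝓝[>] 0)
        (𝓝 (ρ * (1 - 0) ^ 3 - ρ₁ * (1 + 0) ^ 2)) :=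
      tendsto_nhdsWithin_of_tendsto_nhds (Continuous.tendsto (by fun_prop) 0)
    have h1 := hc.eventually_const_lt (show (0 : ℝ) < _ by norm_num; exact hρ₁ρ)
    obtain ⟨ε, h1, h2⟩ := (h1.and (Ioo_mem_nhdsGT (show (0 : ℝ) < 1 by norm_num))).exists
    exact ⟨ε, by linarith, h2.1, h2.2⟩
  have hlog : Tendsto (fun N : ℕ => Real.log (N : ℝ)) atTop atTop :=
    Real.tendsto_log_atTop.comp tendsto_natCast_atTop_atTop
  -- The block length is eventually at least `n ^ (1 / 2)`, so the bound on the mean range applies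
  -- to single blocks.
  have hL : Tendsto (fun n : ℕ => ⌈(n : ℝ) / ⌈Real.log n ^ 3⌉₊⌉₊) atTop atTop := by
    refine tendsto_atTop_mono' _ ?_ (tendsto_nat_ceil_atTop.comp
      ((tendsto_rpow_atTop (show (0 : ℝ) < 1 / 2 by norm_num)).comp tendsto_natCast_atTop_atTop))
    filter_upwards [eventually_log_pow_le 3 1 (show (0 : ℝ) < 1 / 2 by norm_num),
      hlog.eventually_gt_atTop 0, eventually_ge_atTop 1] with n hn hl hn1
    simp only [one_mul] at hn
    have hn' : (0 : ℝ) < n := by exact_mod_cast hn1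
    refine Nat.ceil_mono ?_
    have hm : (0 : ℝ) < ⌈Real.log n ^ 3⌉₊ := by
      exact_mod_cast Nat.ceil_pos.2 (by positivity)
    simp only [Function.comp_apply]
    rw [le_div_iff₀ hm]
    have hm2 : (⌈Real.log n ^ 3⌉₊ : ℝ) ≤ (n : ℝ) ^ (1 / 2 : ℝ) :=
      (Nat.ceil_lt_add_one (by positivity)).le.trans hn
    calc _ ≤ (n : ℝ) ^ (1 / 2 : ℝ) * (n : ℝ) ^ (1 / 2 : ℝ) := by gcongr
      _ = n := by rw [← Real.rpow_add hn']; norm_num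
  filter_upwards [hL.eventually (eventually_lintegral_card_visited_le G hρ₁0 hρ₁),
    hL.eventually (eventually_ge_atTop 2),
    eventually_log_pow_le 3 1 hε0, eventually_log_pow_le 3 (4 / ε) (show (0 : ℝ) < 1 by norm_num),
    eventually_log_pow_le 1 (1 / (ε * (1 - ε) * ρ))  (show (0 : ℝ) < 1 by norm_num),
    hlog.eventually_ge_atTop 1, hlog.eventually_ge_atTop (8 / (ε * ε * ρ)),
    eventually_ge_atTop 1] with n hb hL2 hmε hmn h1n hl1 hl8 hn1 x
  set ℓ := Real.log (n : ℝ) with hℓ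
  set m := ⌈ℓ ^ 3⌉₊ with hm
  set L := ⌈(n : ℝ) / m⌉₊ with hLdef
  have hn0 : (0 : ℝ) < n := by exact_mod_cast hn1
  have hl0 : 0 < ℓ := by linarith
  have hm0 : (0 : ℝ) < m := by exact_mod_cast Nat.ceil_pos.2 (by positivity)
  have hm3 : ℓ ^ 3 ≤ m := Nat.le_ceil _
  have hm4 : (m : ℝ) ≤ ℓ ^ 3 + 1 := (Nat.ceil_lt_add_one (by positivity)).le
  have hL0 : (2 : ℝ) ≤ L := by exact_mod_cast hL2
  have hLn : (n : ℝ) / m ≤ L := Nat.le_ceil _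
  have hLn' : (L : ℝ) ≤ n / m + 1 := (Nat.ceil_lt_add_one (by positivity)).le
  rw [Real.rpow_one] at hmn h1n
  have hmn' : (m : ℝ) ≤ ε / 4 * n := by
    have : ℓ ^ 3 + 1 ≤ ε / 4 * n := by
      have h := mul_le_mul_of_nonneg_left hmn (show 0 ≤ ε / 4 by positivity)
      field_simp at h ⊢
      linarith
    linarith
  have hmL : (n : ℝ) ≤ m * L := by rwa [div_le_iff₀' hm0] at hLn
  have hmL' : (m : ℝ) * L ≤ (1 + ε) * n := by
    calc (m : ℝ) * L ≤ m * (n / m + 1) := by gcongr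
      _ = n + m := by field_simp
      _ ≤ _ := by nlinarith
  have hlogL : (1 - ε) * ℓ ≤ Real.log L := by
    calc (1 - ε) * ℓ = Real.log ((n : ℝ) ^ (1 - ε)) := by rw [Real.log_rpow hn0]
      _ ≤ Real.log L := by
          refine Real.log_le_log (by positivity) (le_trans ?_ hLn)
          rw [le_div_iff₀ hm0]
          calc (n : ℝ) ^ (1 - ε) * m ≤ (n : ℝ) ^ (1 - ε) * (n : ℝ) ^ ε := by
                gcongr; linarith
            _ = n := by rw [← Real.rpow_add hn0]; simp
  have h1ε : 0 < 1 - ε := by linarith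
  have hlogL0 : 0 < Real.log L := lt_of_lt_of_le (by positivity) hlogL
  have hy1 : 1 ≤ ε * (1 - ε) * (ρ * (n / ℓ)) := by
    have h0 : 0 < ε * (1 - ε) * ρ := by positivity
    have h := mul_le_mul_of_nonneg_left h1n h0.le
    rw [show ε * (1 - ε) * ρ * (1 / (ε * (1 - ε) * ρ) * ℓ ^ 1 + 1 / (ε * (1 - ε) * ρ)) =
      (ε * (1 - ε) * ρ * (1 / (ε * (1 - ε) * ρ))) * (ℓ + 1) by ring,
      mul_one_div_cancel h0.ne', one_mul] at h
    calc (1 : ℝ) ≤ (ε * (1 - ε) * ρ * n) / ℓ := by rw [le_div_iff₀ hl0]; linarith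
      _ = _ := by ring
  set b := ρ₁ * (L / Real.log L) with hbdef
  have hb0 : 0 ≤ b := by positivity
  have hmb : m * b * (1 + ε) ≤ (1 - ε) ^ 2 * (ρ * (n / ℓ)) := by
    calc m * b * (1 + ε) = ρ₁ * (1 + ε) * ((m * L) / Real.log L) := by rw [hbdef]; ring
      _ ≤ ρ₁ * (1 + ε) * (((1 + ε) * n) / ((1 - ε) * ℓ)) := by gcongr
      _ = (ρ₁ * (1 + ε) ^ 2) * (n / ((1 - ε) * ℓ)) := by ring
      _ ≤ (ρ * (1 - ε) ^ 3) * (n / ((1 - ε) * ℓ)) := by gcongr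
      _ = _ := by field_simp
  have hmain := measure_card_visited_ge_le (srwStep G) hb0 hb hε0.le m (ρ * (n / ℓ)) x
  have hsub : chainLaw (srwStep G) x {ω | ρ * (n / ℓ) ≤ (visited n ω).card} ≤
      chainLaw (srwStep G) x {ω | ρ * (n / ℓ) ≤ (visited (m * L) ω).card} := by
    refine measure_mono fun ω hω => ?_
    simp only [Set.mem_ofPred_eq] at hω ⊢
    refine hω.trans ?_
    exact_mod_cast Finset.card_le_card (visited_mono ω (by exact_mod_cast hmL))
  refine hsub.trans (hmain.trans (ENNReal.ofReal_le_ofReal ?_))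
  have hexp : Real.exp ε - 1 ≤ ε * (1 + ε) := by
    have := Real.abs_exp_sub_one_sub_id_le (x := ε) (by rw [abs_of_pos hε0]; exact hε1.le)
    have := (abs_le.1 this).2
    nlinarith
  have hbd := chernoff_exponent_le hε0 hε1 hρ0 hl0 hn0.le hm3 hb0 (Nat.cast_nonneg L) hmL'
    (hmn'.trans (by nlinarith)) hexp hmb hy1 hl8
  calc _ ≤ Real.exp (-(2 * ℓ)) := Real.exp_le_exp.2 hbd
    _ = 1 / (n : ℝ) ^ 2 := by
        rw [Real.exp_neg, two_mul, Real.exp_add, hℓ, Real.exp_log hn0, one_div, sq]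

end SimpleWalk

end Lamplighter

namespace Lamplighter

theorem tsum_bind_mul {α β : Type*} (p : PMF α) (f : α → PMF β) (F : β → ℝ≥0∞) :
    ∑' b, (p.bind f) b * F b = ∑' a, p a * ∑' b, f a b * F b := by
  simp_rw [PMF.bind_apply, ← ENNReal.tsum_mul_right, ← ENNReal.tsum_mul_left]
  rw [ENNReal.tsum_comm]
  exact tsum_congr fun a => tsum_congr fun b => mul_assoc _ _ _

theorem tsum_pure_mul {α : Type*} (a : α) (F : α → ℝ≥0∞) :
    ∑' b, PMF.pure a b * F b = F a := by
  rw [tsum_eq_single a fun b hb => by rw [PMF.pure_apply, if_neg hb, zero_mul]]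
  simp

theorem sum_zmod_two {M : Type*} [AddCommMonoid M] (F : ZMod 2 → M) : ∑ a, F a = F 0 + F 1 :=
  Fin.sum_univ_two F

theorem half_mul_sum_zmod_two_const (c : ℝ≥0∞) : 2⁻¹ * ∑ _a : ZMod 2, c = c := by
  rw [sum_zmod_two, ← two_mul, ← mul_assoc, ENNReal.inv_mul_cancel (by simp) (by simp), one_mul]

theorem tsum_uniform_zmod_two_mul (F : ZMod 2 → ℝ≥0∞) :
    ∑' a, PMF.uniformOfFintype (ZMod 2) a * F a = 2⁻¹ * (F 0 + F 1) := by
  rw [tsum_fintype]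
  simp only [PMF.uniformOfFintype_apply, ZMod.card, Nat.cast_ofNat]
  rw [← Finset.mul_sum]
  congr 1
  exact sum_zmod_two F

instance (V : Type*) [Countable V] : Countable (LampState V) :=
  Function.Injective.countable (f := fun s : LampState V => (s.lamps, s.pos)) fun s t h => by
    simp only [Prod.mk.injEq] at h
    exact LampState.ext h.1 h.2

/-- The number of lamps in different states in `s` and `t`. -/
noncomputable def diffCount {V : Type*} (s t : LampState V) : ℕ := (s.lamps - t.lamps).support.card

/-- The trajectory of the lamplighter. -/
def posPath {V : Type*} (Y : ℕ → LampState V) : ℕ → V := fun i => (Y i).pos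

/-- The properties of the one-step transition probabilities of a lamplighter walk on `{0,1} ≀ G`
that determine its rate of escape: the lamplighter moves along edges and changes lamps only at its
positions before and after the step, its range is dominated by that of the simple random walk, and
the lamps it leaves behind are flipped sufficiently often. -/
structure IsLamplighterStep {V : Type*} (G : SimpleGraph V) [G.LocallyFinite] (Δ : ℕ)
    (Q : LampState V → PMF (LampState V)) : Prop where
  pos_step : ∀ s t, Q s t ≠ 0 → s.pos = t.pos ∨ G.Adj s.pos t.pos
  lamps_step : ∀ s t, Q s t ≠ 0 → ∀ v, v ≠ s.pos → v ≠ t.pos → s.lamps v = t.lamps v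
  dominated : ∀ s (f : V → ℝ≥0∞), f s.pos ≤ ∑' w, srwStep G s.pos w * f w →
    ∑' t, Q s t * f t.pos ≤ ∑' w, srwStep G s.pos w * f w
  flip : ∃ g : LampState V → LampState V → ℝ≥0∞,
    (∀ s₀ s (f : V → ℝ≥0∞), 2⁻¹ * g s₀ s * ∑' w, srwStep G s.pos w * f w ≤
      ∑' t, Q s t * (ind (s₀.lamps s.pos ≠ t.lamps s.pos) * f t.pos)) ∧
    ∀ s₀ (N : ℕ), (N : ℝ≥0∞) ≤
      2 * ∑ k ∈ Finset.range N, ∫⁻ Y, g s₀ (Y k) ∂chainLaw Q s₀ +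
        (Δ + 1) * ∫⁻ Y, diffCount s₀ (Y N) ∂chainLaw Q s₀

/-! ### The switch-walk-switch walk. -/

section SwitchWalkSwitch

variable {V : Type*} (G : SimpleGraph V) [G.LocallyFinite]

theorem tsum_swsStep_mul (s : LampState V) (F : LampState V → ℝ≥0∞) :
    ∑' t, swsStep G s t * F t = 2⁻¹ * ∑ a : ZMod 2, ∑' v, srwStep G s.pos v *
      (2⁻¹ * ∑ b : ZMod 2, F ⟨(s.lamps.update s.pos a).update v b, v⟩) := by
  rw [swsStep, tsum_bind_mul, tsum_uniform_zmod_two_mul]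
  simp_rw [tsum_bind_mul, tsum_pure_mul, tsum_uniform_zmod_two_mul]
  congr 1
  rw [sum_zmod_two]
  simp_rw [sum_zmod_two]

theorem exists_of_swsStep_ne_zero {s t : LampState V} (h : swsStep G s t ≠ 0) :
    srwStep G s.pos t.pos ≠ 0 ∧
      ∃ a b : ZMod 2, t.lamps = (s.lamps.update s.pos a).update t.pos b := by
  rw [← PMF.mem_support_iff] at h
  simp only [swsStep, PMF.mem_support_bind_iff, PMF.mem_support_pure_iff] at h
  obtain ⟨a, _, v, hv, b, _, rfl⟩ := h
  exact ⟨(PMF.mem_support_iff _ _).1 hv, a, b, rfl⟩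

/-- The lamp left behind is uniform and independent of the move, so `g = 1` is admissible. The
second switch takes place at a neighbour, hence at another vertex, and does not touch that lamp. -/
theorem isLamplighterStep_sws (hpos : ∀ v, 1 ≤ G.degree v) (Δ : ℕ) :
    IsLamplighterStep G Δ (swsStep G) where
  pos_step s t h := by
    have := (exists_of_swsStep_ne_zero G h).1
    rw [srwStep_apply G hpos] at this
    right
    by_contra hn
    exact this (by rw [ind_false hn, zero_mul])
  lamps_step s t h v h1 h2 := by
    obtain ⟨a, b, e⟩ := (exists_of_swsStep_ne_zero G h).2
    classical
    rw [e, Finsupp.update_apply, if_neg h2, Finsupp.update_apply, if_neg h1]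
  dominated s f _ := by
    rw [tsum_swsStep_mul]
    simp only [half_mul_sum_zmod_two_const, le_refl]
  flip := by
    classical
    refine ⟨fun _ _ => 1, fun s₀ s f => ?_, fun s₀ N => ?_⟩
    · rw [tsum_swsStep_mul, mul_one]
      gcongr
      have key : ∀ a : ZMod 2, ∀ v, srwStep G s.pos v * (2⁻¹ * ∑ b : ZMod 2,
          (ind (s₀.lamps s.pos ≠ ((s.lamps.update s.pos a).update v b) s.pos) * f v)) =
          ind (s₀.lamps s.pos ≠ a) * (srwStep G s.pos v * f v) := by
        intro a v
        by_cases hv : v = s.pos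
        · subst hv
          rw [srwStep_apply G hpos, ind_false (G.loopless.irrefl _)]
          simp
        · have : ∀ b, ((s.lamps.update s.pos a).update v b) s.pos = a := fun b => by
            rw [Finsupp.update_apply, if_neg (Ne.symm hv), Finsupp.update_apply, if_pos rfl]
          simp only [this, half_mul_sum_zmod_two_const]
          ring
      simp_rw [key, ENNReal.tsum_mul_left]
      rw [← Finset.sum_mul]
      refine le_mul_of_one_le_left' ?_
      have h2 : ∀ c : ZMod 2, c ≠ c + 1 := by decide
      calc (1 : ℝ≥0∞) = ind (s₀.lamps s.pos ≠ s₀.lamps s.pos + 1) := (ind_true (h2 _)).symm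
        _ ≤ _ := Finset.single_le_sum (f := fun a => ind (s₀.lamps s.pos ≠ a))
          (fun _ _ => zero_le) (Finset.mem_univ _)
    · simp only [lintegral_const, measure_univ, mul_one, Finset.sum_const, Finset.card_range,
        nsmul_eq_mul]
      refine le_trans ?_ le_self_add
      exact le_mul_of_one_le_left' (by norm_num)

end SwitchWalkSwitch

/-! ### The simple random walk on the wreath product. -/

section SimpleRandomWalk

variable {V : Type*} (G : SimpleGraph V) [G.LocallyFinite]

/-- The state with the lamp at the present position switched. -/
noncomputable def switch (s : LampState V) : LampState V :=
  ⟨s.lamps + Finsupp.single s.pos 1, s.pos⟩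

open Classical in
theorem neighborFinset_wreath (s : LampState V) :
    (wreath G).neighborFinset s =
      insert (switch s) ((G.neighborFinset s.pos).image fun w => ⟨s.lamps, w⟩) := by
  have h2 : ∀ a b : ZMod 2, a ≠ b ↔ b = a + 1 := by decide
  ext t
  simp only [SimpleGraph.mem_neighborFinset, Finset.mem_insert, Finset.mem_image]
  constructor
  · rintro (⟨h, h'⟩ | ⟨h, h', h''⟩)
    · exact Or.inr ⟨t.pos, h', LampState.ext h rfl⟩
    · refine Or.inl (LampState.ext (Finsupp.ext fun v => ?_) h.symm)
      by_cases hv : v = s.pos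
      · subst hv; simpa [switch] using (h2 _ _).1 h'
      · simp [switch, Ne.symm hv, h'' v hv]
  · rintro (rfl | ⟨w, hw, rfl⟩)
    · refine Or.inr ⟨rfl, (h2 _ _).2 (by simp [switch]), fun v hv => by simp [switch, Ne.symm hv]⟩
    · exact Or.inl ⟨rfl, hw⟩

theorem switch_ne (s : LampState V) (w : V) : switch s ≠ ⟨s.lamps, w⟩ := by
  intro h
  have := congrArg (fun t : LampState V => t.lamps s.pos) h
  simp [switch] at this

theorem degree_wreath (s : LampState V) : (wreath G).degree s = G.degree s.pos + 1 := by
  classical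
  rw [← SimpleGraph.card_neighborFinset_eq_degree, neighborFinset_wreath, Finset.card_insert_of_notMem,
    Finset.card_image_of_injective, SimpleGraph.card_neighborFinset_eq_degree]
  · intro v w h; simpa using h
  · simp only [Finset.mem_image, not_exists, not_and]
    exact fun w _ h => switch_ne s w h.symm

theorem tsum_srwStep_wreath_mul (s : LampState V) (F : LampState V → ℝ≥0∞) :
    ∑' t, srwStep (wreath G) s t * F t = (G.degree s.pos + 1 : ℝ≥0∞)⁻¹ *
      (F (switch s) + ∑ w ∈ G.neighborFinset s.pos, F ⟨s.lamps, w⟩) := by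
  classical
  rw [tsum_srwStep_mul (wreath G) (fun s => by rw [degree_wreath]; omega), degree_wreath,
    neighborFinset_wreath, Finset.sum_insert, Finset.sum_image]
  · push_cast; rfl
  · intro v _ w _ h; simpa using h
  · simp only [Finset.mem_image, not_exists, not_and]
    exact fun w _ h => switch_ne s w h.symm

/-- The number of flipped lamps, weighted by the degrees in `{0,1} ≀ G`. -/
noncomputable def flipWeight (s₀ s : LampState V) : ℕ :=
  ∑ v ∈ (s₀.lamps - s.lamps).support, (G.degree v + 1)

theorem flipWeight_switch (s₀ s : LampState V) :
    (s₀.lamps s.pos ≠ s.lamps s.pos →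
      flipWeight G s₀ (switch s) + (G.degree s.pos + 1) = flipWeight G s₀ s) ∧
    (s₀.lamps s.pos = s.lamps s.pos →
      flipWeight G s₀ (switch s) = flipWeight G s₀ s + (G.degree s.pos + 1)) := by
  classical
  have h2 : ∀ a b : ZMod 2, a ≠ b → a = b + 1 := by decide
  have hoff : ∀ v, v ≠ s.pos → (v ∈ (s₀.lamps - (switch s).lamps).support ↔
      v ∈ (s₀.lamps - s.lamps).support) := fun v hv => by
    simp [switch, Ne.symm hv]
  constructor
  · intro h
    have e : (s₀.lamps - (switch s).lamps).support = (s₀.lamps - s.lamps).support.erase s.pos := by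
      ext v
      by_cases hv : v = s.pos
      · subst hv; simp [switch, h2 _ _ h]
      · rw [hoff v hv, Finset.mem_erase]; simp [hv]
    rw [flipWeight, flipWeight, e, Finset.sum_erase_add]
    simpa [sub_eq_zero] using h
  · intro h
    have e : (s₀.lamps - (switch s).lamps).support = insert s.pos (s₀.lamps - s.lamps).support := by
      ext v
      by_cases hv : v = s.pos
      · subst hv
        simp [switch, h]
      · rw [hoff v hv, Finset.mem_insert]; simp [hv]
    rw [flipWeight, flipWeight, e, Finset.sum_insert (by simp [h]), add_comm]

/-- A switch has probability `1 / (deg + 1)` and changes the weight by `±(deg + 1)`, so the drift is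
exactly `+1` when the present lamp is unflipped and `-1` when it is flipped. The weights are chosen
for this cancellation. -/
theorem tsum_srwStep_wreath_flipWeight (s₀ s : LampState V) :
    ∑' t, srwStep (wreath G) s t * (flipWeight G s₀ t : ℝ≥0∞) +
      2 * ind (s₀.lamps s.pos ≠ s.lamps s.pos) = flipWeight G s₀ s + 1 := by
  rw [tsum_srwStep_wreath_mul]
  have e : ∀ w, flipWeight G s₀ ⟨s.lamps, w⟩ = flipWeight G s₀ s := fun w => rfl
  simp only [e, Finset.sum_const, SimpleGraph.card_neighborFinset_eq_degree, nsmul_eq_mul]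
  have hd : ((G.degree s.pos : ℝ≥0∞) + 1)⁻¹ * (G.degree s.pos + 1) = 1 :=
    ENNReal.inv_mul_cancel (by simp) (by finiteness)
  by_cases h : s₀.lamps s.pos = s.lamps s.pos
  · rw [ind_false (by simpa using h), (flipWeight_switch G s₀ s).2 h]
    push_cast
    calc _ = ((G.degree s.pos : ℝ≥0∞) + 1)⁻¹ * (G.degree s.pos + 1) *
          (flipWeight G s₀ s + 1) := by ring
      _ = _ := by rw [hd, one_mul]
  · have h' := (flipWeight_switch G s₀ s).1 h
    rw [ind_true h]
    have h3 : (flipWeight G s₀ s : ℝ≥0∞) =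
        flipWeight G s₀ (switch s) + (G.degree s.pos + 1) := by
      rw [← h']; push_cast; ring
    rw [h3]
    calc _ = ((G.degree s.pos : ℝ≥0∞) + 1)⁻¹ * (G.degree s.pos + 1) *
          (flipWeight G s₀ (switch s) + G.degree s.pos) + 2 := by ring
      _ = _ := by rw [hd, one_mul]; ring

theorem flipWeight_le {Δ : ℕ} (hΔ : ∀ v, G.degree v ≤ Δ) (s₀ s : LampState V) :
    flipWeight G s₀ s ≤ (Δ + 1) * diffCount s₀ s := by
  rw [flipWeight, diffCount, mul_comm, ← smul_eq_mul]
  exact Finset.sum_le_card_nsmul _ _ _ fun v _ => by have := hΔ v; omega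

variable [Countable V]

/-- Summing the drifts: apart from the final weight, the present lamp is flipped half of the time on
average. -/
theorem lintegral_flipWeight (s₀ : LampState V) (N : ℕ) :
    ∫⁻ Y, flipWeight G s₀ (Y N) ∂chainLaw (srwStep (wreath G)) s₀ +
      2 * ∑ k ∈ Finset.range N, ∫⁻ Y, ind (s₀.lamps (Y k).pos ≠ (Y k).lamps (Y k).pos)
        ∂chainLaw (srwStep (wreath G)) s₀ = N := by
  induction N with
  | zero =>
    rw [lintegral_chainLaw_coord _ _ fun s => (flipWeight G s₀ s : ℝ≥0∞)]
    simp [flipWeight]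
  | succ N ih =>
    have hm : ∀ f : LampState V → ℝ≥0∞, Measurable fun Y : ℕ → LampState V => f (Y N) := fun f =>
      Measurable.of_discrete.comp (measurable_pi_apply N)
    rw [Finset.sum_range_succ, mul_add, ← add_assoc, add_right_comm,
      lintegral_chainLaw_succ _ _ (n := N) (F := fun Y => (flipWeight G s₀ (Y (N + 1)) : ℝ≥0∞))
        (fun Y Y' h => by simp only [h (N + 1) (by simp)])]
    simp only [Function.update_self]
    rw [← lintegral_const_mul _ (hm fun s => ind (s₀.lamps s.pos ≠ s.lamps s.pos)),
      ← lintegral_add_left (hm fun s =>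
        ∑' t, srwStep (wreath G) s t * (flipWeight G s₀ t : ℝ≥0∞))]
    simp_rw [tsum_srwStep_wreath_flipWeight]
    rw [lintegral_add_right _ measurable_const, lintegral_const, measure_univ, mul_one,
      add_right_comm, ih]
    push_cast; rfl

/-- Here `g` is the indicator that the present lamp is flipped; the walker then moves off without
touching it with probability `deg / (deg + 1) ≥ 1 / 2`. For `dominated`, a step is a mixture of
staying put and a step in `G`, and by assumption staying put gives no more. -/
theorem isLamplighterStep_srw (hpos : ∀ v, 1 ≤ G.degree v) {Δ : ℕ} (hΔ : ∀ v, G.degree v ≤ Δ) :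
    IsLamplighterStep G Δ (srwStep (wreath G)) where
  pos_step s t h := by
    rw [srwStep_apply (wreath G) (fun s => by rw [degree_wreath]; omega)] at h
    have hadj : (wreath G).Adj s t := by
      by_contra hn; exact h (by rw [ind_false hn, zero_mul])
    rcases hadj with ⟨_, h'⟩ | ⟨h', _⟩
    · exact Or.inr h'
    · exact Or.inl h'
  lamps_step s t h v h1 h2 := by
    rw [srwStep_apply (wreath G) (fun s => by rw [degree_wreath]; omega)] at h
    have hadj : (wreath G).Adj s t := by
      by_contra hn; exact h (by rw [ind_false hn, zero_mul])
    rcases hadj with ⟨h', _⟩ | ⟨_, _, h'⟩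
    · rw [h']
    · exact h' v h1
  dominated s f hf := by
    rw [tsum_srwStep_mul G hpos] at hf ⊢
    rw [tsum_srwStep_wreath_mul]
    have hd0 : (G.degree s.pos : ℝ≥0∞) ≠ 0 := by
      have := hpos s.pos
      simp only [ne_eq, Nat.cast_eq_zero]; omega
    set T := ∑ w ∈ G.neighborFinset s.pos, f w with hT
    have h1 : (G.degree s.pos : ℝ≥0∞) * ((G.degree s.pos : ℝ≥0∞)⁻¹ * T) = T := by
      rw [← mul_assoc, ENNReal.mul_inv_cancel hd0 (by simp), one_mul]
    calc _ ≤ ((G.degree s.pos : ℝ≥0∞) + 1)⁻¹ * ((G.degree s.pos : ℝ≥0∞)⁻¹ * T +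
          (G.degree s.pos : ℝ≥0∞) * ((G.degree s.pos : ℝ≥0∞)⁻¹ * T)) := by
          rw [h1]
          gcongr
          exact hf
      _ = (((G.degree s.pos : ℝ≥0∞) + 1)⁻¹ * (G.degree s.pos + 1)) *
          ((G.degree s.pos : ℝ≥0∞)⁻¹ * T) := by ring
      _ = _ := by
          rw [ENNReal.inv_mul_cancel (by simp) (by finiteness), one_mul]
  flip := by
    refine ⟨fun s₀ s => ind (s₀.lamps s.pos ≠ s.lamps s.pos), fun s₀ s f => ?_, fun s₀ N => ?_⟩
    · rw [tsum_srwStep_mul G hpos, tsum_srwStep_wreath_mul]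
      by_cases h : s₀.lamps s.pos = s.lamps s.pos
      · simp [ind_false (not_not.2 h)]
      · simp only [ind_true h, one_mul, mul_one]
        rw [← mul_assoc]
        refine mul_le_mul' ?_ le_add_self
        rw [← ENNReal.mul_inv (by simp) (by simp)]
        refine ENNReal.inv_le_inv.2 ?_
        have := hpos s.pos
        exact_mod_cast (by omega : G.degree s.pos + 1 ≤ 2 * G.degree s.pos)
    · calc (N : ℝ≥0∞) = _ := (lintegral_flipWeight G s₀ N).symm
        _ ≤ _ := by
          rw [add_comm]
          refine add_le_add le_rfl ?_
          rw [← lintegral_const_mul' _ _ (by finiteness)]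
          refine lintegral_mono fun Y => ?_
          have h : ((flipWeight G s₀ (Y N) : ℕ) : ℝ≥0∞) ≤ (((Δ + 1) * diffCount s₀ (Y N) : ℕ) : ℝ≥0∞) :=
            Nat.cast_le.2 (flipWeight_le G hΔ s₀ (Y N))
          simpa using h

end SimpleRandomWalk

end Lamplighter

namespace Lamplighter

/-! ### Deterministic facts about lamps along a path. -/

section Paths

variable {V : Type*} {G : SimpleGraph V} [G.LocallyFinite] {Δ : ℕ}
  {Q : LampState V → PMF (LampState V)}

theorem dependsOn_visited_posPath (n : ℕ) :
    DependsOn (fun Y : ℕ → LampState V => visited n (posPath Y)) (Set.Iic n) := fun Y Y' h =>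
  dependsOn_visited n fun i hi => by simp only [posPath, h i hi]

theorem lamps_eq_of_not_visited (hQ : IsLamplighterStep G Δ Q) {Y : ℕ → LampState V}
    (hY : ∀ n, Q (Y n) (Y (n + 1)) ≠ 0) {a b : ℕ} (hab : a ≤ b) {v : V}
    (hv : ∀ j, a ≤ j → j ≤ b → (Y j).pos ≠ v) : (Y a).lamps v = (Y b).lamps v := by
  induction b, hab using Nat.le_induction with
  | base => rfl
  | succ b hb ih =>
    rw [ih fun j h1 h2 => hv j h1 (by omega)]
    exact hQ.lamps_step _ _ (hY b) v (hv b hb (by omega)).symm (hv (b + 1) (by omega) le_rfl).symm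

theorem support_sub_subset_visited (hQ : IsLamplighterStep G Δ Q) {Y : ℕ → LampState V}
    (hY : ∀ n, Q (Y n) (Y (n + 1)) ≠ 0) (n : ℕ) :
    ((Y 0).lamps - (Y n).lamps).support ⊆ visited n (posPath Y) := by
  intro v hv
  by_contra h
  rw [mem_visited] at h
  push Not at h
  refine (Finsupp.mem_support_iff.1 hv) ?_
  rw [Finsupp.sub_apply, sub_eq_zero]
  exact lamps_eq_of_not_visited hQ hY (Nat.zero_le n) fun j _ hj => h j hj

theorem diffCount_le_card_visited (hQ : IsLamplighterStep G Δ Q) {Y : ℕ → LampState V}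
    (hY : ∀ n, Q (Y n) (Y (n + 1)) ≠ 0) (n : ℕ) :
    diffCount (Y 0) (Y n) ≤ (visited n (posPath Y)).card :=
  Finset.card_le_card (support_sub_subset_visited hQ hY n)

/-- The lamplighter leaves its position at time `k` with the lamp flipped with respect to time `0`
and does not come back up to time `N`. -/
def LeavesFlipped (N k : ℕ) (Y : ℕ → LampState V) : Prop :=
  (Y 0).lamps (Y k).pos ≠ (Y (k + 1)).lamps (Y k).pos ∧
    (Y k).pos ∉ visited (N - (k + 1)) (posPath fun i => Y (k + 1 + i))

-- Without a return, the lamp keeps its flipped state up to time `N`, and distinct such times have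
-- distinct positions.
open Classical in
theorem card_leavesFlipped_le_diffCount (hQ : IsLamplighterStep G Δ Q) {Y : ℕ → LampState V}
    (hY : ∀ n, Q (Y n) (Y (n + 1)) ≠ 0) (N : ℕ) :
    ((Finset.range N).filter fun k => LeavesFlipped N k Y).card ≤ diffCount (Y 0) (Y N) := by
  have hav : ∀ k, LeavesFlipped N k Y → ∀ j, k + 1 ≤ j → j ≤ N → (Y j).pos ≠ (Y k).pos := by
    intro k hk j h1 h2 e
    refine hk.2 (mem_visited.2 ⟨j - (k + 1), by omega, ?_⟩)
    simp only [posPath]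
    rw [← e]
    congr 2
    omega
  refine Finset.card_le_card_of_injOn (fun k => (Y k).pos) ?_ ?_
  · intro k hk
    simp only [Finset.coe_filter, Finset.mem_range, Set.mem_ofPred_eq] at hk
    simp only [Finset.mem_coe, Finsupp.mem_support_iff, Finsupp.sub_apply, sub_ne_zero]
    rw [← lamps_eq_of_not_visited hQ hY (show k + 1 ≤ N by omega) (hav k hk.2)]
    exact hk.2.1
  · intro k hk l hl e
    simp only [Finset.coe_filter, Finset.mem_range, Set.mem_ofPred_eq] at hk hl
    by_contra hne
    rcases lt_or_gt_of_ne hne with h | h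
    · exact hav k hk.2 l (by omega) (by omega) e.symm
    · exact hav l hl.2 k (by omega) (by omega) e

/-- A lamp changed in exactly one of the two stages is changed overall. Only lamps changed in both
can cancel; they lie in `B ∩ A` and are counted twice on the left. -/
theorem diffCount_add_le (s t u : LampState V) (A : Finset V)
    (hA : (s.lamps - t.lamps).support ⊆ A) (B : Finset V)
    (hB : (t.lamps - u.lamps).support ⊆ B) [DecidableEq V] :
    diffCount s t + diffCount t u ≤ diffCount s u + 2 * (B ∩ A).card := by
  unfold diffCount
  set X := (s.lamps - t.lamps).support
  set Z := (t.lamps - u.lamps).support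
  have h1 : X ∪ Z ⊆ (s.lamps - u.lamps).support ∪ (X ∩ Z) := by
    intro v hv
    by_cases hX : v ∈ X
    · by_cases hZ : v ∈ Z
      · simp [hX, hZ]
      · have hX' := Finsupp.mem_support_iff.1 hX
        have hZ' := Finsupp.notMem_support_iff.1 hZ
        rw [Finsupp.sub_apply] at hX' hZ'
        refine Finset.mem_union_left _ (Finsupp.mem_support_iff.2 ?_)
        rw [Finsupp.sub_apply, ← sub_eq_zero.1 hZ']
        exact hX'
    · have hZ : v ∈ Z := (Finset.mem_union.1 hv).resolve_left hX
      have hZ' := Finsupp.mem_support_iff.1 hZ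
      have hX' := Finsupp.notMem_support_iff.1 hX
      rw [Finsupp.sub_apply] at hX' hZ'
      refine Finset.mem_union_left _ (Finsupp.mem_support_iff.2 ?_)
      rw [Finsupp.sub_apply, sub_eq_zero.1 hX']
      exact hZ'
  have h2 := (Finset.card_le_card h1).trans (Finset.card_union_le _ _)
  have h3 := Finset.card_union_add_card_inter X Z
  have h4 : (X ∩ Z).card ≤ (B ∩ A).card := by
    rw [Finset.inter_comm X Z]
    exact Finset.card_le_card (Finset.inter_subset_inter hB hA)
  omega

/-- A lamp changed by time `m` and restored by time `m + n` must be at a vertex visited in between.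
-/
theorem diffCount_le_add_card_visited (hQ : IsLamplighterStep G Δ Q) {Y : ℕ → LampState V}
    (hY : ∀ n, Q (Y n) (Y (n + 1)) ≠ 0) (m n : ℕ) :
    diffCount (Y 0) (Y m) ≤
      diffCount (Y 0) (Y (m + n)) + (visited n (posPath fun i => Y (m + i))).card := by
  classical
  refine le_trans ?_ (Nat.add_le_add_left
    (diffCount_le_card_visited hQ (Y := fun i => Y (m + i)) (fun i => hY (m + i)) n) _)
  simp only [diffCount, add_zero]
  refine le_trans (Finset.card_le_card fun v hv => ?_) (Finset.card_union_le _ _)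
  by_contra h
  rw [Finset.mem_union, not_or, Finsupp.notMem_support_iff, Finsupp.notMem_support_iff,
    Finsupp.sub_apply, Finsupp.sub_apply, sub_eq_zero, sub_eq_zero] at h
  refine Finsupp.mem_support_iff.1 hv ?_
  rw [Finsupp.sub_apply, sub_eq_zero, h.1, h.2]

end Paths

/-! ### Domination by the simple random walk and the mean number of changed lamps. -/

section Domination

variable {V : Type*} [Countable V] [MeasurableSpace V] [DiscreteMeasurableSpace V]
  {G : SimpleGraph V} [G.LocallyFinite] {Δ : ℕ} {Q : LampState V → PMF (LampState V)}

/-- The range of the lamplighter is stochastically dominated by that of the simple random walk. -/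
theorem lintegral_visited_posPath_le (hQ : IsLamplighterStep G Δ Q) {Φ : Finset V → ℝ≥0∞}
    (hΦ : Monotone Φ) (n : ℕ) (s : LampState V) :
    ∫⁻ Y, Φ (visited n (posPath Y)) ∂chainLaw Q s ≤
      ∫⁻ ω, Φ (visited n ω) ∂chainLaw (srwStep G) s.pos := by
  classical
  induction n generalizing Φ s with
  | zero =>
    simp only [visited_zero]
    rw [lintegral_chainLaw_coord (srwStep G) s.pos fun v => Φ {v}]
    exact (lintegral_chainLaw_coord Q s fun t => Φ {t.pos}).le
  | succ n ih =>
    set f : V → ℝ≥0∞ := fun w =>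
      ∫⁻ ω, Φ (insert s.pos (visited n ω)) ∂chainLaw (srwStep G) w with hf
    have hins : Monotone fun A : Finset V => Φ (insert s.pos A) := fun A B h =>
      hΦ (Finset.insert_subset_insert _ h)
    have h1 : ∫⁻ Y, Φ (visited (n + 1) (posPath Y)) ∂chainLaw Q s =
        ∑' t, Q s t * ∫⁻ Y, Φ (insert s.pos (visited n (posPath Y))) ∂chainLaw Q t := by
      rw [← lintegral_first_step Q s (k := n)
        (K := fun u Y => Φ (insert u.pos (visited n (posPath Y))))
        (fun u Y Y' h => by simp only [dependsOn_visited_posPath n h])]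
      exact lintegral_congr fun Y => congrArg Φ (visited_succ n (posPath Y))
    have h2 : ∫⁻ ω, Φ (visited (n + 1) ω) ∂chainLaw (srwStep G) s.pos =
        ∑' w, srwStep G s.pos w * f w := by
      rw [← lintegral_first_step (srwStep G) s.pos (k := n)
        (K := fun u ω => Φ (insert u (visited n ω)))
        (fun u Y Y' h => by simp only [dependsOn_visited n h])]
      exact lintegral_congr fun ω => congrArg Φ (visited_succ n ω)
    rw [h1, h2]
    refine le_trans (ENNReal.tsum_le_tsum fun t => ?_) (hQ.dominated s f ?_)
    · exact mul_le_mul_right (ih hins t) _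
    -- The condition `f s.pos ≤ ∑ P f` of `dominated`: the right side is the value for a walk from
    -- `s.pos` with one more step, which visits more points, its starting point being among them.
    · rw [← h2, hf]
      refine lintegral_mono_ae ?_
      filter_upwards [chainLaw_zero (srwStep G) s.pos] with ω hω
      refine hΦ (Finset.insert_subset ?_ (visited_mono ω (Nat.le_succ n)))
      exact mem_visited.2 ⟨0, Nat.zero_le _, hω⟩

theorem lintegral_ind_not_add (S : Type*) [MeasurableSpace S] [DiscreteMeasurableSpace S]
    [Countable S] (μ : Measure (ℕ → S)) [IsProbabilityMeasure μ] {n : ℕ} {p : (ℕ → S) → Prop}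
    (hp : DependsOn p (Set.Iic n)) : ∫⁻ ω, ind (¬ p ω) ∂μ + ∫⁻ ω, ind (p ω) ∂μ = 1 := by
  rw [← lintegral_add_right _ (measurable_ind hp)]
  have : ∀ ω, ind (¬ p ω) + ind (p ω) = 1 := fun ω => by
    by_cases h : p ω <;> simp [ind, h]
  simp [this]

/-- The complementary form of domination: a lazier walker is more likely to miss a given vertex.
Subtraction is legitimate because the probabilities are finite. -/
theorem lintegral_not_visited_le (hQ : IsLamplighterStep G Δ Q) (n : ℕ) (v : V)
    (s : LampState V) :
    ∫⁻ ω, ind (v ∉ visited n ω) ∂chainLaw (srwStep G) s.pos ≤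
      ∫⁻ Y, ind (v ∉ visited n (posPath Y)) ∂chainLaw Q s := by
  have h1 := lintegral_ind_not_add V (chainLaw (srwStep G) s.pos) (dependsOn_mem_visited n v)
  have h2 := lintegral_ind_not_add (LampState V) (chainLaw Q s) (n := n)
    (p := fun Y => v ∈ visited n (posPath Y))
    (fun Y Y' h => by simp only [dependsOn_visited_posPath n h])
  have h3 := lintegral_visited_posPath_le hQ (Φ := fun A => ind (v ∈ A))
    (fun A B h => ind_mono fun hv => h hv) n s
  have h4 : ∫⁻ ω, ind (v ∈ visited n ω) ∂chainLaw (srwStep G) s.pos ≠ ∞ := by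
    refine ne_of_lt (lt_of_le_of_lt le_add_self (h1.trans_lt ENNReal.one_lt_top))
  rw [← h2] at h1
  by_contra hlt
  exact absurd h1 (ne_of_gt (ENNReal.add_lt_add_of_lt_of_le
    (ne_top_of_le_ne_top h4 h3) (not_le.1 hlt) h3))

theorem escapeProb_succ (Q : V → PMF V) (n : ℕ) (v : V) :
    escapeProb Q (n + 1) v = ∑' w, Q v w * ∫⁻ ω, ind (v ∉ visited n ω) ∂chainLaw Q w := by
  rw [escapeProb_eq_lintegral, ← lintegral_first_step Q v (k := n)
    (K := fun u ω => ind (u ∉ visited n ω))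
    (fun u ω ω' h => by simp only [dependsOn_visited n h])]
  refine lintegral_congr_ae ?_
  filter_upwards [chainLaw_zero Q v] with ω hω
  congr 1
  rw [hω, mem_visited]
  refine propext ⟨fun h ⟨k, hk, e⟩ => h (1 + k) (by omega) (by omega) e, fun h j h1 h2 e => ?_⟩
  exact h ⟨j - 1, by omega, by rw [← e]; congr 1; omega⟩

/-- After the step from `k` to `k + 1`, the chance of avoiding the vertex left is at least that of
the simple random walk from the new position, by domination. Averaged over a simple random walk
step, the latter is an escape probability, hence at least `ι`; the first property in `flip`
contributes `2⁻¹ * g`. -/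
theorem lintegral_leavesFlipped_ge (hQ : IsLamplighterStep G Δ Q)
    {g : LampState V → LampState V → ℝ≥0∞}
    (hg : ∀ s₀ s (f : V → ℝ≥0∞), 2⁻¹ * g s₀ s * ∑' w, srwStep G s.pos w * f w ≤
      ∑' t, Q s t * (ind (s₀.lamps s.pos ≠ t.lamps s.pos) * f t.pos))
    {N k : ℕ} (hk : k < N) {ι : ℝ≥0∞} (hι : ∀ v, ι ≤ escapeProb (srwStep G) N v)
    (s : LampState V) :
    2⁻¹ * ι * ∫⁻ Y, g s (Y k) ∂chainLaw Q s ≤ ∫⁻ Y, ind (LeavesFlipped N k Y) ∂chainLaw Q s := by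
  set M := N - (k + 1) with hM
  set ν : V → V → ℝ≥0∞ := fun v w =>
    ∫⁻ ω, ind (v ∉ visited M ω) ∂chainLaw (srwStep G) w with hν
  have hνι : ∀ v, ι ≤ ∑' w, srwStep G v w * ν v w := fun v => by
    rw [hν, ← escapeProb_succ]
    exact (hι v).trans (escapeProb_anti _ (by omega) v)
  have hmark := lintegral_markov Q s (n := k + 1) (k := M)
    (K := fun Y Y' => ind ((Y 0).lamps (Y k).pos ≠ (Y (k + 1)).lamps (Y k).pos) *
      ind ((Y k).pos ∉ visited M (posPath Y')))
    (fun Y' Y₁ Y₂ h => by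
      simp only [h 0 (by simp), h k (by simp), h (k + 1) (by simp)])
    (fun Y Y₁ Y₂ h => by simp only [dependsOn_visited_posPath M h])
  calc 2⁻¹ * ι * ∫⁻ Y, g s (Y k) ∂chainLaw Q s
      = ∫⁻ Y, 2⁻¹ * g (Y 0) (Y k) * ι ∂chainLaw Q s := by
        have hm : Measurable fun Y : ℕ → LampState V => g s (Y k) :=
          Measurable.of_discrete.comp (measurable_pi_apply k)
        rw [← lintegral_const_mul _ hm]
        refine lintegral_congr_ae ?_
        filter_upwards [chainLaw_zero Q s] with Y hY
        rw [hY]; ring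
    _ ≤ ∫⁻ Y, ∑' t, Q (Y k) t * (ind ((Y 0).lamps (Y k).pos ≠ t.lamps (Y k).pos) *
          ν (Y k).pos t.pos) ∂chainLaw Q s := by
        refine lintegral_mono fun Y => le_trans ?_ (hg (Y 0) (Y k) (ν (Y k).pos))
        gcongr
        exact hνι _
    _ = ∫⁻ Y, ind ((Y 0).lamps (Y k).pos ≠ (Y (k + 1)).lamps (Y k).pos) *
          ν (Y k).pos (Y (k + 1)).pos ∂chainLaw Q s := by
        rw [lintegral_chainLaw_succ Q s (n := k)
          (F := fun Y => ind ((Y 0).lamps (Y k).pos ≠ (Y (k + 1)).lamps (Y k).pos) *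
            ν (Y k).pos (Y (k + 1)).pos)
          (fun Y₁ Y₂ h => by simp only [h 0 (by simp), h k (by simp), h (k + 1) (by simp)])]
        refine lintegral_congr fun Y => tsum_congr fun t => ?_
        rw [Function.update_of_ne (show (0 : ℕ) ≠ k + 1 by omega),
          Function.update_of_ne (show k ≠ k + 1 by omega), Function.update_self]
    _ ≤ ∫⁻ Y, ∫⁻ Y', ind ((Y 0).lamps (Y k).pos ≠ (Y (k + 1)).lamps (Y k).pos) *
          ind ((Y k).pos ∉ visited M (posPath Y')) ∂chainLaw Q (Y (k + 1)) ∂chainLaw Q s := by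
        refine lintegral_mono fun Y => ?_
        rw [lintegral_const_mul' _ _ (ne_top_of_le_ne_top ENNReal.one_ne_top (ind_le_one _))]
        exact mul_le_mul_right (lintegral_not_visited_le hQ M (Y k).pos (Y (k + 1))) _
    _ = _ := by
        rw [← hmark]
        refine lintegral_congr fun Y => ?_
        rw [LeavesFlipped, ind_and]

/-- With `T = ∑ E g` and `E` the mean of `diffCount`, one has `ι T / 2 ≤ E` and `N ≤ 2 T + (Δ + 1)
E`. Eliminating `T` produces the constant 4 of the theorem. -/
theorem mul_le_lintegral_diffCount (hQ : IsLamplighterStep G Δ Q) {N : ℕ} {ι : ℝ≥0∞}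
    (hι : ∀ v, ι ≤ escapeProb (srwStep G) N v) (s : LampState V) :
    ι * N ≤ (4 + ι * (Δ + 1)) * ∫⁻ Y, diffCount (Y 0) (Y N) ∂chainLaw Q s := by
  classical
  obtain ⟨g, hg1, hg2⟩ := hQ.flip
  have hs : ∫⁻ Y, diffCount (Y 0) (Y N) ∂chainLaw Q s =
      ∫⁻ Y, diffCount s (Y N) ∂chainLaw Q s := by
    refine lintegral_congr_ae ?_
    filter_upwards [chainLaw_zero Q s] with Y hY
    rw [hY]
  have hm : ∀ k ∈ Finset.range N, Measurable fun Y : ℕ → LampState V =>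
      ind (LeavesFlipped N k Y) := fun k hk => by
    refine measurable_ind (n := N) fun Y Y' h => ?_
    have hk := Finset.mem_range.1 hk
    simp only [LeavesFlipped]
    rw [h 0 (by simp), h k (by simp [hk.le]), h (k + 1) (by simp; omega)]
    have e : visited (N - (k + 1)) (posPath fun i => Y (k + 1 + i)) =
        visited (N - (k + 1)) (posPath fun i => Y' (k + 1 + i)) :=
      dependsOn_visited_posPath (N - (k + 1)) fun i hi => by
        simp only [Set.mem_Iic] at hi
        exact h _ (by simp only [Set.mem_Iic]; omega)
    rw [e]
  have h1 : 2⁻¹ * ι * ∑ k ∈ Finset.range N, ∫⁻ Y, g s (Y k) ∂chainLaw Q s ≤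
      ∫⁻ Y, diffCount (Y 0) (Y N) ∂chainLaw Q s := by
    rw [Finset.mul_sum]
    calc _ ≤ ∑ k ∈ Finset.range N, ∫⁻ Y, ind (LeavesFlipped N k Y) ∂chainLaw Q s :=
          Finset.sum_le_sum fun k hk =>
            lintegral_leavesFlipped_ge hQ hg1 (Finset.mem_range.1 hk) hι s
      _ = ∫⁻ Y, ∑ k ∈ Finset.range N, ind (LeavesFlipped N k Y) ∂chainLaw Q s :=
          (lintegral_finsetSum _ hm).symm
      _ ≤ _ := by
          refine lintegral_mono_ae ?_
          filter_upwards [ae_step_ne_zero Q s] with Y hY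
          rw [← card_filter_eq_sum_ind]
          exact Nat.cast_le.2 (card_leavesFlipped_le_diffCount hQ hY N)
  have h2 := hg2 s N
  rw [← hs] at h2
  set E := ∫⁻ Y, diffCount (Y 0) (Y N) ∂chainLaw Q s
  set T := ∑ k ∈ Finset.range N, ∫⁻ Y, g s (Y k) ∂chainLaw Q s
  calc ι * N ≤ ι * (2 * T + (Δ + 1) * E) := by gcongr
    _ = 4 * (2⁻¹ * ι * T) + ι * (Δ + 1) * E := by
        have : (4 : ℝ≥0∞) * 2⁻¹ = 2 := by
          rw [show (4 : ℝ≥0∞) = 2 * 2 by norm_num, mul_assoc,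
            ENNReal.mul_inv_cancel (by simp) (by simp), mul_one]
        rw [← mul_assoc, ← mul_assoc, this]; ring
    _ ≤ 4 * E + ι * (Δ + 1) * E := by gcongr
    _ = _ := by ring

end Domination

end Lamplighter

namespace Lamplighter

/-! ### Concentration of the number of changed lamps by blocks. -/

section Blocks

variable {V : Type*} {G : SimpleGraph V} [G.LocallyFinite] {Δ : ℕ}
  {Q : LampState V → PMF (LampState V)}

/-- The number of points visited during the `i`-th block of `N` steps that were visited before. -/
noncomputable def blockOverlap (N i : ℕ) (Y : ℕ → LampState V) : ℕ :=
  visitedIn N (visited (i * N) (posPath Y) : Set V) (posPath fun j => Y (i * N + j))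

/-- Iteration of `diffCount_add_le`, with the whole past taken as the first stage at each block. -/
theorem sum_diffCount_block_le (hQ : IsLamplighterStep G Δ Q) {Y : ℕ → LampState V}
    (hY : ∀ n, Q (Y n) (Y (n + 1)) ≠ 0) (N m : ℕ) :
    ∑ i ∈ Finset.range m, diffCount (Y (i * N)) (Y (i * N + N)) ≤
      diffCount (Y 0) (Y (m * N)) + 2 * ∑ i ∈ Finset.range m, blockOverlap N i Y := by
  classical
  induction m with
  | zero => simp
  | succ m ih =>
    rw [Finset.sum_range_succ, Finset.sum_range_succ]
    have h := diffCount_add_le (Y 0) (Y (m * N)) (Y (m * N + N)) _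
      (support_sub_subset_visited hQ hY (m * N)) _
      (support_sub_subset_visited hQ (Y := fun j => Y (m * N + j)) (fun j => hY (m * N + j)) N)
    have e : blockOverlap N m Y = (visited N (posPath fun j => Y (m * N + j)) ∩
        visited (m * N) (posPath Y)).card := by
      rw [blockOverlap, visitedIn]
      congr 1
      ext v
      simp
    rw [Nat.succ_mul, e]
    omega

theorem exp_neg_le_one_sub_add_sq {u : ℝ} (hu : 0 ≤ u) : Real.exp (-u) ≤ 1 - u + u ^ 2 := by
  rcases le_total u 1 with h | h
  · have := Real.abs_exp_sub_one_sub_id_le (x := -u) (by rwa [abs_neg, abs_of_nonneg hu])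
    have := (abs_le.1 this).2
    nlinarith
  · have : Real.exp (-u) ≤ 1 := Real.exp_le_one_iff.2 (by linarith)
    nlinarith

/-- Exponential lower tail for a sum of nonnegative block functionals with controlled first and
second conditional moments. -/
theorem measure_sum_blocks_le_le {S : Type*} [MeasurableSpace S] [DiscreteMeasurableSpace S]
    [Countable S] (Q : S → PMF S) {N : ℕ} {Z : (ℕ → S) → ℕ} (hZ : DependsOn Z (Set.Iic N))
    {b B : ℝ} (hb0 : 0 ≤ b) (hB0 : 0 ≤ B)
    (hb : ∀ x, ENNReal.ofReal b ≤ ∫⁻ ω, Z ω ∂chainLaw Q x)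
    (hB : ∀ x, ∫⁻ ω, (Z ω : ℝ≥0∞) ^ 2 ∂chainLaw Q x ≤ ENNReal.ofReal B)
    {θ : ℝ} (hθ : 0 ≤ θ) (m : ℕ) (y : ℝ) (x : S) :
    chainLaw Q x {ω | ((∑ i ∈ Finset.range m, Z (fun j => ω (i * N + j)) : ℕ) : ℝ) ≤ m * y} ≤
      ENNReal.ofReal (Real.exp (m * (θ * y - θ * b + θ ^ 2 * B))) := by
  set F : (ℕ → S) → ℝ≥0∞ := fun ω => ENNReal.ofReal (Real.exp (-(θ * Z ω))) with hF
  have hFdep : DependsOn F (Set.Iic N) := fun ω ω' h => by simp only [hF, hZ h]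
  have hZm : Measurable fun ω => (Z ω : ℝ≥0∞) :=
    measurable_of_dependsOn (n := N) fun ω ω' h => by simp only [hZ h]
  have hcF : ∀ x, ∫⁻ ω, F ω ∂chainLaw Q x ≤
      ENNReal.ofReal (Real.exp (-(θ * b) + θ ^ 2 * B)) := by
    intro x
    -- The inequality `exp (-u) ≤ 1 - u + u²` is integrated with `u` moved to the left, as all terms
    -- must be nonnegative.
    have h1 : ∫⁻ ω, F ω ∂chainLaw Q x + ENNReal.ofReal θ * ∫⁻ ω, Z ω ∂chainLaw Q x ≤
        1 + ENNReal.ofReal (θ ^ 2) * ∫⁻ ω, (Z ω : ℝ≥0∞) ^ 2 ∂chainLaw Q x := by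
      rw [← lintegral_const_mul _ hZm, ← lintegral_add_left (measurable_of_dependsOn hFdep),
        ← lintegral_const_mul _ (hZm.pow_const 2)]
      have hone : (1 : ℝ≥0∞) = ∫⁻ _, 1 ∂chainLaw Q x := by simp
      rw [hone, ← lintegral_add_left measurable_const]
      refine lintegral_mono fun ω => ?_
      rw [← ENNReal.ofReal_natCast, ← ENNReal.ofReal_mul hθ,
        ← ENNReal.ofReal_pow (Nat.cast_nonneg _), ← ENNReal.ofReal_mul (by positivity),
        ← ENNReal.ofReal_one, ← ENNReal.ofReal_add (Real.exp_pos _).le (by positivity),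
        ← ENNReal.ofReal_add one_pos.le (by positivity)]
      refine ENNReal.ofReal_le_ofReal ?_
      have := exp_neg_le_one_sub_add_sq (u := θ * Z ω) (by positivity)
      nlinarith
    have h2 : ∫⁻ ω, F ω ∂chainLaw Q x + ENNReal.ofReal (θ * b) ≤
        ENNReal.ofReal (1 + θ ^ 2 * B) := by
      rw [ENNReal.ofReal_mul hθ, ENNReal.ofReal_add one_pos.le (by positivity),
        ENNReal.ofReal_one, ENNReal.ofReal_mul (by positivity)]
      calc _ ≤ _ := add_le_add le_rfl (mul_le_mul_right (hb x) _)
        _ ≤ _ := h1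
        _ ≤ _ := add_le_add le_rfl (mul_le_mul_right (hB x) _)
    have h3 : ∫⁻ ω, F ω ∂chainLaw Q x ≤ ENNReal.ofReal (1 + θ ^ 2 * B - θ * b) := by
      rw [ENNReal.ofReal_sub _ (by positivity)]
      exact ENNReal.le_sub_of_add_le_right ENNReal.ofReal_ne_top h2
    refine h3.trans (ENNReal.ofReal_le_ofReal ?_)
    have := Real.add_one_le_exp (-(θ * b) + θ ^ 2 * B)
    linarith
  have hprod := lintegral_prod_blocks_le Q hFdep hcF m x
  set E : (ℕ → S) → Prop := fun ω =>
    ((∑ i ∈ Finset.range m, Z (fun j => ω (i * N + j)) : ℕ) : ℝ) ≤ m * y with hE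
  have hEdep : DependsOn E (Set.Iic (m * N)) := fun ω ω' h => by
    have : ∑ i ∈ Finset.range m, Z (fun j => ω (i * N + j)) =
        ∑ i ∈ Finset.range m, Z (fun j => ω' (i * N + j)) := by
      refine Finset.sum_congr rfl fun i hi => hZ fun j hj => h _ ?_
      simp only [Finset.mem_range, Set.mem_Iic] at *
      nlinarith
    simp only [hE, this]
  have hmk : ENNReal.ofReal (Real.exp (-(θ * (m * y)))) * chainLaw Q x {ω | E ω} ≤
      ENNReal.ofReal (Real.exp (-(θ * b) + θ ^ 2 * B)) ^ m := by
    refine le_trans ?_ hprod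
    rw [← lintegral_ind _ hEdep, ← lintegral_const_mul' _ _ (by simp)]
    refine lintegral_mono fun ω => ?_
    by_cases h : E ω
    · rw [ind_true h, mul_one, ← ENNReal.ofReal_prod_of_nonneg fun _ _ => (Real.exp_pos _).le,
        ← Real.exp_sum]
      refine ENNReal.ofReal_le_ofReal (Real.exp_le_exp.2 ?_)
      rw [Finset.sum_neg_distrib, ← Finset.mul_sum, neg_le_neg_iff]
      refine mul_le_mul_of_nonneg_left ?_ hθ
      rw [← Nat.cast_sum]
      exact h
    · rw [ind_false h, mul_zero]; exact zero_le
  rw [← ENNReal.ofReal_pow (Real.exp_pos _).le, ← Real.exp_nat_mul] at hmk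
  have e : Real.exp (m * (θ * y - θ * b + θ ^ 2 * B)) =
      Real.exp (m * (-(θ * b) + θ ^ 2 * B)) / Real.exp (-(θ * (m * y))) := by
    rw [← Real.exp_sub]; congr 1; ring
  rw [e, ENNReal.ofReal_div_of_pos (Real.exp_pos _),
    ENNReal.le_div_iff_mul_le (by simp [Real.exp_pos]) (by simp), mul_comm]
  exact hmk

theorem dependsOn_blockOverlap_cond (N i : ℕ) (a w : ℝ) :
    DependsOn (fun Y : ℕ → LampState V => ((visited (i * N) (posPath Y)).card : ℝ) ≤ a ∧
      w < blockOverlap N i Y) (Set.Iic (i * N + N)) := fun Y Y' h => by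
  have h1 : visited (i * N) (posPath Y) = visited (i * N) (posPath Y') :=
    dependsOn_visited_posPath (i * N) fun j hj => h j (by simp only [Set.mem_Iic] at *; omega)
  have h2 : visited N (posPath fun j => Y (i * N + j)) =
      visited N (posPath fun j => Y' (i * N + j)) :=
    dependsOn_visited_posPath N fun j hj => h _ (by simp only [Set.mem_Iic] at *; omega)
  have h3 : blockOverlap N i Y = blockOverlap N i Y' := by
    rw [blockOverlap, blockOverlap, h1]
    simp only [visitedIn, h2]
  simp only [h1, h3]

variable [Countable V] [MeasurableSpace V] [DiscreteMeasurableSpace V]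

/-- Conditionally on the past, the set visited before is a fixed `A` with at most `a` points.
Domination reduces its overlap with the new block to the simple random walk, whose second moment is
at most `2 * H ^ 2`; then Chebyshev's inequality. -/
theorem measure_blockOverlap_gt_le (hQ : IsLamplighterStep G Δ Q) {N : ℕ} {a H w : ℝ}
    (hw : 0 < w)
    (hH : ∀ A : Finset V, (A.card : ℝ) ≤ a → ∀ x,
      ∫⁻ ω, visitedIn N (A : Set V) ω ∂chainLaw (srwStep G) x ≤ ENNReal.ofReal H)
    (i : ℕ) (s : LampState V) :
    chainLaw Q s {Y | ((visited (i * N) (posPath Y)).card : ℝ) ≤ a ∧ w < blockOverlap N i Y} ≤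
      ENNReal.ofReal (2 * H ^ 2 / w ^ 2) := by
  classical
  have hmono : ∀ A : Finset V, Monotone fun B : Finset V =>
      (((B.filter (· ∈ (A : Set V))).card : ℕ) : ℝ≥0∞) ^ 2 := fun A B B' h => by
    simp only
    gcongr
  have hfix : ∀ A : Finset V, (A.card : ℝ) ≤ a → ∀ t : LampState V,
      ENNReal.ofReal (w ^ 2) * ∫⁻ Y, ind (w < visitedIn N (A : Set V) (posPath Y)) ∂chainLaw Q t ≤
        ENNReal.ofReal (2 * H ^ 2) := by
    intro A hA t
    rw [← lintegral_const_mul' _ _ (by simp)]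
    calc _ ≤ ∫⁻ Y, (visitedIn N (A : Set V) (posPath Y) : ℝ≥0∞) ^ 2 ∂chainLaw Q t := by
          refine lintegral_mono fun Y => ?_
          by_cases h : w < visitedIn N (A : Set V) (posPath Y)
          · rw [ind_true h, mul_one, ← ENNReal.ofReal_natCast, ← ENNReal.ofReal_pow (by positivity)]
            exact ENNReal.ofReal_le_ofReal (by gcongr)
          · rw [ind_false h, mul_zero]; exact zero_le
      _ ≤ ∫⁻ ω, (visitedIn N (A : Set V) ω : ℝ≥0∞) ^ 2 ∂chainLaw (srwStep G) t.pos := by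
          have := lintegral_visited_posPath_le hQ (hmono A) N t
          simp only [visitedIn]
          convert this
      _ ≤ 2 * ENNReal.ofReal H ^ 2 := lintegral_visitedIn_sq_le (srwStep G) N _ (hH A hA) _
      _ ≤ _ := by
          rw [ENNReal.ofReal_mul (by norm_num), ENNReal.ofReal_ofNat]
          gcongr
          rcases le_total 0 H with h | h
          · rw [ENNReal.ofReal_pow h]
          · rw [ENNReal.ofReal_of_nonpos h]; simp
  rw [← lintegral_ind _ (dependsOn_blockOverlap_cond N i a w),
    ENNReal.ofReal_div_of_pos (by positivity),
    ENNReal.le_div_iff_mul_le (by left; simpa using hw.ne') (by simp), mul_comm]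
  have hmark := lintegral_markov Q s (n := i * N) (k := N)
    (K := fun Y Y' => ind (((visited (i * N) (posPath Y)).card : ℝ) ≤ a) *
      ind (w < visitedIn N (visited (i * N) (posPath Y) : Set V) (posPath Y')))
    (fun Y' Y₁ Y₂ h => by
      have e : visited (i * N) (posPath Y₁) = visited (i * N) (posPath Y₂) :=
        dependsOn_visited_posPath (i * N) h
      simp only [e])
    (fun Y Y₁ Y₂ h => by
      have e : visited N (posPath Y₁) = visited N (posPath Y₂) := dependsOn_visited_posPath N h
      simp only [visitedIn, e])
  simp_rw [ind_and]
  simp only [blockOverlap]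
  rw [hmark, ← lintegral_const_mul' _ _ (by simp)]
  calc _ ≤ ∫⁻ _, ENNReal.ofReal (2 * H ^ 2) ∂chainLaw Q s := by
        refine lintegral_mono fun Y => ?_
        rw [lintegral_const_mul' _ _ (ne_top_of_le_ne_top ENNReal.one_ne_top (ind_le_one _))]
        by_cases h : ((visited (i * N) (posPath Y)).card : ℝ) ≤ a
        · rw [ind_true h, one_mul]
          exact hfix _ h _
        · rw [ind_false h, zero_mul, mul_zero]; exact zero_le
    _ = _ := by simp

/-- The three terms bound three bad events: the block changes sum to too little, the range exceeds
`a`, or some block overlaps its past in more than `w` points. Otherwise at most `2 * m * w` is lost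
to cancellation. -/
theorem measure_diffCount_blocks_le (hQ : IsLamplighterStep G Δ Q) {N : ℕ} {a b B H w θ : ℝ}
    (hb0 : 0 ≤ b) (hB0 : 0 ≤ B) (hw : 0 < w) (hθ : 0 ≤ θ)
    (hb : ∀ s, ENNReal.ofReal b ≤ ∫⁻ Y, diffCount (Y 0) (Y N) ∂chainLaw Q s)
    (hB : ∀ s, ∫⁻ Y, (diffCount (Y 0) (Y N) : ℝ≥0∞) ^ 2 ∂chainLaw Q s ≤ ENNReal.ofReal B)
    (hH : ∀ A : Finset V, (A.card : ℝ) ≤ a → ∀ x,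
      ∫⁻ ω, visitedIn N (A : Set V) ω ∂chainLaw (srwStep G) x ≤ ENNReal.ofReal H)
    (m : ℕ) (y : ℝ) (s : LampState V) :
    chainLaw Q s {Y | (diffCount (Y 0) (Y (m * N)) : ℝ) ≤ m * y - 2 * m * w} ≤
      ENNReal.ofReal (Real.exp (m * (θ * y - θ * b + θ ^ 2 * B))) +
      chainLaw (srwStep G) s.pos {ω | a ≤ (visited (m * N) ω).card} +
      ENNReal.ofReal (m * (2 * H ^ 2 / w ^ 2)) := by
  set E₁ : Set (ℕ → LampState V) :=
    {Y | ((∑ i ∈ Finset.range m, diffCount (Y (i * N + 0)) (Y (i * N + N)) : ℕ) : ℝ) ≤ m * y}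
  set E₂ : Set (ℕ → LampState V) := {Y | a ≤ (visited (m * N) (posPath Y)).card}
  set E₃ : ℕ → Set (ℕ → LampState V) := fun i =>
    {Y | ((visited (i * N) (posPath Y)).card : ℝ) ≤ a ∧ w < blockOverlap N i Y}
  set E₀ : Set (ℕ → LampState V) := {Y | ¬ ∀ n, Q (Y n) (Y (n + 1)) ≠ 0}
  have hsub : {Y : ℕ → LampState V | (diffCount (Y 0) (Y (m * N)) : ℝ) ≤ m * y - 2 * m * w} ⊆
      (E₀ ∪ E₁ ∪ E₂) ∪ ⋃ i ∈ Finset.range m, E₃ i := by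
    intro Y hY
    simp only [Set.mem_ofPred_eq] at hY
    by_contra hcon
    simp only [Set.mem_union, not_or, Set.mem_iUnion, not_exists, E₀, E₁, E₂, E₃,
      Set.mem_ofPred_eq, not_not, not_le, not_and, not_lt, Finset.mem_range, add_zero] at hcon
    obtain ⟨⟨⟨h0, h1⟩, h2⟩, h3⟩ := hcon
    have h4 := sum_diffCount_block_le hQ h0 N m
    have h5 : ((∑ i ∈ Finset.range m, blockOverlap N i Y : ℕ) : ℝ) ≤ m * w := by
      push_cast
      calc _ ≤ ∑ i ∈ Finset.range m, w := by
            refine Finset.sum_le_sum fun i hi => h3 i (Finset.mem_range.1 hi) ?_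
            refine le_trans ?_ h2.le
            have him : i ≤ m := (Finset.mem_range.1 hi).le
            exact_mod_cast Finset.card_le_card (visited_mono _ (Nat.mul_le_mul_right N him))
        _ = _ := by simp
    have h6 : ((∑ i ∈ Finset.range m, diffCount (Y (i * N)) (Y (i * N + N)) : ℕ) : ℝ) ≤
        diffCount (Y 0) (Y (m * N)) + 2 * (∑ i ∈ Finset.range m, blockOverlap N i Y : ℕ) := by
      exact_mod_cast h4
    linarith
  have m0 : chainLaw Q s E₀ = 0 := ae_step_ne_zero Q s
  have m1 : chainLaw Q s E₁ ≤ _ := measure_sum_blocks_le_le Q (N := N)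
    (Z := fun Y => diffCount (Y 0) (Y N))
    (fun Y Y' h => by simp only [h 0 (by simp), h N (by simp)]) hb0 hB0 hb hB hθ m y s
  have m2 : chainLaw Q s E₂ ≤ chainLaw (srwStep G) s.pos {ω | a ≤ (visited (m * N) ω).card} := by
    have := lintegral_visited_posPath_le hQ (Φ := fun A => ind (a ≤ A.card))
      (fun A B h => ind_mono fun hv => hv.trans (by exact_mod_cast Finset.card_le_card h)) (m * N) s
    rwa [lintegral_ind _ (n := m * N) (fun Y Y' h => by
        simp only [dependsOn_visited_posPath (m * N) h]),
      lintegral_ind _ (n := m * N) (fun Y Y' h => by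
        simp only [dependsOn_visited (m * N) h])] at this
  have m3 : chainLaw Q s (⋃ i ∈ Finset.range m, E₃ i) ≤
      ENNReal.ofReal (m * (2 * H ^ 2 / w ^ 2)) := by
    refine (measure_biUnion_finset_le _ _).trans ?_
    calc _ ≤ ∑ i ∈ Finset.range m, ENNReal.ofReal (2 * H ^ 2 / w ^ 2) :=
          Finset.sum_le_sum fun i _ => measure_blockOverlap_gt_le hQ hw hH i s
      _ = _ := by
          rw [Finset.sum_const, Finset.card_range, nsmul_eq_mul,
            ENNReal.ofReal_mul (Nat.cast_nonneg m), ENNReal.ofReal_natCast]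
  calc _ ≤ _ := measure_mono hsub
    _ ≤ chainLaw Q s (E₀ ∪ E₁ ∪ E₂) + _ := measure_union_le _ _
    _ ≤ (chainLaw Q s E₀ + chainLaw Q s E₁ + chainLaw Q s E₂) + _ := by
        gcongr
        exact (measure_union_le _ _).trans (by gcongr; exact measure_union_le _ _)
    _ ≤ _ := by
        rw [m0, zero_add]
        gcongr

end Blocks

end Lamplighter

namespace Lamplighter

/-! ### Numerical estimates in terms of `l = log n`. -/

section Numerics

/-- The target error `l ^ (-5/4)` is summable once `l` grows linearly, as it does along geometric
times. Each of the three error terms receives one third of it. -/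
theorem eventually_exp_neg_rpow_le {κ : ℝ} (hκ : 0 < κ) :
    ∀ᶠ l : ℝ in atTop, Real.exp (-(κ * (l ^ (1 / 6 : ℝ) - 1))) ≤ 1 / 3 * l ^ (-(5 / 4) : ℝ) := by
  have h1 := (tendsto_rpow_mul_exp_neg_mul_atTop_nhds_zero (15 / 2) κ hκ).comp
    (tendsto_rpow_atTop (show (0 : ℝ) < 1 / 6 by norm_num))
  have h2 := h1.eventually_le_const (show (0 : ℝ) < 1 / 3 * Real.exp (-κ) by positivity)
  filter_upwards [h2, eventually_gt_atTop 0] with l hl hl0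
  simp only [Function.comp_apply] at hl
  rw [← Real.rpow_mul hl0.le] at hl
  have e : Real.exp (-(κ * (l ^ (1 / 6 : ℝ) - 1))) =
      Real.exp (-κ * l ^ (1 / 6 : ℝ)) * Real.exp κ := by rw [← Real.exp_add]; congr 1; ring
  rw [e, Real.rpow_neg hl0.le, ← div_eq_mul_inv, le_div_iff₀ (by positivity)]
  have h3 : (1 / 6 : ℝ) * (15 / 2) = 5 / 4 := by norm_num
  rw [h3] at hl
  calc _ = (l ^ (5 / 4 : ℝ) * Real.exp (-κ * l ^ (1 / 6 : ℝ))) * Real.exp κ := by ring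
    _ ≤ (1 / 3 * Real.exp (-κ)) * Real.exp κ := by gcongr
    _ = 1 / 3 := by rw [mul_assoc, ← Real.exp_add]; simp

theorem eventually_exp_neg_two_mul_le :
    ∀ᶠ l : ℝ in atTop, Real.exp (-(2 * l)) ≤ 1 / 3 * l ^ (-(5 / 4) : ℝ) := by
  have h1 := tendsto_rpow_mul_exp_neg_mul_atTop_nhds_zero (5 / 4) 2 two_pos
  filter_upwards [h1.eventually_le_const (show (0 : ℝ) < 1 / 3 by norm_num),
    eventually_gt_atTop 0] with l hl hl0
  rw [Real.rpow_neg hl0.le, ← div_eq_mul_inv, le_div_iff₀ (by positivity), mul_comm, ← neg_mul]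
  exact hl

theorem eventually_mul_log_sq_le {D : ℝ} (hD : 0 < D) (E : ℝ) :
    ∀ᶠ l : ℝ in atTop, D * (3 + E * Real.log (2 * l)) ^ 2 ≤ 1 / 3 * l ^ (1 / 4 : ℝ) := by
  have h8 : (0 : ℝ) < 1 / 8 := by norm_num
  have h1 : (fun l : ℝ => (3 + E * Real.log 2) + E * Real.log l) =o[atTop]
      fun l : ℝ => l ^ (1 / 8 : ℝ) := by
    refine Asymptotics.IsLittleO.add ?_ ((isLittleO_log_rpow_atTop h8).const_mul_left E)
    exact Asymptotics.isLittleO_const_left.2 (Or.inr (tendsto_norm_atTop_atTop.comp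
        (tendsto_rpow_atTop h8)))
  filter_upwards [h1.def (show 0 < Real.sqrt (1 / (3 * D)) by positivity),
    eventually_ge_atTop 1] with l hl hl1
  have hl0 : 0 < l := by linarith
  have e : (3 + E * Real.log 2) + E * Real.log l = 3 + E * Real.log (2 * l) := by
    rw [Real.log_mul (by norm_num) hl0.ne']; ring
  rw [e, Real.norm_eq_abs, Real.norm_eq_abs, abs_of_nonneg (by positivity : 0 ≤ l ^ (1 / 8 : ℝ))]
    at hl
  calc D * (3 + E * Real.log (2 * l)) ^ 2 = D * |3 + E * Real.log (2 * l)| ^ 2 := by rw [sq_abs]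
    _ ≤ D * (Real.sqrt (1 / (3 * D)) * l ^ (1 / 8 : ℝ)) ^ 2 := by gcongr
    _ = D * (1 / (3 * D)) * (l ^ (1 / 8 : ℝ)) ^ 2 := by
        rw [mul_pow, Real.sq_sqrt (by positivity)]; ring
    _ = 1 / 3 * l ^ (1 / 4 : ℝ) := by
        rw [← Real.rpow_natCast, ← Real.rpow_mul hl0.le]
        norm_num
        field_simp
        simp

/-- The block number and block length used for the lower tail at time `n`. -/
theorem eventually_block_sizes :
    ∀ᶠ n : ℕ in atTop, ∃ m N : ℕ, 1 ≤ m ∧ (m : ℝ) ≤ Real.log n ^ (1 / 6 : ℝ) ∧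
      Real.log n ^ (1 / 6 : ℝ) - 1 ≤ m ∧ (m : ℝ) ≤ Real.log n / 2 ∧
      (n : ℝ) / (2 * m) ≤ N ∧ (N : ℝ) ≤ n / m ∧ n < m * N + m ∧ m * N ≤ n ∧
      Real.log n / 2 ≤ Real.log N ∧ Real.log N ≤ Real.log n ∧ (n : ℝ) ^ (1 / 2 : ℝ) ≤ N := by
  have hlog : Tendsto (fun N : ℕ => Real.log (N : ℝ)) atTop atTop :=
    Real.tendsto_log_atTop.comp tendsto_natCast_atTop_atTop
  filter_upwards [hlog.eventually_ge_atTop 4, eventually_log_pow_le 1 2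
    (show (0 : ℝ) < 1 / 2 by norm_num), eventually_ge_atTop 1] with n hl hn2 hn1
  set l := Real.log (n : ℝ) with hldef
  have hn0 : (0 : ℝ) < n := by exact_mod_cast hn1
  have hl0 : 0 < l := by linarith
  -- The exponent `1 / 6` lets `exp (-κ m)` beat every power of `l`, while the factor `m³` in the
  -- overlap error stays below `l ^ (1 / 2)`.
  set m := ⌊l ^ (1 / 6 : ℝ)⌋₊ with hm
  have hl1 : (1 : ℝ) ≤ l ^ (1 / 6 : ℝ) := Real.one_le_rpow (by linarith) (by norm_num)
  have hm1 : 1 ≤ m := Nat.one_le_floor_iff _ |>.2 hl1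
  have hm0 : (0 : ℝ) < m := by exact_mod_cast hm1
  have hmle : (m : ℝ) ≤ l ^ (1 / 6 : ℝ) := Nat.floor_le (by positivity)
  have hml : (m : ℝ) ≤ l / 2 := by
    refine hmle.trans ?_
    have h1 : l ^ (1 / 6 : ℝ) ≤ l ^ (1 / 2 : ℝ) :=
      Real.rpow_le_rpow_of_exponent_le (by linarith) (by norm_num)
    have h2 : l ^ (1 / 2 : ℝ) * l ^ (1 / 2 : ℝ) = l := by
      rw [← Real.rpow_add hl0]; norm_num
    have h3 : 0 ≤ l ^ (1 / 2 : ℝ) := by positivity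
    nlinarith
  have hsq : (n : ℝ) ^ (1 / 2 : ℝ) * (n : ℝ) ^ (1 / 2 : ℝ) = n := by
    rw [← Real.rpow_add hn0]; norm_num
  have h2m : 2 * (m : ℝ) ≤ (n : ℝ) ^ (1 / 2 : ℝ) := by simp only [pow_one] at hn2; linarith
  have hs1 : (1 : ℝ) ≤ (n : ℝ) ^ (1 / 2 : ℝ) := Real.one_le_rpow (by exact_mod_cast hn1) (by norm_num)
  set N := n / m with hN
  have hNn : (N : ℝ) ≤ n / m := Nat.cast_div_le
  have hmod : n < m * N + m := by
    have := Nat.lt_mul_div_succ n (show 0 < m by omega)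
    rw [mul_add, mul_one] at this
    exact this
  have hmodR : (n : ℝ) < m * N + m := by exact_mod_cast hmod
  have hmn : 2 * (m : ℝ) ≤ n := by nlinarith
  have hNge : (n : ℝ) / (2 * m) ≤ N := by
    rw [div_le_iff₀ (by positivity)]; linarith
  have hNs : (n : ℝ) ^ (1 / 2 : ℝ) ≤ N := by
    refine le_trans ?_ hNge
    rw [le_div_iff₀ (by positivity)]
    nlinarith
  have hN0 : (0 : ℝ) < N := by linarith
  refine ⟨m, N, hm1, hmle, ?_, hml, hNge, hNn, hmod, Nat.mul_div_le n m, ?_, ?_, hNs⟩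
  · have := Nat.lt_floor_add_one (l ^ (1 / 6 : ℝ)); linarith
  · calc l / 2 = Real.log ((n : ℝ) ^ (1 / 2 : ℝ)) := by rw [Real.log_rpow hn0]; ring
      _ ≤ Real.log N := Real.log_le_log (by positivity) hNs
  · refine Real.log_le_log hN0 (hNn.trans ?_)
    exact div_le_self hn0.le (by exact_mod_cast hm1)

/-- Since `n / N ≤ 2 * m`, the left side is at most a constant times `X² m³ / l²`. With `X²` of
order at most `l ^ (1 / 4)` and `m³ ≤ l ^ (1 / 2)`, the exponent is `1/4 + 1/2 - 2 = -5/4`. -/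
theorem overlap_error_le {m n N l lN η c X : ℝ} (hm : 0 < m) (hn : 0 < n) (hl : 0 < l)
    (hη : 0 < η) (hc : 0 < c) (hlN0 : l / 2 ≤ lN)
    (hN : n / (2 * m) ≤ N) (hm6 : m ≤ l ^ (1 / 6 : ℝ))
    (hX2 : 32 / (η ^ 2 * c ^ 2) * X ^ 2 ≤ 1 / 3 * l ^ (1 / 4 : ℝ)) :
    m * (2 * (n / l * X / (c * lN)) ^ 2 / (η * (N / lN)) ^ 2) ≤ 1 / 3 * l ^ (-(5 / 4) : ℝ) := by
  have hlN' : 0 < lN := by linarith [half_pos hl]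
  have hN0 : 0 < N := lt_of_lt_of_le (by positivity) hN
  have e1 : m * (2 * (n / l * X / (c * lN)) ^ 2 / (η * (N / lN)) ^ 2) =
      2 * m * X ^ 2 / (η ^ 2 * c ^ 2 * l ^ 2) * (n / N) ^ 2 := by
    field_simp
  have h1 : n / N ≤ 2 * m := by
    rw [div_le_iff₀ hN0]
    rw [div_le_iff₀ (by positivity)] at hN
    linarith
  have hm3 : m ^ 3 ≤ l ^ (1 / 2 : ℝ) := by
    calc m ^ 3 ≤ (l ^ (1 / 6 : ℝ)) ^ 3 := by gcongr
      _ = l ^ (1 / 2 : ℝ) := by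
          rw [← Real.rpow_natCast, ← Real.rpow_mul hl.le]; norm_num
  calc _ = _ := e1
    _ ≤ 2 * m * X ^ 2 / (η ^ 2 * c ^ 2 * l ^ 2) * (2 * m) ^ 2 := by gcongr
    _ = (8 / (η ^ 2 * c ^ 2) * X ^ 2) * m ^ 3 / l ^ 2 := by field_simp; ring
    _ ≤ (32 / (η ^ 2 * c ^ 2) * X ^ 2) * l ^ (1 / 2 : ℝ) / l ^ 2 := by
        gcongr; norm_num
    _ ≤ (1 / 3 * l ^ (1 / 4 : ℝ)) * l ^ (1 / 2 : ℝ) / l ^ 2 := by gcongr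
    _ = 1 / 3 * l ^ (-(5 / 4) : ℝ) := by
        rw [mul_assoc, ← Real.rpow_add hl, ← Real.rpow_natCast l 2, mul_div_assoc,
          ← Real.rpow_sub hl]
        norm_num

end Numerics

/-! ### Moments of the number of changed lamps. -/

section LowerTail

variable {V : Type*} [Countable V] [MeasurableSpace V] [DiscreteMeasurableSpace V]
  {G : SimpleGraph V} [G.LocallyFinite] {Δ : ℕ} {Q : LampState V → PMF (LampState V)}

/-- In `mul_le_lintegral_diffCount` one takes `ι = R / log N`. The correction `ι (Δ + 1)` tends to 0
and is paid for by the gap between `4 * r` and `R`. -/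
theorem eventually_le_lintegral_diffCount (hQ : IsLamplighterStep G Δ Q) {r : ℝ} (hr0 : 0 < r)
    (hr : ((4 * r : ℝ) : EReal) < rInf G) :
    ∀ᶠ N : ℕ in atTop, ∀ s, ENNReal.ofReal (r * (N / Real.log N)) ≤
      ∫⁻ Y, diffCount (Y 0) (Y N) ∂chainLaw Q s := by
  obtain ⟨R, hR1, hR2⟩ := EReal.lt_iff_exists_real_btwn.1 hr
  have hR1 : 4 * r < R := by exact_mod_cast hR1
  have hR0 : 0 < R := by linarith
  have hlog : Tendsto (fun N : ℕ => Real.log (N : ℝ)) atTop atTop :=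
    Real.tendsto_log_atTop.comp tendsto_natCast_atTop_atTop
  filter_upwards [eventually_le_noReturnProb G hR2, hlog.eventually_gt_atTop 0,
    hlog.eventually_ge_atTop (R * (Δ + 1) * r / (R - 4 * r))] with N hN hl hl2 s
  have hι : ∀ v, ENNReal.ofReal (R / Real.log N) ≤ escapeProb (srwStep G) N v := fun v => by
    rw [← ofReal_noReturnProb]
    refine ENNReal.ofReal_le_ofReal ?_
    rw [div_le_iff₀ hl, mul_comm]
    exact hN v
  have h := mul_le_lintegral_diffCount hQ hι s
  by_cases htop : ∫⁻ Y, diffCount (Y 0) (Y N) ∂chainLaw Q s = ∞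
  · rw [htop]; exact le_top
  rw [← ENNReal.ofReal_toReal htop] at h ⊢
  set e := (∫⁻ Y, diffCount (Y 0) (Y N) ∂chainLaw Q s).toReal with he
  have he0 : 0 ≤ e := ENNReal.toReal_nonneg
  have h' : ENNReal.ofReal (R / Real.log N * N) ≤
      ENNReal.ofReal ((4 + R / Real.log N * (Δ + 1)) * e) := by
    rw [ENNReal.ofReal_mul (by positivity), ENNReal.ofReal_natCast,
      ENNReal.ofReal_mul (by positivity), ENNReal.ofReal_add (by norm_num) (by positivity),
      ENNReal.ofReal_mul (by positivity), ENNReal.ofReal_add (by positivity) (by norm_num),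
      ENNReal.ofReal_natCast, ENNReal.ofReal_ofNat, ENNReal.ofReal_one]
    exact h
  rw [ENNReal.ofReal_le_ofReal_iff (by positivity)] at h'
  refine ENNReal.ofReal_le_ofReal ?_
  have h3 : R / Real.log N * (Δ + 1) * r ≤ R - 4 * r := by
    rw [div_le_iff₀ (by linarith)] at hl2
    rw [div_mul_eq_mul_div, div_mul_eq_mul_div, div_le_iff₀ hl]
    linarith
  have hq : 0 < 4 + R / Real.log N * (Δ + 1) := by positivity
  have h4 : (4 + R / Real.log N * (Δ + 1)) * (r * (N / Real.log N)) ≤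
      (4 + R / Real.log N * (Δ + 1)) * e := by
    calc _ = (4 * r + R / Real.log N * (Δ + 1) * r) * (N / Real.log N) := by ring
      _ ≤ R * (N / Real.log N) := by gcongr; linarith
      _ = R / Real.log N * N := by ring
      _ ≤ _ := h'
  exact le_of_mul_le_mul_left h4 hq

variable [Nonempty V]

theorem visitedIn_univ {S : Type*} (N : ℕ) (ω : ℕ → S) :
    visitedIn N Set.univ ω = (visited N ω).card := by
  simp [visitedIn]

/-- Changed lamps lie in the range, whose second moment is controlled by the square of its uniformly
bounded mean (`lintegral_visitedIn_sq_le` with `A` everything). -/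
theorem exists_lintegral_diffCount_sq_le (hQ : IsLamplighterStep G Δ Q)
    (hG : UniformlyWeaklyRecurrent G) :
    ∃ C : ℝ, 0 < C ∧ ∀ᶠ N : ℕ in atTop, ∀ s,
      ∫⁻ Y, (diffCount (Y 0) (Y N) : ℝ≥0∞) ^ 2 ∂chainLaw Q s ≤
        ENNReal.ofReal (C * (N / Real.log N) ^ 2) := by
  obtain ⟨C, hC0, hC⟩ := exists_rSup_le G hG
  have hC' : rSup G < ((C + 1 : ℝ) : EReal) :=
    hC.trans_lt (by exact_mod_cast lt_add_one C)
  refine ⟨2 * (C + 1) ^ 2, by positivity, ?_⟩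
  filter_upwards [eventually_lintegral_card_visited_le G (by positivity) hC',
    eventually_ge_atTop 1] with N hN hN1 s
  have hl : 0 ≤ Real.log N := Real.log_nonneg (by exact_mod_cast hN1)
  have h1 := lintegral_visitedIn_sq_le (srwStep G) N Set.univ
    (H := ENNReal.ofReal ((C + 1) * (N / Real.log N)))
    (fun x => by simp only [visitedIn_univ]; exact hN x) s.pos
  simp only [visitedIn_univ] at h1
  calc _ ≤ ∫⁻ Y, ((visited N (posPath Y)).card : ℝ≥0∞) ^ 2 ∂chainLaw Q s := by
        refine lintegral_mono_ae ?_
        filter_upwards [ae_step_ne_zero Q s] with Y hY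
        gcongr
        exact diffCount_le_card_visited hQ hY N
    _ ≤ _ := lintegral_visited_posPath_le hQ (Φ := fun A => (A.card : ℝ≥0∞) ^ 2)
        (fun A B h => by simp only; gcongr) N s
    _ ≤ _ := h1
    _ = _ := by
        rw [← ENNReal.ofReal_pow (by positivity), ← ENNReal.ofReal_ofNat,
          ← ENNReal.ofReal_mul (by norm_num)]
        congr 1
        ring

end LowerTail

end Lamplighter

namespace Lamplighter

/-- The margin `4 * η` is spent as follows: one `η` on concentration, two on the overlaps, and the
last on the incomplete final block, including the summand `m`. -/
theorem block_threshold_le {m n N l lN r η : ℝ} (hm : 0 ≤ m) (hr : 0 ≤ r) (hη : 0 < η)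
    (hlN : 0 < lN) (hlNl : lN ≤ l) (hml : 2 * m ≤ l ∧ 1 ≤ l) (hn : n ≤ m * N + m)
    (hmn : 0 ≤ m * N) (hbig : (1 + r + η) / η * l ^ 2 ≤ n) :
    r * (n / l) + m ≤ m * ((r + 4 * η - η) * (N / lN)) - 2 * m * (η * (N / lN)) := by
  obtain ⟨hml, hl1⟩ := hml
  have hl0 : 0 < l := by linarith
  have e : m * ((r + 4 * η - η) * (N / lN)) - 2 * m * (η * (N / lN)) =
      (r + η) * (m * N / lN) := by ring
  rw [e]
  have h2 : (n - m) / l ≤ m * N / lN := by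
    have : n - m ≤ m * N := by linarith
    gcongr
  refine le_trans ?_ (mul_le_mul_of_nonneg_left h2 (by positivity))
  have h3 : (1 + r + η) * l ^ 2 ≤ η * n := by
    rw [div_mul_eq_mul_div, div_le_iff₀ hη] at hbig
    linarith
  have a2 : m ≤ l ^ 2 := by nlinarith
  have a1 : m * l ≤ l ^ 2 := by nlinarith
  have h4 : m * l + (r + η) * m ≤ η * n := by
    refine le_trans ?_ h3
    have := mul_le_mul_of_nonneg_left a2 (show 0 ≤ r + η by positivity)
    linarith
  have e2 : (r + η) * ((n - m) / l) - (r * (n / l) + m) =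
      (η * n - (m * l + (r + η) * m)) / l := by field_simp; ring
  have : 0 ≤ (η * n - (m * l + (r + η) * m)) / l := div_nonneg (by linarith) hl0.le
  linarith

theorem measure_card_visited_ge_mono {V : Type*} [MeasurableSpace V] (μ : Measure (ℕ → V)) {k n : ℕ} (h : k ≤ n) (a : ℝ) :
    μ {ω | a ≤ (visited k ω).card} ≤ μ {ω | a ≤ (visited n ω).card} := by
  refine measure_mono fun ω h' => ?_
  rw [Set.mem_ofPred_eq] at h' ⊢
  exact h'.trans (by exact_mod_cast Finset.card_le_card (visited_mono ω h))

/-! ### Lower tail for the number of changed lamps. -/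

section LowerTail

variable {V : Type*} [Countable V] {G : SimpleGraph V} [G.LocallyFinite] {Δ : ℕ}
  {Q : LampState V → PMF (LampState V)}

/-- Fewer than `m` steps remain after the last block; they visit at most `m` vertices and so undo at
most `m` changes. -/
theorem measure_diffCount_le_of_blocks (hQ : IsLamplighterStep G Δ Q) {m n N : ℕ}
    (hn : n < m * N + m) (hmN : m * N ≤ n) {z y : ℝ} (hy : z + m ≤ y) (s : LampState V) :
    chainLaw Q s {Y | (diffCount (Y 0) (Y n) : ℝ) ≤ z} ≤
      chainLaw Q s {Y | (diffCount (Y 0) (Y (m * N)) : ℝ) ≤ y} := by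
  refine measure_mono_ae ?_
  filter_upwards [ae_step_ne_zero Q s] with Y hY h
  obtain ⟨k, rfl⟩ := Nat.exists_eq_add_of_le hmN
  have h1 := diffCount_le_add_card_visited hQ hY (m * N) k
  have h2 := card_visited_le k (posPath fun i => Y (m * N + i))
  have h3 : diffCount (Y 0) (Y (m * N)) ≤ diffCount (Y 0) (Y (m * N + k)) + m := by omega
  have h3' : (diffCount (Y 0) (Y (m * N)) : ℝ) ≤ diffCount (Y 0) (Y (m * N + k)) + m := by
    exact_mod_cast h3
  exact h3'.trans ((add_le_add h le_rfl).trans hy)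

variable [MeasurableSpace V] [DiscreteMeasurableSpace V]

theorem lintegral_visitedIn_le_of_card_le {K c C : ℝ} (hK : 0 < K) (hc : 0 < c) (hC : 0 < C)
    (hp : ∀ k, 1 ≤ k → ∀ u v, transProb (srwStep G) k u v ≤ ENNReal.ofReal (K / k))
    (hg : ∀ N : ℕ, ∀ v, ENNReal.ofReal (c * Real.log N) ≤ green (srwStep G) N v v)
    {n m N : ℕ} (hm : 1 ≤ m) (hl : 1 ≤ Real.log n) (hml : (m : ℝ) ≤ Real.log n / 2)
    (hN : (n : ℝ) / (2 * m) ≤ N) (hNn : (N : ℝ) ≤ n) (hlN : 0 < Real.log N)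
    (A : Finset V) (hA : (A.card : ℝ) ≤ C * (n / Real.log n)) (x : V) :
    ∫⁻ ω, visitedIn N (A : Set V) ω ∂chainLaw (srwStep G) x ≤
      ENNReal.ofReal
        (n / Real.log n * (3 + K * C * Real.log (2 * Real.log n)) / (c * Real.log N)) := by
  set l := Real.log (n : ℝ) with hldef
  have hl0 : 0 < l := by linarith
  have hm0 : (0 : ℝ) < m := by exact_mod_cast hm
  have hn0 : (0 : ℝ) < n := by
    rcases Nat.eq_zero_or_pos n with h | h
    · simp [hldef, h] at hl0
    · exact_mod_cast h
  have hnl : 1 ≤ n / l := by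
    rw [le_div_iff₀ hl0, one_mul]
    exact (Real.log_le_sub_one_of_pos hn0).trans (by linarith)
  have hnlN : n / l ≤ N := by
    refine le_trans ?_ hN
    gcongr
    linarith
  -- Cutting at the order of `|A|` balances the two parts of `lintegral_visitedIn_mul_log_le`; the
  -- logarithm left over is then at most `log (2 * l)`.
  set M := ⌈(n : ℝ) / l⌉₊ with hM
  have hM1 : (n : ℝ) / l ≤ M := Nat.le_ceil _
  have hM2 : (M : ℝ) < n / l + 1 := Nat.ceil_lt_add_one (by linarith)
  have hMN : M ≤ N := Nat.ceil_le.2 hnlN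
  have hM0 : 1 ≤ M := by
    have : (1 : ℝ) ≤ M := hnl.trans hM1
    exact_mod_cast this
  have h := lintegral_visitedIn_mul_log_le G hK hp hg A hA hM0 (by omega : M ≤ 2 * N) x
  rw [ENNReal.ofReal_div_of_pos (by positivity), ENNReal.le_div_iff_mul_le
    (Or.inl (by simp only [ne_eq, ENNReal.ofReal_eq_zero, not_le]; positivity)) (Or.inl (by simp))]
  refine h.trans (ENNReal.ofReal_le_ofReal ?_)
  have h2 : Real.log ((2 * N : ℕ) / M) ≤ Real.log (2 * l) := by
    have hNp : 0 < N := by omega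
    refine Real.log_le_log (by positivity) ?_
    rw [div_le_iff₀ (by positivity)]
    push_cast
    calc (2 : ℝ) * N ≤ 2 * n := by gcongr
      _ = 2 * l * (n / l) := by field_simp
      _ ≤ 2 * l * M := by gcongr
  calc (M : ℝ) + 1 + K * (C * (n / l)) * Real.log ((2 * N : ℕ) / M)
      ≤ 3 * (n / l) + K * (C * (n / l)) * Real.log (2 * l) := by gcongr; linarith
    _ = _ := by ring

set_option maxHeartbeats 400000 in
/-- Lower tail for the number of lamps changed, uniformly in the starting state. -/
theorem eventually_measure_diffCount_le [Nonempty V] (hQ : IsLamplighterStep G Δ Q)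
    (hpos : ∀ v, 1 ≤ G.degree v) (hΔ : ∀ v, G.degree v ≤ Δ) (hG : UniformlyWeaklyRecurrent G)
    {r : ℝ} (hr0 : 0 < r) (hr : ((4 * r : ℝ) : EReal) < rInf G) :
    ∀ᶠ n : ℕ in atTop, ∀ s,
      chainLaw Q s {Y | (diffCount (Y 0) (Y n) : ℝ) ≤ r * (n / Real.log n)} ≤
        ENNReal.ofReal (Real.log n ^ (-(5 / 4) : ℝ)) := by
  obtain ⟨r₂, hr1, hr2⟩ := EReal.lt_iff_exists_real_btwn.1 hr
  have hr1 : 4 * r < r₂ := by exact_mod_cast hr1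
  obtain ⟨η, hη0, hη⟩ : ∃ η : ℝ, 0 < η ∧ 4 * (r + 4 * η) = r₂ :=
    ⟨(r₂ / 4 - r) / 4, by linarith, by ring⟩
  set r' := r + 4 * η with hr'
  have hr'0 : 0 < r' := by positivity
  obtain ⟨C, hC0, hC⟩ := exists_lintegral_diffCount_sq_le hQ hG
  obtain ⟨C₀, hC₀0, hC₀⟩ := exists_rSup_le G hG
  set C₁ := C₀ + 1 with hC₁
  have hC₁S : rSup G < (C₁ : ℝ) := hC₀.trans_lt (by exact_mod_cast lt_add_one C₀)
  obtain ⟨K, hK0, hK⟩ := exists_transProb_le G hpos hΔ hG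
  obtain ⟨c, hc0, hc⟩ := exists_green_ge G hG
  have hlog : Tendsto (fun N : ℕ => Real.log (N : ℝ)) atTop atTop :=
    Real.tendsto_log_atTop.comp tendsto_natCast_atTop_atTop
  -- The moment bounds are needed at the block length `N`, which is at least `n ^ (1 / 2)` and hence
  -- exceeds `N₀` for large `n`.
  obtain ⟨N₀, hN₀⟩ := eventually_atTop.1
    ((eventually_le_lintegral_diffCount hQ hr'0 (hη ▸ hr2)).and hC)
  have hsq : ∀ᶠ n : ℕ in atTop, (N₀ : ℝ) ≤ (n : ℝ) ^ (1 / 2 : ℝ) :=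
    ((tendsto_rpow_atTop (by norm_num : (0 : ℝ) < 1 / 2)).comp
      tendsto_natCast_atTop_atTop).eventually_ge_atTop _
  have hκ : 0 < η ^ 2 / (4 * C) := by positivity
  filter_upwards [eventually_block_sizes, hsq, hlog.eventually_ge_atTop 4,
    hlog.eventually (eventually_exp_neg_rpow_le hκ), hlog.eventually eventually_exp_neg_two_mul_le,
    hlog.eventually (eventually_mul_log_sq_le
      (show 0 < 32 / (η ^ 2 * c ^ 2) by positivity) (K * C₁)),
    eventually_measure_card_visited_ge_le G hC₁S,
    eventually_log_pow_le 2 ((1 + r + η) / η) one_pos, eventually_ge_atTop 1]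
    with n ⟨m, N, hm1, hm6, hm6', hml, hNge, hNle, hnm, hmn, hlN1, hlN2, hNs⟩ hsq hl4 he1 he2 he3
      hvis hbig hn1 s
  set l := Real.log (n : ℝ) with hldef
  have hl0 : 0 < l := by linarith
  have hm0 : (0 : ℝ) < m := by exact_mod_cast hm1
  have hm1' : (1 : ℝ) ≤ m := by exact_mod_cast hm1
  have hn0 : (0 : ℝ) < n := by exact_mod_cast hn1
  have hlN0 : 0 < Real.log N := by linarith
  have hN0 : (0 : ℝ) < N := lt_of_lt_of_le (by positivity) hNge
  have hNN : N₀ ≤ N := by exact_mod_cast hsq.trans hNs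
  obtain ⟨hb, hB⟩ := hN₀ N hNN
  have hgap : r * (n / l) + m ≤ m * ((r' - η) * (N / Real.log N)) -
      2 * m * (η * (N / Real.log N)) := by
    have h0 : 0 ≤ (1 + r + η) / η := by positivity
    have hb : (1 + r + η) / η * l ^ 2 ≤ n := by
      rw [Real.rpow_one] at hbig
      linarith
    have h1 : (n : ℝ) ≤ m * N + m := by exact_mod_cast hnm.le
    rw [hr']
    exact block_threshold_le hm0.le hr0.le hη0 hlN0 hlN2 ⟨by linarith, by linarith⟩ h1 (by positivity) hb
  -- With `u = N / log N`, this minimises `-θ η u + θ² C u²`, and the minimum is `-η² / (4 C)`,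
  -- independent of `N`.
  set θ := η / (2 * C) * (Real.log N / N) with hθ
  have hmain := measure_diffCount_blocks_le hQ (N := N) (a := C₁ * (n / l))
    (b := r' * (N / Real.log N)) (B := C * (N / Real.log N) ^ 2) (w := η * (N / Real.log N))
    (θ := θ) (H := n / l * (3 + K * C₁ * Real.log (2 * l)) / (c * Real.log N))
    (by positivity) (by positivity) (by positivity) (by positivity) hb hB
    (lintegral_visitedIn_le_of_card_le hK0 hc0 (by positivity) hK hc hm1 (by linarith) hml hNge
      (hNle.trans (div_le_self hn0.le hm1')) hlN0) m ((r' - η) * (N / Real.log N)) s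
  refine (measure_diffCount_le_of_blocks hQ hnm hmn hgap s).trans (hmain.trans ?_)
  have e1 : Real.exp (m * (θ * ((r' - η) * (N / Real.log N)) - θ * (r' * (N / Real.log N)) +
      θ ^ 2 * (C * (N / Real.log N) ^ 2))) ≤ 1 / 3 * l ^ (-(5 / 4) : ℝ) := by
    refine le_trans (Real.exp_le_exp.2 ?_) he1
    have : θ * ((r' - η) * (N / Real.log N)) - θ * (r' * (N / Real.log N)) +
      θ ^ 2 * (C * (N / Real.log N) ^ 2) = -(η ^ 2 / (4 * C)) := by
      rw [hθ]; field_simp; ring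
    rw [this]
    nlinarith [mul_le_mul_of_nonneg_left hm6' hκ.le]
  have e2 : chainLaw (srwStep G) s.pos {ω | C₁ * (n / l) ≤ (visited (m * N) ω).card} ≤
      ENNReal.ofReal (1 / 3 * l ^ (-(5 / 4) : ℝ)) := by
    refine (measure_card_visited_ge_mono _ hmn _).trans
      ((hvis s.pos).trans (ENNReal.ofReal_le_ofReal (le_of_eq_of_le ?_ he2)))
    rw [Real.exp_neg, mul_comm, Real.exp_mul, hldef, Real.exp_log hn0, one_div]
    norm_cast
  have e3 := overlap_error_le hm0 hn0 hl0 hη0 hc0 hlN1 hNge hm6 he3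
  have hq : 0 ≤ 1 / 3 * l ^ (-(5 / 4) : ℝ) := by positivity
  calc _ ≤ ENNReal.ofReal (1 / 3 * l ^ (-(5 / 4) : ℝ)) + ENNReal.ofReal (1 / 3 * l ^ (-(5 / 4) : ℝ))
        + ENNReal.ofReal (1 / 3 * l ^ (-(5 / 4) : ℝ)) := by
        gcongr
    _ = _ := by
        rw [← ENNReal.ofReal_add hq hq, ← ENNReal.ofReal_add (by positivity) hq]
        congr 1; ring

end LowerTail

end Lamplighter

namespace Lamplighter

/-! ### Graph distance, changed lamps and range. -/

section Distance

variable {V : Type*} {G : SimpleGraph V}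

theorem diffCount_triangle (s t u : LampState V) :
    diffCount s u ≤ diffCount s t + diffCount t u := by
  classical
  rw [diffCount, diffCount, diffCount, ← sub_add_sub_cancel s.lamps t.lamps u.lamps]
  exact (Finset.card_le_card Finsupp.support_add).trans (Finset.card_union_le _ _)

theorem diffCount_le_one_of_adj {s t : LampState V} (h : (wreath G).Adj s t) :
    diffCount s t ≤ 1 := by
  rcases h with ⟨h, -⟩ | ⟨-, -, h⟩
  · simp [diffCount, h]
  · refine (Finset.card_le_card (t := {s.pos}) fun x hx => ?_).trans_eq (Finset.card_singleton _)
    rw [Finset.mem_singleton]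
    by_contra hne
    exact (Finsupp.mem_support_iff.1 hx) (by rw [Finsupp.sub_apply, h x hne, sub_self])

theorem diffCount_le_length {s t : LampState V} (p : (wreath G).Walk s t) :
    diffCount s t ≤ p.length := by
  induction p with
  | nil => simp [diffCount]
  | cons h p ih =>
    rw [SimpleGraph.Walk.length_cons]
    have := diffCount_le_one_of_adj h
    have := diffCount_triangle _ _ _ |>.trans (add_le_add this ih)
    omega

theorem diffCount_le_dist {s t : LampState V} (h : (wreath G).Reachable s t) :
    diffCount s t ≤ (wreath G).dist s t := by
  obtain ⟨p, hp⟩ := h.exists_walk_length_eq_dist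
  exact hp ▸ diffCount_le_length p

/-- Setting the lamp at the present position costs one step when it changes the lamp. -/
theorem exists_walk_set_lamp (f g : V →₀ ZMod 2) (u : V) :
    ∃ f' : V →₀ ZMod 2, ∃ q : (wreath G).Walk ⟨f, u⟩ ⟨f', u⟩,
      f' u = g u ∧ (∀ x, x ≠ u → f' x = f x) ∧
        q.length + (f' - g).support.card ≤ (f - g).support.card := by
  classical
  by_cases h : f u = g u
  · exact ⟨f, .nil, h, fun _ _ => rfl, by simp⟩
  have h' : ∀ x, x ≠ u → (f.update u (g u)) x = f x := fun x hx => by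
    simp [Finsupp.update_apply, hx]
  have hadj : (wreath G).Adj ⟨f, u⟩ ⟨f.update u (g u), u⟩ :=
    Or.inr ⟨rfl, by simpa using h, fun x hx => (h' x hx).symm⟩
  refine ⟨f.update u (g u), .cons hadj .nil, by simp, h', ?_⟩
  simp only [SimpleGraph.Walk.length_cons, SimpleGraph.Walk.length_nil, zero_add]
  rw [add_comm]
  refine Finset.card_lt_card ⟨fun x hx => ?_, fun hsub => ?_⟩
  · rw [Finsupp.mem_support_iff, Finsupp.sub_apply] at hx ⊢
    by_cases hxu : x = u
    · subst hxu; simp at hx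
    · rwa [h' x hxu] at hx
  · have : u ∈ (f - g).support := by
      rw [Finsupp.mem_support_iff, Finsupp.sub_apply]; exact sub_ne_zero.2 h
    simpa using hsub this

/-- The walk follows `p` and sets the lamp to its target on arriving at each vertex. Tracking the
number of lamps still wrong shows that each is paid for only once. -/
theorem exists_wreath_walk {u v : V} (p : G.Walk u v) (f g : V →₀ ZMod 2)
    (h : ∀ x, f x ≠ g x → x ∈ p.support) :
    ∃ q : (wreath G).Walk ⟨f, u⟩ ⟨g, v⟩, q.length ≤ p.length + (f - g).support.card := by
  induction p generalizing f with
  | @nil u =>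
    obtain ⟨f', q, h1, h2, h3⟩ := exists_walk_set_lamp (G := G) f g u
    have : f' = g := by
      ext x : 1
      by_cases hx : x = u
      · rw [hx, h1]
      · rw [h2 x hx]
        by_contra hne
        exact hx (by simpa using h x hne)
    subst this
    exact ⟨q, by simpa using h3⟩
  | @cons u w v hadj p ih =>
    obtain ⟨f', q, h1, h2, h3⟩ := exists_walk_set_lamp (G := G) f g u
    obtain ⟨q', hq'⟩ := ih f' fun x hx => by
      have hxu : x ≠ u := fun e => hx (e ▸ h1)
      have := h x (h2 x hxu ▸ hx)
      rw [SimpleGraph.Walk.support_cons, List.mem_cons] at this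
      exact this.resolve_left hxu
    have hadj' : (wreath G).Adj ⟨f', u⟩ ⟨f', w⟩ := Or.inl ⟨rfl, hadj⟩
    refine ⟨q.append (.cons hadj' q'), ?_⟩
    rw [SimpleGraph.Walk.length_append, SimpleGraph.Walk.length_cons, SimpleGraph.Walk.length_cons]
    omega

theorem visited_succ_last [DecidableEq V] (n : ℕ) (ω : ℕ → V) :
    visited (n + 1) ω = insert (ω (n + 1)) (visited n ω) := by
  ext v
  simp only [Finset.mem_insert, mem_visited]
  constructor
  · rintro ⟨k, hk, rfl⟩
    rcases hk.lt_or_eq with h | rfl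
    · exact Or.inr ⟨k, Nat.le_of_lt_succ h, rfl⟩
    · exact Or.inl rfl
  · rintro (rfl | ⟨k, hk, rfl⟩)
    · exact ⟨n + 1, le_rfl, rfl⟩
    · exact ⟨k, by omega, rfl⟩

/-- A closed walk covering the range of a lazy path, with two steps per new point. -/
theorem exists_closed_walk_visited {ω : ℕ → V} (hω : ∀ i, ω (i + 1) = ω i ∨ G.Adj (ω i) (ω (i + 1)))
    (n : ℕ) : ∃ p : G.Walk (ω 0) (ω 0), p.length + 2 ≤ 2 * (visited n ω).card ∧
      ∀ v ∈ visited n ω, v ∈ p.support := by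
  classical
  induction n with
  | zero => exact ⟨.nil, by simp [visited_zero], by simp [visited_zero]⟩
  | succ n ih =>
    obtain ⟨p, hp, hsup⟩ := ih
    have hn : ω n ∈ p.support := hsup _ ((mem_visited).2 ⟨n, le_rfl, rfl⟩)
    by_cases hmem : ω (n + 1) ∈ visited n ω
    · rw [visited_succ_last, Finset.insert_eq_of_mem hmem]
      exact ⟨p, hp, hsup⟩
    have hadj : G.Adj (ω n) (ω (n + 1)) := (hω n).resolve_left fun e =>
      hmem (e ▸ (mem_visited).2 ⟨n, le_rfl, rfl⟩)
    -- A detour from `ω n` to the new vertex and back is inserted into the closed walk, at the cost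
    -- of two steps.
    refine ⟨(p.takeUntil _ hn).append (.cons hadj (.cons hadj.symm (p.dropUntil _ hn))), ?_, ?_⟩
    · have hlen : (p.takeUntil _ hn).length + (p.dropUntil _ hn).length = p.length := by
        rw [← SimpleGraph.Walk.length_append, SimpleGraph.Walk.take_spec]
      rw [visited_succ_last, Finset.card_insert_of_notMem hmem]
      simp only [SimpleGraph.Walk.length_append, SimpleGraph.Walk.length_cons]
      omega
    · intro v hv
      rw [visited_succ_last, Finset.mem_insert] at hv
      rw [SimpleGraph.Walk.mem_support_append_iff, SimpleGraph.Walk.support_cons,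
        SimpleGraph.Walk.support_cons]
      rcases hv with rfl | hv
      · simp
      · have := hsup v hv
        rw [← p.take_spec hn, SimpleGraph.Walk.mem_support_append_iff] at this
        rcases this with h | h
        · exact Or.inl h
        · exact Or.inr (by simp [h])

/-- The constant is `5 = 2 + 2 + 1`: the closed tour of the range, an initial piece of it leading to
the final position, and the switches. -/
theorem exists_wreath_walk_visited {Y : ℕ → LampState V}
    (hpath : ∀ i, (Y (i + 1)).pos = (Y i).pos ∨ G.Adj (Y i).pos (Y (i + 1)).pos) (n : ℕ)
    (hlamps : ((Y 0).lamps - (Y n).lamps).support ⊆ visited n (posPath Y)) :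
    ∃ q : (wreath G).Walk (Y 0) (Y n), q.length ≤ 5 * (visited n (posPath Y)).card := by
  classical
  obtain ⟨p, hp, hsup⟩ := exists_closed_walk_visited (ω := posPath Y) hpath n
  have hn : posPath Y n ∈ p.support := hsup _ ((mem_visited).2 ⟨n, le_rfl, rfl⟩)
  obtain ⟨q, hq⟩ := exists_wreath_walk (p.append (p.takeUntil _ hn)) (Y 0).lamps (Y n).lamps
    fun x hx => by
      rw [SimpleGraph.Walk.mem_support_append_iff]
      refine Or.inl (hsup x (hlamps ?_))
      rw [Finsupp.mem_support_iff, Finsupp.sub_apply]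
      exact sub_ne_zero.2 hx
  refine ⟨q, hq.trans ?_⟩
  have h1 := p.length_takeUntil_le_length hn
  have h2 := Finset.card_le_card hlamps
  rw [SimpleGraph.Walk.length_append]
  omega

end Distance

/-! ### Infinite connected locally finite graphs. -/

section Graph

variable {V : Type*} {G : SimpleGraph V}

theorem countable_of_connected (G : SimpleGraph V) [G.LocallyFinite] (hG : G.Connected) :
    Countable V := by
  obtain ⟨x⟩ := hG.nonempty
  have hB : ∀ n : ℕ, {y | ∃ p : G.Walk y x, p.length = n}.Countable := by
    intro n
    induction n with
    | zero =>
      refine (Set.countable_singleton x).mono ?_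
      rintro y ⟨p, hp⟩
      exact SimpleGraph.Walk.eq_of_length_eq_zero hp
    | succ n ih =>
      refine (ih.biUnion fun z _ => (G.neighborSet z).toFinite.countable).mono ?_
      rintro y ⟨p, hp⟩
      cases p with
      | nil => simp at hp
      | @cons _ z _ h p =>
        exact Set.mem_biUnion (show z ∈ _ from ⟨p, by simpa using hp⟩) h.symm
  have : (Set.univ : Set V) ⊆ ⋃ n : ℕ, {y | ∃ p : G.Walk y x, p.length = n} := fun y _ => by
    obtain ⟨p⟩ := hG.preconnected y x
    exact Set.mem_iUnion.2 ⟨p.length, p, rfl⟩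
  exact Set.countable_univ_iff.1 ((Set.countable_iUnion hB).mono this)

/-- If all degrees were at most 1, the connected graph would be a single edge. This gives `5 ≤ 2 Δ +
1`. -/
theorem exists_two_le_degree [Infinite V] (G : SimpleGraph V) [G.LocallyFinite]
    (hG : G.Connected) : ∃ v, 2 ≤ G.degree v := by
  by_contra! hcon
  obtain ⟨x⟩ := hG.nonempty
  have hpos := hG.preconnected.degree_pos_of_nontrivial x
  obtain ⟨y, hy⟩ := (G.degree_pos_iff_exists_adj x).1 hpos
  have huniq : ∀ a b c, G.Adj a b → G.Adj a c → b = c := fun a b c hb hc =>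
    Finset.card_le_one.1 (Nat.le_of_lt_succ (hcon a)) b (by simpa using hb) c (by simpa using hc)
  have hwalk : ∀ {u v : V}, G.Walk u v → u = x ∨ u = y → v = x ∨ v = y := by
    intro u v p
    induction p with
    | nil => exact id
    | cons h p ih =>
      rintro (rfl | rfl)
      · exact ih (Or.inr (huniq _ _ _ h hy))
      · exact ih (Or.inl (huniq _ _ _ h hy.symm))
  refine Set.infinite_univ.not_finite (α := V) ((Set.toFinite {x, y}).subset fun v _ => ?_)
  obtain ⟨p⟩ := hG.preconnected x v
  exact hwalk p (Or.inl rfl)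

end Graph

end Lamplighter

namespace Lamplighter

section BorelCantelli

theorem ae_eventually_notMem_of_eventually_le {Ω : Type*} [MeasurableSpace Ω] {μ : Measure Ω}
    {E : ℕ → Set Ω} {f : ℕ → ℝ} (hf : Summable f) (h : ∀ᶠ n in atTop, μ (E n) ≤ ENNReal.ofReal (f n)) :
    ∀ᵐ x ∂μ, ∀ᶠ n in atTop, x ∉ E n := by
  obtain ⟨N, hN⟩ := eventually_atTop.1 h
  have hsum : ∑' n, μ {x | N ≤ n ∧ x ∈ E n} ≠ ∞ := by
    refine ne_top_of_le_ne_top hf.tsum_ofReal_ne_top (ENNReal.tsum_le_tsum fun n => ?_)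
    by_cases hn : N ≤ n
    · simpa [hn] using hN n hn
    · simp [hn]
  filter_upwards [ae_eventually_notMem hsum] with x hx
  filter_upwards [hx, eventually_ge_atTop N] with n hn hNn hmem
  exact hn ⟨hNn, hmem⟩

end BorelCantelli

/-! ### Almost sure bounds by Borel-Cantelli. -/

section AlmostSure

variable {V : Type*} [Countable V] [MeasurableSpace V] [DiscreteMeasurableSpace V]
  {G : SimpleGraph V} [G.LocallyFinite] {Δ : ℕ} {Q : LampState V → PMF (LampState V)}

theorem measure_card_visited_posPath_ge_le (hQ : IsLamplighterStep G Δ Q) (n : ℕ) (a : ℝ)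
    (s : LampState V) :
    chainLaw Q s {Y | a ≤ (visited n (posPath Y)).card} ≤
      chainLaw (srwStep G) s.pos {ω | a ≤ (visited n ω).card} := by
  have h := lintegral_visited_posPath_le hQ (Φ := fun A => ind (a ≤ A.card))
    (fun A B hAB => ind_mono fun h => h.trans (by exact_mod_cast Finset.card_le_card hAB)) n s
  have h1 : DependsOn (fun Y : ℕ → LampState V => a ≤ (visited n (posPath Y)).card) (Set.Iic n) :=
    fun Y Y' hYY => by
      have e : visited n (posPath Y) = visited n (posPath Y') := dependsOn_visited_posPath n hYY
      simp only [e]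
  have h2 : DependsOn (fun ω : ℕ → V => a ≤ (visited n ω).card) (Set.Iic n) := fun ω ω' hω => by
    have e : visited n ω = visited n ω' := dependsOn_visited n hω
    simp only [e]
  rw [lintegral_ind _ h1, lintegral_ind _ h2] at h
  exact h

theorem measure_card_visited_shift_ge_le (hQ : IsLamplighterStep G Δ Q) {n : ℕ} {a : ℝ} {p : ℝ≥0∞}
    (h : ∀ x, chainLaw (srwStep G) x {ω | a ≤ (visited n ω).card} ≤ p) (T : ℕ) (s : LampState V) :
    chainLaw Q s {Y | a ≤ (visited n (posPath fun i => Y (T + i))).card} ≤ p := by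
  have h1 : DependsOn (fun Y : ℕ → LampState V => a ≤ (visited n (posPath Y)).card) (Set.Iic n) :=
    fun Y Y' hYY => by
      have e : visited n (posPath Y) = visited n (posPath Y') := dependsOn_visited_posPath n hYY
      simp only [e]
  have h2 : DependsOn (fun Y : ℕ → LampState V =>
      a ≤ (visited n (posPath fun i => Y (T + i))).card) (Set.Iic (T + n)) := fun Y Y' hYY => by
    have e : visited n (posPath fun i => Y (T + i)) = visited n (posPath fun i => Y' (T + i)) :=
      dependsOn_visited_posPath n fun i hi => hYY _ (by simp only [Set.mem_Iic] at *; omega)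
    simp only [e]
  rw [← lintegral_ind _ h2, lintegral_markov Q s (n := T) (k := n)
    (K := fun _ Y => ind (a ≤ (visited n (posPath Y)).card)) (fun _ _ _ _ => rfl)
    (fun _ Y Y' hYY => by simp only [h1 hYY])]
  calc _ ≤ ∫⁻ _, p ∂chainLaw Q s := lintegral_mono fun Y => by
        rw [lintegral_ind _ h1]
        exact (measure_card_visited_posPath_ge_le hQ n a _).trans (h _)
    _ = p := by simp

theorem ae_eventually_card_visited_lt [Nonempty V] (hQ : IsLamplighterStep G Δ Q) {ρ : ℝ}
    (hρ : rSup G < ρ) (s : LampState V) :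
    ∀ᵐ Y ∂chainLaw Q s, ∀ᶠ n : ℕ in atTop,
      ((visited n (posPath Y)).card : ℝ) < ρ * (n / Real.log n) := by
  have h := ae_eventually_notMem_of_eventually_le (μ := chainLaw Q s)
    (E := fun n => {Y | ρ * (n / Real.log n) ≤ (visited n (posPath Y)).card})
    (Real.summable_one_div_nat_pow.2 one_lt_two) (by
      filter_upwards [eventually_measure_card_visited_ge_le G hρ] with n hn
      exact (measure_card_visited_posPath_ge_le hQ n _ s).trans (hn _))
  filter_upwards [h] with Y hY
  filter_upwards [hY] with n hn
  exact not_le.1 hn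

/-- Controls the lamps that can be restored between times `i * 2 ^ j` and `(i + 1) * 2 ^ j`. The
tail bound for `2 ^ j` steps is `4 ^ (-j)`. -/
theorem ae_eventually_dyadic_visited_lt [Nonempty V] (hQ : IsLamplighterStep G Δ Q) {ρ : ℝ}
    (hρ : rSup G < ρ) (s : LampState V) (i : ℕ) :
    ∀ᵐ Y ∂chainLaw Q s, ∀ᶠ j : ℕ in atTop,
      ((visited (2 ^ j) (posPath fun k => Y (i * 2 ^ j + k))).card : ℝ) <
        ρ * ((2 ^ j : ℕ) / Real.log (2 ^ j : ℕ)) := by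
  have hsum : Summable fun j : ℕ => 1 / ((2 ^ j : ℕ) : ℝ) ^ 2 := by
    refine (summable_geometric_of_lt_one (r := 1 / 4) (by norm_num) (by norm_num)).congr fun j => ?_
    push_cast
    rw [← pow_mul, mul_comm, pow_mul, one_div_pow]
    norm_num
  have h2 : Tendsto (fun j : ℕ => 2 ^ j) atTop atTop := tendsto_pow_atTop_atTop_of_one_lt one_lt_two
  have h := ae_eventually_notMem_of_eventually_le (μ := chainLaw Q s)
    (E := fun j => {Y | ρ * ((2 ^ j : ℕ) / Real.log (2 ^ j : ℕ)) ≤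
      (visited (2 ^ j) (posPath fun k => Y (i * 2 ^ j + k))).card}) hsum (by
      filter_upwards [h2.eventually (eventually_measure_card_visited_ge_le G hρ)] with j hj
      exact measure_card_visited_shift_ge_le hQ hj _ s)
  filter_upwards [h] with Y hY
  filter_upwards [hY] with n hn
  exact not_le.1 hn

/-- The lower tail bound `(log n) ^ (-5/4)` is not summable over all `n`, but it is along `n = i * 2
^ j`, where `log n ≥ j log 2`. -/
theorem ae_eventually_dyadic_lt_diffCount [Nonempty V] (hQ : IsLamplighterStep G Δ Q)
    (hpos : ∀ v, 1 ≤ G.degree v) (hΔ : ∀ v, G.degree v ≤ Δ) (hG : UniformlyWeaklyRecurrent G)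
    {r : ℝ} (hr0 : 0 < r) (hr : ((4 * r : ℝ) : EReal) < rInf G) (s : LampState V) {i : ℕ}
    (hi : 1 ≤ i) :
    ∀ᵐ Y ∂chainLaw Q s, ∀ᶠ j : ℕ in atTop,
      r * ((i * 2 ^ j : ℕ) / Real.log (i * 2 ^ j : ℕ)) < diffCount (Y 0) (Y (i * 2 ^ j)) := by
  have hsum : Summable fun j : ℕ => Real.log 2 ^ (-(5 / 4) : ℝ) * (j : ℝ) ^ (-(5 / 4) : ℝ) :=
    (Real.summable_nat_rpow.2 (by norm_num)).mul_left _
  have h2 : Tendsto (fun j : ℕ => i * 2 ^ j) atTop atTop :=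
    (tendsto_pow_atTop_atTop_of_one_lt one_lt_two).const_mul_atTop' hi
  have h := ae_eventually_notMem_of_eventually_le (μ := chainLaw Q s)
    (E := fun j => {Y | (diffCount (Y 0) (Y (i * 2 ^ j)) : ℝ) ≤
      r * ((i * 2 ^ j : ℕ) / Real.log (i * 2 ^ j : ℕ))}) hsum (by
      filter_upwards [h2.eventually (eventually_measure_diffCount_le hQ hpos hΔ hG hr0 hr),
        eventually_ge_atTop 1] with j hj hj1
      refine (hj s).trans (ENNReal.ofReal_le_ofReal ?_)
      have hl2 : 0 < Real.log 2 := Real.log_pos one_lt_two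
      have hj0 : (0 : ℝ) < j := by exact_mod_cast hj1
      rw [← Real.mul_rpow hl2.le hj0.le]
      refine Real.rpow_le_rpow_of_nonpos (by positivity) ?_ (by norm_num)
      rw [mul_comm, ← Real.log_pow]
      refine Real.log_le_log (by positivity) ?_
      exact_mod_cast Nat.le_mul_of_pos_left _ hi)
  filter_upwards [h] with Y hY
  filter_upwards [hY] with n hn
  exact not_le.1 hn

end AlmostSure

/-! ### From geometric times to all times. -/

section Interpolation

/-- As `p ≤ n / q`, replacing `T` by `n` loses a proportion `1 / q` of the main term, which gives `r
/ q`. The vertices visited in the gap give `2 * ρ / q`, the 2 coming from `log n ≤ 2 * log p`. -/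
theorem interpolation_le {r ρ q p n T DT Dn W : ℝ} (hr : 0 ≤ r) (hρ : 0 ≤ ρ) (hq : 1 ≤ q)
    (hp : 1 < p) (hT : 1 < T) (h1 : r * (T / Real.log T) ≤ DT) (h2 : DT ≤ Dn + W)
    (h3 : W ≤ ρ * (p / Real.log p)) (hTn : T ≤ n) (hnT : n ≤ T + p) (hqp : q * p ≤ n)
    (hlog : Real.log n ≤ 2 * Real.log p) :
    (r - (r + 2 * ρ) / q) * (n / Real.log n) ≤ Dn := by
  have hn : 1 < n := hT.trans_le hTn
  have hln : 0 < Real.log n := Real.log_pos hn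
  have hlT : 0 < Real.log T := Real.log_pos hT
  have hlp : 0 < Real.log p := Real.log_pos hp
  have hpn : p ≤ n / q := by rw [le_div_iff₀ (by positivity)]; linarith
  have a1 : (n - n / q) / Real.log n ≤ T / Real.log T := by
    have : Real.log T ≤ Real.log n := Real.log_le_log (by linarith) hTn
    have : n - n / q ≤ T := by linarith
    gcongr
  have a2 : p / Real.log p ≤ n / q / (Real.log n / 2) := by
    have : Real.log n / 2 ≤ Real.log p := by linarith
    gcongr
  have a3 := mul_le_mul_of_nonneg_left a1 hr
  have a4 := mul_le_mul_of_nonneg_left a2 hρ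
  have e : (r - (r + 2 * ρ) / q) * (n / Real.log n) =
      r * ((n - n / q) / Real.log n) - ρ * (n / q / (Real.log n / 2)) := by
    field_simp
    ring
  rw [e]
  linarith

variable {V : Type*} {G : SimpleGraph V} [G.LocallyFinite] {Δ : ℕ}
  {Q : LampState V → PMF (LampState V)}

theorem eventually_le_diffCount_of_dyadic (hQ : IsLamplighterStep G Δ Q) {Y : ℕ → LampState V}
    (hY : ∀ n, Q (Y n) (Y (n + 1)) ≠ 0) {r ρ : ℝ} (hr : 0 ≤ r) (hρ : 0 ≤ ρ) {q : ℕ} (hq : 1 ≤ q)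
    (h1 : ∀ i ∈ Finset.Ico q (2 * q), ∀ᶠ j : ℕ in atTop,
      r * ((i * 2 ^ j : ℕ) / Real.log (i * 2 ^ j : ℕ)) < diffCount (Y 0) (Y (i * 2 ^ j)))
    (h2 : ∀ i ∈ Finset.Ico q (2 * q), ∀ᶠ j : ℕ in atTop,
      ((visited (2 ^ j) (posPath fun k => Y (i * 2 ^ j + k))).card : ℝ) <
        ρ * ((2 ^ j : ℕ) / Real.log (2 ^ j : ℕ))) :
    ∀ᶠ n : ℕ in atTop, (r - (r + 2 * ρ) / q) * (n / Real.log n) ≤ diffCount (Y 0) (Y n) := by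
  have h2pow : Tendsto (fun j : ℕ => 2 ^ j) atTop atTop := tendsto_pow_atTop_atTop_of_one_lt one_lt_two
  obtain ⟨J, hJ⟩ := eventually_atTop.1 (((Filter.eventually_all_finset _).2 h1).and
    (((Filter.eventually_all_finset _).2 h2).and
      ((h2pow.eventually_ge_atTop (2 * q)).and (eventually_ge_atTop 1))))
  filter_upwards [eventually_ge_atTop (q * 2 ^ J)] with n hn
  have hnq : 2 ^ J ≤ n / q := (Nat.le_div_iff_mul_le hq).2 (by linarith)
  have hnq0 : n / q ≠ 0 := (lt_of_lt_of_le (by positivity) hnq).ne'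
  -- With this `j`, `n` lies in `[i 2^j, (i + 1) 2^j)` for some `i` in `[q, 2q)`: only finitely many
  -- `i` matter, and the gap is at most a fraction `1 / q` of `n`.
  set j := Nat.log 2 (n / q) with hj
  have hJj : J ≤ j := Nat.le_log_of_pow_le one_lt_two hnq
  obtain ⟨hA, hB, hqj, hj1⟩ := hJ j hJj
  have hle : q * 2 ^ j ≤ n := by
    have := Nat.pow_log_le_self 2 hnq0
    rw [Nat.le_div_iff_mul_le hq] at this
    linarith
  have hlt : n < 2 * q * 2 ^ j := by
    have := Nat.lt_pow_succ_log_self one_lt_two (n / q)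
    rw [Nat.div_lt_iff_lt_mul hq, pow_succ] at this
    rw [← hj] at this
    linarith
  have hp2 : 2 ≤ 2 ^ j := by
    calc 2 = 2 ^ 1 := rfl
      _ ≤ 2 ^ j := Nat.pow_le_pow_right two_pos hj1
  generalize hpdef : 2 ^ j = p at *
  set i := n / p with hi
  have hp0 : 0 < p := by omega
  have hi1 : q ≤ i := (Nat.le_div_iff_mul_le hp0).2 hle
  have hi2 : i < 2 * q := (Nat.div_lt_iff_lt_mul hp0).2 hlt
  have hmem : i ∈ Finset.Ico q (2 * q) := Finset.mem_Ico.2 ⟨hi1, hi2⟩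
  have hdecomp : i * p + n % p = n := by rw [mul_comm]; exact Nat.div_add_mod n p
  have hmod : n % p < p := Nat.mod_lt _ hp0
  have hAi := hA i hmem
  have hBi := hB i hmem
  have hsplit := diffCount_le_add_card_visited hQ hY (i * p) (n % p)
  rw [hdecomp] at hsplit
  have hcard := Finset.card_le_card (visited_mono (posPath fun k => Y (i * p + k)) hmod.le)
  have hT : i * p ≤ n := by omega
  have hT2 : p ≤ i * p := Nat.le_mul_of_pos_left _ (by omega)
  refine interpolation_le (p := (p : ℝ)) (T := ((i * p : ℕ) : ℝ)) (DT := diffCount (Y 0) (Y (i * p)))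
    (W := (visited p (posPath fun k => Y (i * p + k))).card) hr hρ (by exact_mod_cast hq)
    (by exact_mod_cast hp2) (by exact_mod_cast hp2.trans hT2) hAi.le ?_ hBi.le
    (by exact_mod_cast hT) ?_ (by exact_mod_cast hle) ?_
  · exact_mod_cast hsplit.trans (by omega)
  · exact_mod_cast (by omega : n ≤ i * p + p)
  · have hn0 : 0 < n := by omega
    rw [← Nat.cast_ofNat, ← Real.log_pow]
    refine Real.log_le_log (by exact_mod_cast hn0) ?_
    have : n ≤ p ^ 2 := by
      rw [sq]
      exact hlt.le.trans (Nat.mul_le_mul_right _ hqj)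
    exact_mod_cast this

end Interpolation

end Lamplighter

namespace Lamplighter

/-! ### Limits of the rescaled distance. -/

section ScaledDist

/-- Almost surely the events in question eventually fail, so their indicators tend to 0 and bounded
convergence applies. -/
theorem tendsto_measure_scaledDist_le {V : Type*} [Countable V] {G : SimpleGraph V}
    {Q : LampState V → PMF (LampState V)} {R : ℝ} {s : LampState V}
    (h : ∀ᵐ Y ∂chainLaw Q s,
      (R : EReal) ≤ liminf (fun n : ℕ => (scaledDist G Y n : EReal)) atTop) {ε : ℝ} (hε : 0 < ε) :
    Tendsto (fun n : ℕ => chainLaw Q s {Y | (scaledDist G Y n : EReal) ≤ ((R - ε : ℝ) : EReal)})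
      atTop (𝓝 0) := by
  have := isProbabilityMeasure_chainLaw Q s
  have hmeas : ∀ n : ℕ, MeasurableSet
      {Y : ℕ → LampState V | (scaledDist G Y n : EReal) ≤ ((R - ε : ℝ) : EReal)} := fun n =>
    measurableSet_setOfPred.2 (measurable_of_dependsOn (n := n) fun Y Y' hYY => by
      have h0 := hYY 0 (by simp)
      have hn := hYY n (by simp)
      simp only [scaledDist, h0, hn])
  have hlim : ∀ᵐ Y ∂chainLaw Q s, ∀ᶠ n : ℕ in atTop,
      (Y ∈ {Y : ℕ → LampState V | (scaledDist G Y n : EReal) ≤ ((R - ε : ℝ) : EReal)} ↔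
        Y ∈ (∅ : Set (ℕ → LampState V))) := by
    filter_upwards [h] with Y hY
    have hlt : ((R - ε : ℝ) : EReal) < liminf (fun n : ℕ => (scaledDist G Y n : EReal)) atTop :=
      lt_of_lt_of_le (EReal.coe_lt_coe_iff.2 (by linarith)) hY
    filter_upwards [eventually_lt_of_lt_liminf hlt] with n hn
    simpa using hn
  simpa using tendsto_measure_of_ae_tendsto_indicator_of_isFiniteMeasure atTop MeasurableSet.empty
    hmeas hlim

variable {V : Type*} {G : SimpleGraph V} [G.LocallyFinite] {Δ : ℕ}
  {Q : LampState V → PMF (LampState V)}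

theorem dist_bounds (hQ : IsLamplighterStep G Δ Q) {Y : ℕ → LampState V}
    (hY : ∀ n, Q (Y n) (Y (n + 1)) ≠ 0) (n : ℕ) :
    diffCount (Y 0) (Y n) ≤ (wreath G).dist (Y 0) (Y n) ∧
      (wreath G).dist (Y 0) (Y n) ≤ 5 * (visited n (posPath Y)).card := by
  obtain ⟨q, hq⟩ := exists_wreath_walk_visited (G := G) (Y := Y)
    (fun i => (hQ.pos_step _ _ (hY i)).imp Eq.symm id) n (support_sub_subset_visited hQ hY n)
  exact ⟨diffCount_le_dist q.reachable, (SimpleGraph.dist_le q).trans hq⟩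

theorem natCast_div_log_pos {n : ℕ} (hn : 2 ≤ n) : (0 : ℝ) < n / Real.log n := by
  have hn' : (1 : ℝ) < n := by exact_mod_cast hn
  have := Real.log_pos hn'
  positivity

theorem scaledDist_nonneg (G : SimpleGraph V) (Y : ℕ → LampState V) (n : ℕ) :
    0 ≤ scaledDist G Y n := by
  have := Real.log_natCast_nonneg n
  rw [scaledDist]
  positivity

variable [Countable V] [Nonempty V] [MeasurableSpace V] [DiscreteMeasurableSpace V]

theorem ae_limsup_scaledDist_le (hQ : IsLamplighterStep G Δ Q) {R : ℝ} (hR : rSup G = R)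
    (s : LampState V) :
    ∀ᵐ Y ∂chainLaw Q s,
      limsup (fun n : ℕ => (scaledDist G Y n : EReal)) atTop ≤ ((5 * R : ℝ) : EReal) := by
  have hρ : ∀ k : ℕ, ∀ᵐ Y ∂chainLaw Q s, ∀ᶠ n : ℕ in atTop,
      ((visited n (posPath Y)).card : ℝ) < (R + 1 / ((k : ℝ) + 1)) * (n / Real.log n) := fun k =>
    ae_eventually_card_visited_lt hQ (by
      rw [hR, EReal.coe_lt_coe_iff]; linarith [Nat.one_div_pos_of_nat (α := ℝ) (n := k)]) s
  filter_upwards [ae_all_iff.2 hρ, ae_step_ne_zero Q s] with Y hY hstep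
  have hlim : Tendsto (fun k : ℕ => ((5 * (R + 1 / ((k : ℝ) + 1)) : ℝ) : EReal)) atTop
      (𝓝 ((5 * R : ℝ) : EReal)) := by
    refine (continuous_coe_real_ereal.tendsto _).comp ?_
    simpa using (tendsto_one_div_add_atTop_nhds_zero_nat (𝕜 := ℝ)).const_add R |>.const_mul 5
  refine ge_of_tendsto' hlim fun k => limsup_le_of_le (by isBoundedDefault) ?_
  filter_upwards [hY k, eventually_ge_atTop 2] with n hn hn2
  rw [EReal.coe_le_coe_iff, scaledDist, div_le_iff₀ (natCast_div_log_pos hn2)]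
  have h : ((wreath G).dist (Y 0) (Y n) : ℝ) ≤ 5 * (visited n (posPath Y)).card := by
    exact_mod_cast (dist_bounds hQ hstep n).2
  linarith

theorem ae_le_liminf_scaledDist (hQ : IsLamplighterStep G Δ Q) (hpos : ∀ v, 1 ≤ G.degree v)
    (hΔ : ∀ v, G.degree v ≤ Δ) (hG : UniformlyWeaklyRecurrent G) {R : ℝ} (hR : rInf G = R)
    (s : LampState V) :
    ∀ᵐ Y ∂chainLaw Q s,
      ((R / 4 : ℝ) : EReal) ≤ liminf (fun n : ℕ => (scaledDist G Y n : EReal)) atTop := by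
  have hkey : ∀ k : ℕ, ∀ᵐ Y ∂chainLaw Q s, ((R / 4 - 1 / ((k : ℝ) + 1) : ℝ) : EReal) ≤
      liminf (fun n : ℕ => (scaledDist G Y n : EReal)) atTop := by
    intro k
    set y := R / 4 - 1 / ((k : ℝ) + 1) with hy
    -- A nonpositive level is trivial; the lower tail estimate needs a positive rate `r`.
    rcases le_or_gt y 0 with hy0 | hy0
    · refine Eventually.of_forall fun Y => le_liminf_of_le (by isBoundedDefault)
        (Eventually.of_forall fun n => ?_)
      exact EReal.coe_le_coe_iff.2 (hy0.trans (scaledDist_nonneg G Y n))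
    have hk : (0 : ℝ) < 1 / ((k : ℝ) + 1) := Nat.one_div_pos_of_nat
    obtain ⟨r, hyr, hrR⟩ := exists_between (show y < R / 4 by linarith)
    have hr0 : 0 < r := hy0.trans hyr
    have hr : ((4 * r : ℝ) : EReal) < rInf G := by
      rw [hR, EReal.coe_lt_coe_iff]; linarith
    obtain ⟨C, hC0, hC⟩ := exists_rSup_le G hG
    have hρ : rSup G < ((C + 1 : ℝ) : EReal) := hC.trans_lt (by exact_mod_cast lt_add_one C)
    -- A mesh so fine that the interpolation loss `(r + 2 (C + 1)) / q` fits between `y` and `r`.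
    obtain ⟨q, hq⟩ := exists_nat_gt ((r + 2 * (C + 1)) / (r - y))
    have hq0 : (0 : ℝ) < q := lt_of_le_of_lt (by have := sub_pos.2 hyr; positivity) hq
    have hq1 : 1 ≤ q := by exact_mod_cast hq0
    have hyq : y ≤ r - (r + 2 * (C + 1)) / q := by
      rw [div_lt_iff₀ (sub_pos.2 hyr)] at hq
      have : (r + 2 * (C + 1)) / q ≤ r - y := by rw [div_le_iff₀ hq0]; linarith
      linarith
    filter_upwards [ae_step_ne_zero Q s,
      (ae_ball_iff (Finset.Ico q (2 * q)).countable_toSet).2 fun i hi =>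
        ae_eventually_dyadic_lt_diffCount hQ hpos hΔ hG hr0 hr s
          (hq1.trans (Finset.mem_Ico.1 (Finset.mem_coe.1 hi)).1),
      ae_all_iff.2 fun i => ae_eventually_dyadic_visited_lt hQ hρ s i] with Y hY h1 h2
    refine le_liminf_of_le (by isBoundedDefault) ?_
    filter_upwards [eventually_le_diffCount_of_dyadic hQ hY hr0.le (by positivity) hq1 h1
      fun i _ => h2 i, eventually_ge_atTop 2] with n hn hn2
    have hpos' := natCast_div_log_pos hn2
    rw [EReal.coe_le_coe_iff, scaledDist, le_div_iff₀ hpos']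
    have h3 : (diffCount (Y 0) (Y n) : ℝ) ≤ (wreath G).dist (Y 0) (Y n) := by
      exact_mod_cast (dist_bounds hQ hY n).1
    exact (mul_le_mul_of_nonneg_right hyq hpos'.le).trans (hn.trans h3)
  filter_upwards [ae_all_iff.2 hkey] with Y hY
  have hlim : Tendsto (fun k : ℕ => ((R / 4 - 1 / ((k : ℝ) + 1) : ℝ) : EReal)) atTop
      (𝓝 ((R / 4 : ℝ) : EReal)) := by
    refine (continuous_coe_real_ereal.tendsto _).comp ?_
    simpa using (tendsto_one_div_add_atTop_nhds_zero_nat (𝕜 := ℝ)).const_sub (R / 4)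
  exact le_of_tendsto' hlim hY

end ScaledDist

end Lamplighter
/-- The transition probabilities `Q` are those of the simple random walk on the graph `{0,1} ≀ G`,
or those of the switch-walk-switch lamplighter walk; the result holds for both. -/
theorem mainTheorem8 {V : Type*} [Infinite V] [MeasurableSpace V] [DiscreteMeasurableSpace V]
    (G : SimpleGraph V) [G.LocallyFinite] (hconn : G.Connected)
    (hdeg : BddAbove (Set.range fun v : V => G.degree v))
    (hG : UniformlyWeaklyRecurrent G)
    (Q : LampState V → PMF (LampState V)) (hQ : Q = srwStep (wreath G) ∨ Q = swsStep G)
    (x : LampState V) :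
    (∀ᵐ Y ∂(chainLaw Q x),
        limsup (fun n : ℕ => (scaledDist G Y n : EReal)) atTop ≤
          ((2 * (⨆ v : V, G.degree v) + 1 : ℕ) : EReal) * rSup G) ∧
      (∀ ε : ℝ, 0 < ε →
        Tendsto (fun n : ℕ => chainLaw Q x
          {Y | (scaledDist G Y n : EReal) ≤ rInf G / 4 - (ε : EReal)}) atTop (𝓝 0)) ∧
      ((∃ d : ℝ, 0 < d ∧ AhlforsRegular G d) →
        ∀ᵐ Y ∂(chainLaw Q x),
          rInf G / 4 ≤ liminf (fun n : ℕ => (scaledDist G Y n : EReal)) atTop) := by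
  have : Countable V := countable_of_connected G hconn
  have : Nonempty V := hconn.nonempty
  set Δ := ⨆ v : V, G.degree v with hΔdef
  have hΔ : ∀ v, G.degree v ≤ Δ := fun v => le_ciSup hdeg v
  have hpos : ∀ v, 1 ≤ G.degree v := fun v => hconn.preconnected.degree_pos_of_nontrivial v
  have hstep : IsLamplighterStep G Δ Q := by
    rcases hQ with rfl | rfl
    · exact isLamplighterStep_srw G hpos hΔ
    · exact isLamplighterStep_sws G hpos Δ
  have h0 : 0 ≤ rInf G := rInf_nonneg G
  have hle : rInf G ≤ rSup G := rInf_le_rSup G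
  obtain ⟨C, -, hC⟩ := exists_rSup_le G hG
  obtain ⟨Rs, hRs⟩ : ∃ R : ℝ, rSup G = R :=
    ⟨_, (EReal.coe_toReal (hC.trans_lt (EReal.coe_lt_top C)).ne
      (EReal.bot_lt_zero.trans_le (h0.trans hle)).ne').symm⟩
  obtain ⟨Ri, hRi⟩ : ∃ R : ℝ, rInf G = R :=
    ⟨_, (EReal.coe_toReal ((hle.trans hC).trans_lt (EReal.coe_lt_top C)).ne
      (EReal.bot_lt_zero.trans_le h0).ne').symm⟩
  have hRs0 : 0 ≤ Rs := by
    have := h0.trans hle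
    rw [hRs] at this
    exact_mod_cast this
  have hdiv : rInf G / 4 = ((Ri / 4 : ℝ) : EReal) := by
    rw [hRi, EReal.coe_div]
    rfl
  have hlower := ae_le_liminf_scaledDist hstep hpos hΔ hG hRi x
  refine ⟨?_, fun ε hε => ?_, fun _ => ?_⟩
  · filter_upwards [ae_limsup_scaledDist_le hstep hRs x] with Y hY
    refine hY.trans ?_
    -- The distance bound gives the constant 5, and `Δ ≥ 2` turns it into `2 Δ + 1`.
    obtain ⟨v, hv⟩ := exists_two_le_degree G hconn
    have hΔ2 : (2 : ℝ) ≤ Δ := by exact_mod_cast hv.trans (hΔ v)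
    have e : ((2 * Δ + 1 : ℕ) : EReal) * rSup G = (((2 * Δ + 1) * Rs : ℝ) : EReal) := by
      rw [hRs, EReal.coe_mul]
      norm_cast
    rw [e, EReal.coe_le_coe_iff]
    exact mul_le_mul_of_nonneg_right (by linarith) hRs0
  · rw [hdiv, ← EReal.coe_sub]
    exact tendsto_measure_scaledDist_le hlower hε
  · rw [hdiv]
    exact hlower
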